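/- Let $k$ be a field of characteristic zero, $Z$ a smooth scheme over $k$, and $X \hookrightarrow Z$ an embedded hypersurface (a closed subscheme locally defined by one equation that is not a zero divisor). Let $a \in X$. We say that $a$ is a *pinch point* of $X$ if, in suitable étale local coordinates $(x,y,z,\ldots)$ for $Z$ at $a$ (at least three of them; i.e. a regular system of parameters at a point over $a$ of some étale neighbourhood of $a$), $X$ is defined by $z^2+xy^2=0$; and a *degenerate pinch point* if, likewise, $X$ is defined by $z^2+(y+2x^2)(y-x^2)^2=0$. Let $\mathrm{inv}(a)$ denote the desingularization invariant of $X$ at $a$ in year zero (that is, before any blowing-up), computed in the local ring of $Z$ at $a$ as follows. Put $(\mathcal I^0,d_0)=(\mathcal I_{X,a},1)$. Given a marked ideal $(\mathcal I^j,d_j)$ on a regular germ $N^j$ of codimension $j$: if $\mathcal I^j=0$, put $\nu_{j+1}=\infty$ and stop; otherwise let $m=\mathrm{ord}_a\mathcal I^j$ and $\nu_{j+1}=m/d_j$, choose a maximal contact hypersurface $N^{j+1}=V(w)\subset N^j$ of $(\mathcal I^j,m)$ (i.e. $\mathrm{ord}_a w=1$ and $w$ lies in the ideal generated by the derivatives of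 order $\le m-1$ of the elements of $\mathcal I^j$) and local coordinates of $N^j$ including $w$, and let $(\mathcal I^{j+1},d_{j+1})$ be the restriction to $N^{j+1}$ of the coefficient ideal $\sum_{r=0}^{m-1}\big(\mathcal D_w^{r}(\mathcal I^j),\,m-r\big)$. Here $\mathcal D_w(\mathcal I)$ is generated by $f,\ \partial f/\partial w$ for $f\in\mathcal I$, and $\sum_r(\mathcal J_r,e_r):=\big(\sum_r\mathcal J_r^{\,l/e_r},\,l\big)$ with $l=\mathrm{lcm}_r(e_r)$. Then $\mathrm{inv}(a)=(\nu_1,0,\nu_2,0,\ldots,\nu_q,0,\infty)$, which is independent of the choices. (The zeros are the entries $s_j(a)$, which count exceptional divisors.) Then: 1. $a$ is a pinch point if and only if $\mathrm{inv}(a)=(2,0,3/2,0,1,0,\infty)$ and $\mathrm{Sing}\,X$ has codimension $2$ in $Z$ at $a$; 2. $a$ is a degenerate pinch point if and only if $\mathrm{inv}(a)=(2,0,3/2,0,2,0,\infty)$ and $\mathrm{Sing}\,X$ has codimension $2$ in $Z$ at $a$. -/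

import Mathlib

open AlgebraicGeometry CategoryTheory

universe u

noncomputable section

namespace YearZero

/-! ### The invariant of a marked ideal in a regular local `k`-algebra, without boundary

Throughout, `(R, 𝔪)` is a regular local ring with structure map `φ : k →+* R`; the maximal ideal is
carried as an explicit ideal so that one can pass to quotients `R ⧸ (z)`. -/

/-- The order of an ideal `I`: the largest `m` with `I ≤ 𝔪 ^ m` (`⊤` if there is none). -/
def idealOrder {R : Type u} [CommRing R] (𝔪 I : Ideal R) : ℕ∞ :=
  ⨆ m ∈ {m : ℕ | I ≤ 𝔪 ^ m}, (m : ℕ∞)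

/-- A derivation of `R` that is `k`-linear, i.e. that kills the image of `k`. -/
def IsLinearOver {k R : Type u} [Field k] [CommRing R] (φ : k →+* R)
    (D : Derivation ℤ R R) : Prop :=
  ∀ c : k, D (φ c) = 0

/-- `I` together with all first derivatives of its elements. -/
def derivClosure {k R : Type u} [Field k] [CommRing R] (φ : k →+* R) (I : Ideal R) : Ideal R :=
  I ⊔ Ideal.span {g | ∃ D : Derivation ℤ R R, IsLinearOver φ D ∧ ∃ f ∈ I, D f = g}

/-- `z` defines a maximal contact hypersurface for the marked ideal `(I, d)` of maximal order
`d ≥ 1`: it has order one, and it is a section of the ideal generated by the partial derivatives of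
order at most `d - 1` of the elements of `I`. -/
def IsMaximalContact {k R : Type u} [Field k] [CommRing R] (φ : k →+* R) (𝔪 I : Ideal R) (d : ℕ)
    (z : R) : Prop :=
  idealOrder 𝔪 (Ideal.span {z}) = 1 ∧ z ∈ (derivClosure φ)^[d - 1] I

/-- `D` is the partial derivative `∂ / ∂z` with respect to some local coordinate system
`(x₁, …, xₙ, z)`, that is, a regular system of parameters of `R` whose last member is `z`. -/
def IsPartialDerivative {k R : Type u} [Field k] [CommRing R] (φ : k →+* R) (𝔪 : Ideal R) (z : R)
    (D : Derivation ℤ R R) : Prop :=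
  ∃ (n : ℕ) (x : Fin n → R),
    ringKrullDim R = ((n + 1 : ℕ) : WithBot ℕ∞) ∧
    Ideal.span (insert z (Set.range x)) = 𝔪 ∧
    IsLinearOver φ D ∧ (∀ j, D (x j) = 0) ∧ D z = 1

/-- `𝒟_z(I)`, generated by `f` and `∂f/∂z` for all `f ∈ I`. -/
def partialClosure {R : Type u} [CommRing R] (D : Derivation ℤ R R) (I : Ideal R) : Ideal R :=
  I ⊔ Ideal.span (D '' I)

/-- The multiplicity attached to the sum of marked ideals `∑_{j < d} (𝒟_z^j(I), d - j)`. -/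
def coeffMultiplicity (d : ℕ) : ℕ :=
  (Finset.range d).lcm (fun j => d - j)

/-- The ideal of the sum of marked ideals `∑_{j < d} (𝒟_z^j(I), d - j)`: if `l` is the least common
multiple of the `d - j`, it is the sum of the ideals `𝒟_z^j(I) ^ (l / (d - j))`. -/
def coeffIdeal {R : Type u} [CommRing R] (D : Derivation ℤ R R) (d : ℕ) (I : Ideal R) : Ideal R :=
  ⨆ j ∈ Finset.range d, ((partialClosure D)^[j] I) ^ (coeffMultiplicity d / (d - j))

/-- `HasInv φ 𝔪 I d s`: the sequence `s = (ν₁, 0, ν₂, 0, …, ν_q, 0, ∞)` is obtained from the marked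
ideal `(I, d)` by some sequence of choices in the inductive construction of the desingularization
invariant in year zero (empty boundary, so that every `s_k` is `0`):
* if `I = 0`, the sequence is `(∞)`;
* if `I` has order `m`, then `ν = m / d`, and one passes from `(I, d)` to `(I, m)`, chooses a maximal
  contact hypersurface `P = V(z)` for `(I, m)` and coordinates `(x, z)`, and continues with the
  restriction to `P` of the coefficient ideal of `(I, m)`. -/
inductive HasInv {k : Type u} [Field k] : ∀ {R : Type u} [CommRing R],
    (k →+* R) → Ideal R → Ideal R → ℕ → List (WithTop ℚ) → Prop
  | zero {R : Type u} [CommRing R] (φ : k →+* R) (𝔪 : Ideal R) (d : ℕ) :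
      HasInv φ 𝔪 ⊥ d [⊤]
  | step {R : Type u} [CommRing R] (φ : k →+* R) (𝔪 I : Ideal R) (d m : ℕ) (z : R)
      (D : Derivation ℤ R R) (s : List (WithTop ℚ))
      (hm : 0 < m) (hI : idealOrder 𝔪 I = m)
      (hz : IsMaximalContact φ 𝔪 I m z) (hD : IsPartialDerivative φ 𝔪 z D)
      (h : HasInv ((Ideal.Quotient.mk (Ideal.span {z})).comp φ)
        (𝔪.map (Ideal.Quotient.mk (Ideal.span {z})))
        ((coeffIdeal D m I).map (Ideal.Quotient.mk (Ideal.span {z})))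
        (coeffMultiplicity m) s) :
      HasInv φ 𝔪 I d ((((m : ℚ) / (d : ℚ) : ℚ) : WithTop ℚ) :: 0 :: s)

/-! ### Hypersurfaces in smooth schemes over a field -/

/-- The structure map from `k` to the local ring of a `k`-scheme at a point. -/
def scalars {k : Type u} [Field k] {Z : Scheme.{u}} (p : Z ⟶ Spec (CommRingCat.of k)) (a : Z) :
    k →+* Z.presheaf.stalk a :=
  ((Scheme.ΓSpecIso (CommRingCat.of k)).inv ≫ p.appTop ≫ Z.presheaf.germ ⊤ a trivial).hom

/-- The ideal of the closed subscheme `i : X ⟶ Z` in the local ring of `Z` at `i x`. -/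
def stalkIdeal {X Z : Scheme.{u}} (i : X ⟶ Z) (x : X) : Ideal (Z.presheaf.stalk (i x)) :=
  RingHom.ker (i.stalkMap x).hom

/-- `X` is locally defined in `Z` by one equation, which is not a zero divisor. -/
def IsHypersurface {X Z : Scheme.{u}} (i : X ⟶ Z) : Prop :=
  ∀ x : X, ∃ f ∈ nonZeroDivisors (Z.presheaf.stalk (i x)), stalkIdeal i x = Ideal.span {f}

open Classical in
/-- The desingularization invariant `inv_X(a)` in year zero, `a = i x`: the common value of all
sequences of choices in the construction, starting from the marked ideal `(ℐ_X, 1)`. (The junk value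
`[]`, if the choices did not lead to exactly one sequence, is not of the form
`(ν₁, 0, …, ν_q, 0, ∞)`.) -/
def inv {k : Type u} [Field k] {X Z : Scheme.{u}} (p : Z ⟶ Spec (CommRingCat.of k)) (i : X ⟶ Z)
    (x : X) : List (WithTop ℚ) :=
  if h : ∃! s, HasInv (scalars p (i x)) (IsLocalRing.maximalIdeal (Z.presheaf.stalk (i x)))
      (stalkIdeal i x) 1 s
  then h.choose else []

/-- The singular subset of `X`: the points whose local ring is not regular. -/
def singularSet (X : Scheme.{u}) : Set X :=
  {y | ¬ IsRegularLocalRing (X.presheaf.stalk y)}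

/-- The codimension in `Z`, at the point `i x`, of the image of a closed subset `S` of `X`: the least
codimension in `Z` of an irreducible closed subset of `S` through `x` (the codimension of the closure
of `y` being the dimension of the local ring of `Z` at `y`), and `⊤` if `x ∉ S`. -/
def codimAt {X Z : Scheme.{u}} (i : X ⟶ Z) (S : Set X) (x : X) : WithBot ℕ∞ :=
  ⨅ y ∈ {y : X | y ∈ S ∧ y ⤳ x}, ringKrullDim (Z.presheaf.stalk (i y))

/-- In suitable étale local coordinates `(t₀, t₁, t₂, …)` for `Z` at `i x`, in number at least three,
`X` is defined by the equation `F(t₀, t₁, t₂) = 0`: there are an étale morphism `ψ : U ⟶ Z`, a point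
`b` of `U` over `i x`, and a regular system of parameters of `U` at `b` such that the ideal of `X` is
generated by `F(t₀, t₁, t₂)` in the local ring of `U` at `b`. -/
def HasEtaleEquation {X Z : Scheme.{u}} (i : X ⟶ Z) (x : X) (F : MvPolynomial (Fin 3) ℤ) : Prop :=
  ∃ (U : Scheme.{u}) (ψ : U ⟶ Z) (_ : Etale ψ) (b : U) (hb : ψ b = i x) (n : ℕ)
    (t : Fin (n + 3) → U.presheaf.stalk b),
    ringKrullDim (U.presheaf.stalk b) = ((n + 3 : ℕ) : WithBot ℕ∞) ∧
    Ideal.span (Set.range t) = IsLocalRing.maximalIdeal (U.presheaf.stalk b) ∧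
    (stalkIdeal i x).map
        (Z.presheaf.stalkSpecializes (specializes_of_eq hb) ≫ ψ.stalkMap b).hom =
      Ideal.span {MvPolynomial.aeval ![t 0, t 1, t 2] F}

/-- Pinch point (in any number `≥ 3` of variables): `z² + x y² = 0`. -/
def IsPinchPoint {X Z : Scheme.{u}} (i : X ⟶ Z) (x : X) : Prop :=
  HasEtaleEquation i x
    (MvPolynomial.X 2 ^ 2 + MvPolynomial.X 0 * MvPolynomial.X 1 ^ 2)

/-- Degenerate pinch point (in any number `≥ 3` of variables):
`z² + (y + 2 x²) (y - x²)² = 0`. -/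
def IsDegeneratePinchPoint {X Z : Scheme.{u}} (i : X ⟶ Z) (x : X) : Prop :=
  HasEtaleEquation i x
    (MvPolynomial.X 2 ^ 2 + (MvPolynomial.X 1 + 2 * MvPolynomial.X 0 ^ 2) *
      (MvPolynomial.X 1 - MvPolynomial.X 0 ^ 2) ^ 2)

end YearZero

end

set_option linter.unusedSectionVars false

namespace YearZero

/-! ### Ideals under derivations -/

section Derivations

variable {k R : Type u} [Field k] [CommRing R] {φ : k →+* R}

/-! The local ring of `Z` at a point is treated through one property (`Germ`): the maximal ideal has
`n` generators with dual `k`-derivations. In characteristic zero the derivations detect the order of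
an element, by Euler's identity. Such rings are domains of dimension `n`, and the property passes to
coordinate hypersurfaces and to étale neighbourhoods. No completion or power series is needed.

Model to invariant. Both equations have the form `z² + c w² = 0`, where `(w, c) = (w, x^q)` and `q =
1` for the pinch point, `q = 2` for the degenerate one. On any maximal contact hypersurface the
equation becomes `w² c'` with `(w, c') = (w, c)`, and the coefficient ideal lies between `(w² c')`
and `(w, c')³`. So it has order 3, which gives `3/2`. The next coefficient ideal is `(t)^(6q)` for a
coordinate `t`, with multiplicity 6, which gives `q` and then `∞` (`hasInv_sq_add`, `hasInv_two`).
The computation covers every choice, and choices pull back along étale maps (`hasInv_map`). As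
choices always exist, `inv` is well defined at these points. The singular locus is `z = w = 0`.

Invariant and codimension to model. Codimension 2 supplies a prime `P` of height at most 2 with `f ∈
P² R_P`. A maximal contact `z` lies in `P`. On `V(z)` the invariant says that the coefficient ideal
`C` consists of binary cubics in `(ζ, t^q)` that are not all multiples of one cube modulo higher
terms. Since `C` and its first derivatives lie in `P`, an argument on binary cubics
(`exists_linear_mem`) shows that `P` contains some `y = ζ - ρ t^q`. Hence `P = (z, y)` by height and
`f` is a quadric in `z, y`. Completing the square gives `z² + (α y + l t^q + γ z) y²` up to a unit,
with `l` a unit, and `α` a unit when `q = 2` (`exists_normal_form`). For `q = 1` the bracket is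
itself a coordinate. For `q = 2` a rescaling by a square root of `3 / l` gives the model, and only
this root requires an étale cover. -/

theorem derivation_sum_apply {ι : Type*} (s : Finset ι) (d : ι → Derivation ℤ R R) (f : R) :
    (∑ i ∈ s, d i) f = ∑ i ∈ s, d i f := by
  rw [← Derivation.coeFnAddMonoidHom_apply, map_sum, Finset.sum_apply]
  rfl

theorem derivation_mem_pow (J : Ideal R) (D : Derivation ℤ R R) (q : ℕ) {f : R}
    (hf : f ∈ J ^ (q + 1)) : D f ∈ J ^ q := by
  induction q generalizing f with
  | zero => simp
  | succ q ih =>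
    rw [pow_succ] at hf
    induction hf using Submodule.mul_induction_on' with
    | mem_mul_mem a ha b hb =>
      rw [D.leibniz, smul_eq_mul, smul_eq_mul]
      refine Ideal.add_mem _ (Ideal.mul_mem_right _ _ ha) ?_
      rw [pow_succ']
      exact Ideal.mul_mem_mul hb (ih ha)
    | add a _ b _ iha ihb => rw [map_add]; exact Ideal.add_mem _ iha ihb

theorem derivation_mem_sup_span {I : Ideal R} {s : Set R} {D : Derivation ℤ R R} (J : Ideal R)
    (hI : I ≤ J) (hs : I = Ideal.span s) (h : ∀ f ∈ s, D f ∈ J) {f : R} (hf : f ∈ I) : D f ∈ J := by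
  subst hs
  induction hf using Submodule.span_induction with
  | mem f hf => exact h f hf
  | zero => simp
  | add a b _ _ ha hb => rw [map_add]; exact Ideal.add_mem _ ha hb
  | smul r a ha h =>
    rw [smul_eq_mul, D.leibniz]
    exact Ideal.add_mem _ (Ideal.mul_mem_left _ _ h) (Ideal.mul_mem_right _ _ (hI ha))

theorem le_derivClosure (I : Ideal R) : I ≤ derivClosure φ I := le_sup_left

theorem derivation_mem_derivClosure {I : Ideal R} {D : Derivation ℤ R R} (hD : IsLinearOver φ D)
    {f : R} (hf : f ∈ I) : D f ∈ derivClosure φ I :=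
  Ideal.mem_sup_right (Ideal.subset_span ⟨D, hD, f, hf, rfl⟩)

theorem derivClosure_le_iff {I J : Ideal R} : derivClosure φ I ≤ J ↔
    I ≤ J ∧ ∀ D : Derivation ℤ R R, IsLinearOver φ D → ∀ f ∈ I, D f ∈ J := by
  rw [derivClosure, sup_le_iff, Ideal.span_le]
  refine and_congr_right fun _ => ⟨fun h D hD f hf => h ⟨D, hD, f, hf, rfl⟩, ?_⟩
  rintro h _ ⟨D, hD, f, hf, rfl⟩
  exact h D hD f hf

theorem partialClosure_le_iff {I J : Ideal R} {D : Derivation ℤ R R} : partialClosure D I ≤ J ↔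
    I ≤ J ∧ ∀ f ∈ I, D f ∈ J := by
  rw [partialClosure, sup_le_iff, Ideal.span_le]
  refine and_congr_right fun _ => ⟨fun h f hf => h ⟨f, hf, rfl⟩, ?_⟩
  rintro h _ ⟨f, hf, rfl⟩
  exact h f hf

theorem derivation_mem_partialClosure {I : Ideal R} {D : Derivation ℤ R R}
    {f : R} (hf : f ∈ I) : D f ∈ partialClosure D I :=
  Ideal.mem_sup_right (Ideal.subset_span ⟨f, hf, rfl⟩)

theorem le_partialClosure (I : Ideal R) (D : Derivation ℤ R R) : I ≤ partialClosure D I :=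
  le_sup_left

theorem derivClosure_mono {I J : Ideal R} (h : I ≤ J) : derivClosure φ I ≤ derivClosure φ J :=
  derivClosure_le_iff.2 ⟨h.trans (le_derivClosure J),
    fun _ hD _ hf => derivation_mem_derivClosure hD (h hf)⟩

theorem partialClosure_mono {I J : Ideal R} (D : Derivation ℤ R R) (h : I ≤ J) :
    partialClosure D I ≤ partialClosure D J :=
  partialClosure_le_iff.2 ⟨h.trans (le_partialClosure J D),
    fun _ hf => derivation_mem_partialClosure (h hf)⟩

/-- Filtration principle behind the containments of iterated derivatives. It is applied to the
powers of an ideal and to the filtrations `A ^ p ⊔ 𝔪 * J ^ p`. -/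
theorem iterate_derivClosure_le {W : ℕ → Ideal R} (hW : ∀ q, derivClosure φ (W (q + 1)) ≤ W q)
    {I : Ideal R} (q j : ℕ) (hI : I ≤ W (q + j)) : (derivClosure φ)^[j] I ≤ W q := by
  induction j generalizing q with
  | zero => simpa using hI
  | succ j ih =>
    rw [Function.iterate_succ_apply']
    exact (derivClosure_mono (ih (q + 1) (by rwa [add_right_comm]))).trans (hW q)

theorem iterate_partialClosure_le {W : ℕ → Ideal R} {D : Derivation ℤ R R}
    (hW : ∀ q, partialClosure D (W (q + 1)) ≤ W q)
    {I : Ideal R} (q j : ℕ) (hI : I ≤ W (q + j)) : (partialClosure D)^[j] I ≤ W q := by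
  induction j generalizing q with
  | zero => simpa using hI
  | succ j ih =>
    rw [Function.iterate_succ_apply']
    exact (partialClosure_mono D (ih (q + 1) (by rwa [add_right_comm]))).trans (hW q)

theorem derivClosure_pow_le (J : Ideal R) (q : ℕ) : derivClosure φ (J ^ (q + 1)) ≤ J ^ q :=
  derivClosure_le_iff.2 ⟨Ideal.pow_le_pow_right (Nat.le_succ q),
    fun D _ _ hf => derivation_mem_pow J D q hf⟩

theorem partialClosure_pow_le (J : Ideal R) (D : Derivation ℤ R R) (q : ℕ) :
    partialClosure D (J ^ (q + 1)) ≤ J ^ q :=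
  partialClosure_le_iff.2 ⟨Ideal.pow_le_pow_right (Nat.le_succ q),
    fun _ hf => derivation_mem_pow J D q hf⟩

theorem iterate_derivation_mem {I : Ideal R} {D : Derivation ℤ R R} {f : R} (hf : f ∈ I) (j : ℕ) :
    D^[j] f ∈ (partialClosure D)^[j] I := by
  induction j with
  | zero => simpa using hf
  | succ j ih =>
    rw [Function.iterate_succ_apply', Function.iterate_succ_apply']
    exact derivation_mem_partialClosure ih

/-- A derivation preserving the kernel of a surjection descends to its target. -/
theorem exists_derivation_of_surjective {S : Type u} [CommRing S] (π : R →+* S)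
    (hπ : Function.Surjective π) (D : Derivation ℤ R R) (hD : ∀ f, π f = 0 → π (D f) = 0) :
    ∃ D' : Derivation ℤ S S, ∀ f, D' (π f) = π (D f) := by
  let g : S →+ S := AddMonoidHom.liftOfSurjective (π : R →+ S) hπ
    ⟨(π : R →+ S).comp (D : R →+ R), fun f hf => hD f hf⟩
  have hg : ∀ f, g (π f) = π (D f) := fun f =>
    AddMonoidHom.liftOfRightInverse_comp_apply (π : R →+ S) _ _
      ⟨(π : R →+ S).comp (D : R →+ R), fun f hf => hD f hf⟩ f
  refine ⟨Derivation.mk' g.toIntLinearMap ?_, hg⟩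
  intro a b
  obtain ⟨a, rfl⟩ := hπ a
  obtain ⟨b, rfl⟩ := hπ b
  change g (π a * π b) = π a * g (π b) + π b * g (π a)
  rw [← map_mul, hg, hg, hg, D.leibniz, map_add, smul_eq_mul, smul_eq_mul, map_mul, map_mul]

end Derivations

/-! ### Order of an ideal -/

section Order

variable {R : Type u} [CommRing R] {𝔪 I : Ideal R}

theorem le_idealOrder_iff {m : ℕ} : (m : ℕ∞) ≤ idealOrder 𝔪 I ↔ I ≤ 𝔪 ^ m := by
  constructor
  · intro h
    rcases Nat.eq_zero_or_pos m with rfl | hm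
    · simp
    by_contra hI
    have : idealOrder 𝔪 I ≤ ((m - 1 : ℕ) : ℕ∞) := by
      refine iSup₂_le fun q hq => ?_
      have : q < m := by
        by_contra hqm
        exact hI (le_trans hq (Ideal.pow_le_pow_right (not_lt.1 hqm)))
      exact_mod_cast (by omega : q ≤ m - 1)
    have := h.trans this
    have : m ≤ m - 1 := by exact_mod_cast this
    omega
  · intro h
    exact le_iSup₂ (f := fun (q : ℕ) (_ : q ∈ {m : ℕ | I ≤ 𝔪 ^ m}) => (q : ℕ∞)) m h

theorem idealOrder_eq_iff {m : ℕ} :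
    idealOrder 𝔪 I = m ↔ I ≤ 𝔪 ^ m ∧ ¬ I ≤ 𝔪 ^ (m + 1) := by
  rw [← le_idealOrder_iff, ← le_idealOrder_iff, not_le, le_antisymm_iff, and_comm]
  refine and_congr_right fun _ => ?_
  push_cast
  exact (ENat.lt_add_one_iff (ENat.natCast_ne_top m)).symm

theorem idealOrder_span_singleton_eq_one {z : R} :
    idealOrder 𝔪 (Ideal.span {z}) = 1 ↔ z ∈ 𝔪 ∧ z ∉ 𝔪 ^ 2 := by
  rw [show (1 : ℕ∞) = ((1 : ℕ) : ℕ∞) from rfl, idealOrder_eq_iff]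
  simp

end Order

/-! ### Germs: local rings with dual derivations -/

/-- `(R, 𝔪)` is a Noetherian local `k`-algebra with a system of `n` generators of `𝔪` that admits
dual `k`-derivations. -/
structure Germ {k R : Type u} [Field k] [CommRing R] (φ : k →+* R) (𝔪 : Ideal R) (n : ℕ) :
    Prop where
  isNoetherianRing : IsNoetherianRing R
  mem_iff : ∀ r, r ∈ 𝔪 ↔ ¬ IsUnit r
  exists_coords : ∃ (x : Fin n → R) (d : Fin n → Derivation ℤ R R),
    Ideal.span (Set.range x) = 𝔪 ∧ (∀ i, IsLinearOver φ (d i)) ∧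
      ∀ i j, d i (x j) = if i = j then 1 else 0

namespace Germ

variable {k R : Type u} [Field k] [CommRing R] {φ : k →+* R} {𝔪 : Ideal R} {n : ℕ}

theorem isUnit_iff (h : Germ φ 𝔪 n) {r : R} : IsUnit r ↔ r ∉ 𝔪 := by
  rw [h.mem_iff, not_not]

theorem one_notMem (h : Germ φ 𝔪 n) : (1 : R) ∉ 𝔪 := h.isUnit_iff.1 isUnit_one

theorem ne_top (h : Germ φ 𝔪 n) : 𝔪 ≠ ⊤ := (Ideal.ne_top_iff_one _).2 h.one_notMem

theorem nontrivial (h : Germ φ 𝔪 n) : Nontrivial R :=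
  ⟨0, 1, fun e => h.one_notMem (e ▸ 𝔪.zero_mem)⟩

theorem isLocalRing (h : Germ φ 𝔪 n) : IsLocalRing R := by
  have := h.nontrivial
  refine IsLocalRing.of_nonunits_add fun a b ha hb => ?_
  exact (h.mem_iff _).1 (𝔪.add_mem ((h.mem_iff _).2 ha) ((h.mem_iff _).2 hb))

theorem eq_maximalIdeal (h : Germ φ 𝔪 n) [IsLocalRing R] : 𝔪 = IsLocalRing.maximalIdeal R := by
  ext r
  rw [h.mem_iff, IsLocalRing.mem_maximalIdeal, mem_nonunits_iff]

theorem isPrime (h : Germ φ 𝔪 n) : 𝔪.IsPrime := by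
  have := h.isLocalRing
  rw [h.eq_maximalIdeal]
  infer_instance

theorem isUnit_add (h : Germ φ 𝔪 n) {a b : R} (ha : IsUnit a) (hb : b ∈ 𝔪) : IsUnit (a + b) := by
  rw [h.isUnit_iff] at ha ⊢
  exact fun hab => ha ((𝔪.add_mem_iff_left hb).1 hab)

theorem isUnit_natCast (_h : Germ φ 𝔪 n) [CharZero k] {m : ℕ} (hm : m ≠ 0) : IsUnit (m : R) := by
  have : IsUnit (m : k) := isUnit_iff_ne_zero.2 (Nat.cast_ne_zero.2 hm)
  simpa using this.map φ

theorem isUnit_ofNat (h : Germ φ 𝔪 n) [CharZero k] (m : ℕ) [m.AtLeastTwo] :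
    IsUnit (OfNat.ofNat m : R) := by
  exact h.isUnit_natCast (m := OfNat.ofNat m) (NeZero.ne (OfNat.ofNat m : ℕ))

theorem bot_of_le_pow (h : Germ φ 𝔪 n) {I : Ideal R} (hI : ∀ q, I ≤ 𝔪 ^ q) : I = ⊥ := by
  have := h.isLocalRing
  have := h.isNoetherianRing
  rw [← le_bot_iff, ← Ideal.iInf_pow_eq_bot_of_isLocalRing 𝔪 h.ne_top]
  exact le_iInf hI

/-- Nakayama's lemma. -/
theorem le_of_le_sup_mul (h : Germ φ 𝔪 n) {I J : Ideal R} (hIJ : I ≤ J ⊔ 𝔪 * I) : I ≤ J := by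
  have := h.isLocalRing
  have := h.isNoetherianRing
  refine Submodule.le_of_le_smul_of_le_jacobson_bot (IsNoetherian.noetherian I) ?_ hIJ
  rw [IsLocalRing.jacobson_eq_maximalIdeal _ bot_ne_top, h.eq_maximalIdeal]

/-- The Euler operator `∑ xᵢ dᵢ` is a derivation that is the identity on `𝔪 / 𝔪²`, hence
multiplication by `q` on `𝔪^q / 𝔪^(q+1)`. -/
theorem euler_mem (_h : Germ φ 𝔪 n) {x : Fin n → R} {d : Fin n → Derivation ℤ R R}
    (hx : Ideal.span (Set.range x) = 𝔪) (hd : ∀ i j, d i (x j) = if i = j then 1 else 0)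
    (q : ℕ) {f : R} (hf : f ∈ 𝔪 ^ q) : ∑ i, x i * d i f - q * f ∈ 𝔪 ^ (q + 1) := by
  have hxm : ∀ i, x i ∈ 𝔪 := fun i => hx ▸ Ideal.subset_span ⟨i, rfl⟩
  have h0 : ∀ f : R, ∑ i, x i * d i f ∈ 𝔪 :=
    fun f => Ideal.sum_mem _ fun i _ => Ideal.mul_mem_right _ _ (hxm i)
  have hmul : ∀ a b : R, ∑ i, x i * d i (a * b) =
      a * ∑ i, x i * d i b + b * ∑ i, x i * d i a := by
    intro a b
    simp only [Finset.mul_sum, ← Finset.sum_add_distrib]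
    refine Finset.sum_congr rfl fun i _ => ?_
    rw [(d i).leibniz, smul_eq_mul, smul_eq_mul]; ring
  have h1 : ∀ f ∈ 𝔪, ∑ i, x i * d i f - f ∈ 𝔪 ^ 2 := by
    intro f hf
    rw [← hx] at hf
    induction hf using Submodule.span_induction with
    | mem f hf =>
      obtain ⟨j, rfl⟩ := hf
      simp [hd]
    | zero => simp
    | add a b _ _ ha hb =>
      have := Ideal.add_mem _ ha hb
      convert this using 1
      simp only [map_add, mul_add, Finset.sum_add_distrib]; ring
    | smul r a ha hr =>
      rw [smul_eq_mul, hmul, show r * ∑ i, x i * d i a + a * ∑ i, x i * d i r - r * a =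
        r * (∑ i, x i * d i a - a) + a * ∑ i, x i * d i r by ring]
      refine Ideal.add_mem _ (Ideal.mul_mem_left _ _ hr) ?_
      rw [pow_two]
      exact Ideal.mul_mem_mul (hx ▸ ha) (h0 r)
  induction q generalizing f with
  | zero => simpa using h0 f
  | succ q ih =>
    rw [pow_succ] at hf
    induction hf using Submodule.mul_induction_on' with
    | mem_mul_mem a ha b hb =>
      rw [hmul]
      have e : a * ∑ i, x i * d i b + b * ∑ i, x i * d i a - ((q + 1 : ℕ) : R) * (a * b) =
        a * (∑ i, x i * d i b - b) + (∑ i, x i * d i a - q * a) * b := by push_cast; ring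
      rw [e]
      refine Ideal.add_mem _ ?_ ?_
      · have := Ideal.mul_mem_mul ha (h1 b hb)
        rwa [← pow_add] at this
      · rw [pow_succ]
        exact Ideal.mul_mem_mul (ih ha) hb
    | add a _ b _ iha ihb =>
      convert Ideal.add_mem _ iha ihb using 1
      simp only [map_add, mul_add, Finset.sum_add_distrib]; ring

/-- Euler's identity puts `q * f` into `𝔪 ^ (q + 1)`, and `q` is a unit in characteristic zero. This
criterion takes the place of Taylor expansions throughout. -/
theorem mem_pow_succ (h : Germ φ 𝔪 n) [CharZero k] {x : Fin n → R} {d : Fin n → Derivation ℤ R R}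
    (hx : Ideal.span (Set.range x) = 𝔪) (hd : ∀ i j, d i (x j) = if i = j then 1 else 0)
    {q : ℕ} (hq : q ≠ 0) {f : R} (hf : f ∈ 𝔪 ^ q) (hdf : ∀ i, d i f ∈ 𝔪 ^ q) :
    f ∈ 𝔪 ^ (q + 1) := by
  have h1 : ∑ i, x i * d i f ∈ 𝔪 ^ (q + 1) := by
    refine Ideal.sum_mem _ fun i _ => ?_
    rw [pow_succ']
    exact Ideal.mul_mem_mul (hx ▸ Ideal.subset_span ⟨i, rfl⟩) (hdf i)
  have h2 := Ideal.sub_mem _ h1 (h.euler_mem hx hd q hf)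
  rw [sub_sub_cancel] at h2
  exact (Ideal.unit_mul_mem_iff_mem _ (h.isUnit_natCast hq)).1 h2

/-- An element of order `q ≥ 1` has a first derivative of order `q - 1`. -/
theorem exists_derivation_notMem (h : Germ φ 𝔪 n) [CharZero k] {q : ℕ} (hq : q ≠ 0) {f : R}
    (hf : f ∈ 𝔪 ^ q) (hf' : f ∉ 𝔪 ^ (q + 1)) :
    ∃ D : Derivation ℤ R R, IsLinearOver φ D ∧ D f ∉ 𝔪 ^ q := by
  obtain ⟨x, d, hx, hl, hd⟩ := h.exists_coords
  by_contra! H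
  exact hf' (h.mem_pow_succ hx hd hq hf fun i => H _ (hl i))

/-- Any minimal system of generators of the maximal ideal admits dual derivations. -/
theorem exists_dual (h : Germ φ 𝔪 n) {ι : Type*} [Fintype ι] [DecidableEq ι] {t : ι → R}
    (hι : Fintype.card ι = n) (ht : Ideal.span (Set.range t) = 𝔪) :
    ∃ d : ι → Derivation ℤ R R, (∀ i, IsLinearOver φ (d i)) ∧
      ∀ i j, d i (t j) = if i = j then 1 else 0 := by
  obtain ⟨x, d, hx, hl, hd⟩ := h.exists_coords
  have hxm : ∀ i, x i ∈ 𝔪 := fun i => hx ▸ Ideal.subset_span ⟨i, rfl⟩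
  have htm : ∀ i, t i ∈ 𝔪 := fun i => ht ▸ Ideal.subset_span ⟨i, rfl⟩
  have hN : ∀ i, ∃ c : ι → R, ∑ j, c j * t j = x i := by
    intro i
    have := hxm i
    rwa [← ht, Ideal.mem_span_range_iff_exists_fun] at this
  choose N hN using hN
  have e : ι ≃ Fin n := Fintype.equivFinOfCardEq hι
  let N' : Matrix (Fin n) (Fin n) R := fun i l => N i (e.symm l)
  let M : Matrix (Fin n) (Fin n) R := fun l i => d i (t (e.symm l))
  -- Differentiating `x = N t` by the derivations dual to `x` gives `1 = N M` modulo `𝔪`. So the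
  -- Jacobian matrix `M` of `t` is invertible, and `M⁻¹` turns `d` into a system dual to `t`.
  have hNM : (N' * M).map (Ideal.Quotient.mk 𝔪) = 1 := by
    ext i l
    rw [Matrix.map_apply, Matrix.mul_apply, Matrix.one_apply]
    have h1 : d l (x i) = ∑ j, N i j * d l (t j) + ∑ j, t j * d l (N i j) := by
      rw [← hN i, map_sum, ← Finset.sum_add_distrib]
      refine Finset.sum_congr rfl fun j _ => ?_
      rw [(d l).leibniz, smul_eq_mul, smul_eq_mul]
    have h2 : ∑ j, N i j * d l (t j) = ∑ j, N' i j * M j l :=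
      (Fintype.sum_equiv e.symm _ _ fun j => rfl).symm
    have h3 : Ideal.Quotient.mk 𝔪 (∑ j, t j * d l (N i j)) = 0 :=
      Ideal.Quotient.eq_zero_iff_mem.2 (Ideal.sum_mem _ fun j _ => Ideal.mul_mem_right _ _ (htm j))
    have h4 := congrArg (Ideal.Quotient.mk 𝔪) h1
    rw [map_add, h3, add_zero, h2, hd] at h4
    rw [← h4]
    by_cases hil : i = l
    · simp [hil]
    · simp [hil, Ne.symm hil]
  have hdet : IsUnit M.det := by
    have : IsUnit (N' * M).det := by
      rw [h.isUnit_iff, ← Ideal.Quotient.eq_zero_iff_mem, RingHom.map_det]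
      change ((N' * M).map (Ideal.Quotient.mk 𝔪)).det ≠ 0
      rw [hNM, Matrix.det_one]
      have := Ideal.Quotient.nontrivial_iff.2 h.ne_top
      exact one_ne_zero
    rw [Matrix.det_mul] at this
    exact isUnit_of_mul_isUnit_right this
  refine ⟨fun i => ∑ l, M⁻¹ l (e i) • d l, fun i c => ?_, fun i j => ?_⟩
  · simp [derivation_sum_apply, hl _ c]
  · have h1 : (M * M⁻¹) (e j) (e i) = if j = i then 1 else 0 := by
      rw [Matrix.mul_nonsing_inv _ hdet, Matrix.one_apply]
      simp
    rw [Matrix.mul_apply] at h1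
    simp only [derivation_sum_apply, Derivation.coe_smul, Pi.smul_apply, smul_eq_mul]
    rw [show (if i = j then (1 : R) else 0) = if j = i then 1 else 0 by simp [eq_comm], ← h1]
    refine Finset.sum_congr rfl fun l _ => ?_
    rw [mul_comm]
    simp [M]

end Germ

theorem span_insert_eq {R : Type u} [CommRing R] {m : ℕ} (z : R) (o : Fin m → R) :
    Ideal.span (Set.range fun i : Option (Fin m) => i.elim z o) =
      Ideal.span (insert z (Set.range o)) := by
  congr 1
  ext r
  simp [Option.exists, eq_comm]

namespace Germ

variable {k R : Type u} [Field k] [CharZero k] [CommRing R] {φ : k →+* R} {𝔪 : Ideal R} {n : ℕ}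

/-- An element of order one is part of a minimal system of generators. -/
theorem exists_params (h : Germ φ 𝔪 n) {z : R} (hz : z ∈ 𝔪) (hz2 : z ∉ 𝔪 ^ 2) :
    ∃ (m : ℕ) (o : Fin m → R), n = m + 1 ∧ Ideal.span (insert z (Set.range o)) = 𝔪 := by
  obtain ⟨x, d, hx, hl, hd⟩ := h.exists_coords
  have hxm : ∀ i, x i ∈ 𝔪 := fun i => hx ▸ Ideal.subset_span ⟨i, rfl⟩
  obtain ⟨i, hi⟩ : ∃ i, d i z ∉ 𝔪 := by
    by_contra! H
    exact hz2 (h.mem_pow_succ hx hd one_ne_zero (by simpa using hz) (by simpa using H))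
  obtain ⟨m, rfl⟩ : ∃ m, n = m + 1 := ⟨n - 1, by have := i.pos; omega⟩
  refine ⟨m, fun j => x (i.succAbove j), rfl, le_antisymm ?_ ?_⟩
  · rw [Ideal.span_le]
    rintro r (rfl | ⟨j, rfl⟩)
    · exact hz
    · exact hxm _
  · have hz' := hz
    rw [← hx, Ideal.mem_span_range_iff_exists_fun] at hz'
    obtain ⟨c, hc⟩ := hz'
    -- The coefficient of `x i` in `z` is a unit, so `z` can be exchanged for `x i`.
    have hci : IsUnit (c i) := by
      have h1 : d i z = c i + ∑ j, x j * d i (c j) := by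
        rw [← hc, map_sum]
        simp only [Derivation.leibniz, hd, smul_eq_mul, Finset.sum_add_distrib]
        simp
      rw [h.isUnit_iff]
      intro hm
      apply hi
      rw [h1]
      exact Ideal.add_mem _ hm (Ideal.sum_mem _ fun j _ => Ideal.mul_mem_right _ _ (hxm j))
    rw [Fin.sum_univ_succAbove _ i] at hc
    rw [← hx, Ideal.span_le]
    rintro r ⟨j, rfl⟩
    by_cases hj : j = i
    · subst hj
      refine (Ideal.unit_mul_mem_iff_mem _ hci).1 ?_
      rw [eq_sub_of_add_eq hc]
      refine Ideal.sub_mem _ (Ideal.subset_span (Set.mem_insert _ _)) ?_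
      exact Ideal.sum_mem _ fun l _ => Ideal.mul_mem_left _ _
        (Ideal.subset_span (Set.mem_insert_of_mem _ ⟨l, rfl⟩))
    · obtain ⟨l, rfl⟩ := Fin.exists_succAbove_eq hj
      exact Ideal.subset_span (Set.mem_insert_of_mem _ ⟨l, rfl⟩)

theorem exists_dual_insert {m : ℕ} (h : Germ φ 𝔪 (m + 1)) {z : R} {o : Fin m → R}
    (ho : Ideal.span (insert z (Set.range o)) = 𝔪) :
    ∃ (D : Derivation ℤ R R) (d : Fin m → Derivation ℤ R R),
      (IsLinearOver φ D ∧ D z = 1 ∧ ∀ j, D (o j) = 0) ∧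
      (∀ i, IsLinearOver φ (d i) ∧ d i z = 0) ∧ ∀ i j, d i (o j) = if i = j then 1 else 0 := by
  obtain ⟨d, hl, hd⟩ := h.exists_dual (ι := Option (Fin m)) (t := fun i => i.elim z o)
    (by simp) ((span_insert_eq z o).trans ho)
  refine ⟨d none, fun i => d (some i), ⟨hl _, ?_, fun j => ?_⟩, fun i => ⟨hl _, ?_⟩,
    fun i j => ?_⟩
  · simpa using hd none none
  · simpa using hd none (some j)
  · simpa using hd (some i) none
  · simpa using hd (some i) (some j)

theorem notMem_sq_of_derivation (h : Germ φ 𝔪 n) {z : R} {D : Derivation ℤ R R}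
    (hD : IsUnit (D z)) : z ∉ 𝔪 ^ 2 :=
  fun hz => h.isUnit_iff.1 hD (by simpa using derivation_mem_pow 𝔪 D 1 hz)

theorem notMem_sq_of_params {m : ℕ} (h : Germ φ 𝔪 (m + 1)) {z : R} {o : Fin m → R}
    (ho : Ideal.span (insert z (Set.range o)) = 𝔪) : z ∉ 𝔪 ^ 2 := by
  obtain ⟨D, -, ⟨-, hD, -⟩, -⟩ := h.exists_dual_insert ho
  exact h.notMem_sq_of_derivation (hD ▸ isUnit_one)

theorem isUnit_mk_iff (h : Germ φ 𝔪 n) {z : R} (hz : z ∈ 𝔪) {r : R} :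
    IsUnit (Ideal.Quotient.mk (Ideal.span {z}) r) ↔ IsUnit r := by
  refine ⟨fun hr => ?_, fun hr => hr.map _⟩
  obtain ⟨s, hs⟩ := hr.exists_right_inv
  obtain ⟨s, rfl⟩ := Ideal.Quotient.mk_surjective s
  rw [← map_mul, ← map_one (Ideal.Quotient.mk (Ideal.span {z})), Ideal.Quotient.eq] at hs
  have h1 : r * s - 1 ∈ 𝔪 := (Ideal.span_singleton_le_iff_mem 𝔪).2 hz hs
  rw [h.isUnit_iff]
  intro hr
  refine h.one_notMem ?_
  have := 𝔪.sub_mem (𝔪.mul_mem_right s hr) h1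
  simpa using this

theorem mk_mem_map_iff {R : Type u} [CommRing R] {I J : Ideal R} (hJ : J ≤ I) {r : R} :
    Ideal.Quotient.mk J r ∈ I.map (Ideal.Quotient.mk J) ↔ r ∈ I := by
  rw [← Ideal.mem_comap, Ideal.comap_map_of_surjective _ Ideal.Quotient.mk_surjective,
    ← RingHom.ker_eq_comap_bot, Ideal.mk_ker, sup_eq_left.2 hJ]

/-- The derivations dual to `o` kill `z` and therefore descend modulo `z`. This stability makes
induction along maximal contact hypersurfaces possible. -/
theorem quotient {m : ℕ} (h : Germ φ 𝔪 (m + 1)) {z : R} {o : Fin m → R}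
    (ho : Ideal.span (insert z (Set.range o)) = 𝔪) :
    Germ ((Ideal.Quotient.mk (Ideal.span {z})).comp φ)
      (𝔪.map (Ideal.Quotient.mk (Ideal.span {z}))) m := by
  have hz : z ∈ 𝔪 := ho ▸ Ideal.subset_span (Set.mem_insert _ _)
  have hzm : Ideal.span {z} ≤ 𝔪 := (Ideal.span_singleton_le_iff_mem 𝔪).2 hz
  obtain ⟨-, d, -, hl, hd⟩ := h.exists_dual_insert ho
  choose d' hd' using fun i => exists_derivation_of_surjective
    (Ideal.Quotient.mk (Ideal.span {z})) Ideal.Quotient.mk_surjective (d i) fun f hf => by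
      rw [Ideal.Quotient.eq_zero_iff_mem] at hf ⊢
      refine derivation_mem_sup_span _ le_rfl rfl ?_ hf
      rintro f rfl
      rw [(hl i).2]
      exact Ideal.zero_mem _
  refine ⟨?_, fun r => ?_, fun j => Ideal.Quotient.mk _ (o j), d', ?_, fun i c => ?_, fun i j => ?_⟩
  · have := h.isNoetherianRing
    infer_instance
  · obtain ⟨r, rfl⟩ := Ideal.Quotient.mk_surjective r
    rw [h.isUnit_mk_iff hz, mk_mem_map_iff hzm, h.mem_iff]
  · rw [← ho, Ideal.map_span, Set.image_insert_eq,
      Ideal.Quotient.eq_zero_iff_mem.2 (Ideal.mem_span_singleton_self z), Ideal.span_insert_zero,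
      ← Set.range_comp]
    rfl
  · rw [RingHom.comp_apply, hd', (hl i).1, map_zero]
  · rw [hd', hd]
    split_ifs <;> simp

theorem quotient_of_order_one (h : Germ φ 𝔪 n) {z : R} (hz : z ∈ 𝔪) (hz2 : z ∉ 𝔪 ^ 2) :
    ∃ m, n = m + 1 ∧ Germ ((Ideal.Quotient.mk (Ideal.span {z})).comp φ)
      (𝔪.map (Ideal.Quotient.mk (Ideal.span {z}))) m := by
  obtain ⟨m, o, rfl, ho⟩ := h.exists_params hz hz2
  exact ⟨m, rfl, h.quotient ho⟩

theorem eq_bot_of_zero (h : Germ φ 𝔪 0) : 𝔪 = ⊥ := by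
  obtain ⟨x, d, hx, -⟩ := h.exists_coords
  simpa using hx.symm

/-- Differentiating `z ^ (q + 1) * c = 0` along `z` and dividing by `q + 1` shows that `z ^ q * c`
is a multiple of `z ^ (q + 1)`. So an element killed by `z` is divisible by every power of `z`, and
it vanishes by Krull's intersection theorem. -/
theorem mem_nonZeroDivisors {m : ℕ} (h : Germ φ 𝔪 (m + 1)) {z : R} {o : Fin m → R}
    (ho : Ideal.span (insert z (Set.range o)) = 𝔪) : z ∈ nonZeroDivisors R := by
  obtain ⟨D, -, ⟨-, hD, -⟩, -⟩ := h.exists_dual_insert ho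
  have hz : z ∈ 𝔪 := ho ▸ Ideal.subset_span (Set.mem_insert _ _)
  have key : ∀ (q : ℕ) (c : R), z ^ (q + 1) * c = 0 → ∃ c', z ^ q * c = z ^ (q + 1) * c' := by
    intro q c hc
    have h1 := congrArg D hc
    rw [D.leibniz, D.leibniz_pow, hD, map_zero] at h1
    simp only [smul_eq_mul, nsmul_eq_mul, mul_one, Nat.add_sub_cancel] at h1
    obtain ⟨u, hu⟩ := h.isUnit_natCast (Nat.succ_ne_zero q)
    rw [← Nat.succ_eq_add_one, ← hu] at h1
    refine ⟨-(↑u⁻¹ * D c), ?_⟩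
    have h2 : (↑u⁻¹ * ↑u : R) = 1 := u.inv_mul
    rw [Nat.succ_eq_add_one] at h1
    linear_combination (↑u⁻¹ : R) * h1 - z ^ q * c * h2
  rw [mem_nonZeroDivisors_iff_right]
  intro a ha
  have h1 : ∀ q, ∃ c, a = z ^ q * c := by
    intro q
    induction q with
    | zero => exact ⟨a, by simp⟩
    | succ q ih =>
      obtain ⟨c, rfl⟩ := ih
      exact key q c (by rw [← ha]; ring)
  have h2 : Ideal.span {a} = ⊥ := by
    refine h.bot_of_le_pow fun q => (Ideal.span_singleton_le_iff_mem _).2 ?_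
    obtain ⟨c, rfl⟩ := h1 q
    exact Ideal.mul_mem_right _ _ (Ideal.pow_mem_pow hz q)
  simpa using h2

theorem exists_eq_pow_mul (h : Germ φ 𝔪 n) {z a : R} (hz : z ∈ 𝔪) (ha : a ≠ 0) :
    ∃ q b, a = z ^ q * b ∧ b ∉ Ideal.span {z} := by
  by_contra! H
  have h1 : ∀ q, ∃ c, a = z ^ q * c := by
    intro q
    induction q with
    | zero => exact ⟨a, by simp⟩
    | succ q ih =>
      obtain ⟨c, hc⟩ := ih
      obtain ⟨c', rfl⟩ := Ideal.mem_span_singleton.1 (H q c hc)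
      exact ⟨c', by rw [hc]; ring⟩
  refine ha ?_
  have h2 : Ideal.span {a} = ⊥ := by
    refine h.bot_of_le_pow fun q => (Ideal.span_singleton_le_iff_mem _).2 ?_
    obtain ⟨c, rfl⟩ := h1 q
    exact Ideal.mul_mem_right _ _ (Ideal.pow_mem_pow hz q)
  simpa using h2

/-- Induction on `n`: the quotient by a coordinate is a domain, so the coordinate generates a prime.
Every nonzero element is a power of the coordinate times an element outside that prime, and the
coordinate is not a zero divisor. -/
theorem isDomain (h : Germ φ 𝔪 n) : IsDomain R := by
  induction n generalizing R with
  | zero =>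
    have := h.nontrivial
    have hf : IsField R := by
      refine ⟨⟨0, 1, zero_ne_one⟩, mul_comm, fun {a} ha => ?_⟩
      refine (h.isUnit_iff.2 ?_).exists_right_inv
      rwa [h.eq_bot_of_zero]
    exact hf.isDomain
  | succ m ih =>
    obtain ⟨x, d, hx, hl, hd⟩ := h.exists_coords
    have ho : Ideal.span (insert (x 0) (Set.range fun i : Fin m => x i.succ)) = 𝔪 := by
      rw [← hx]
      congr 1
      ext r
      simp [Fin.exists_fin_succ, eq_comm]
    have hz := h.mem_nonZeroDivisors ho
    have hzm : x 0 ∈ 𝔪 := hx ▸ Ideal.subset_span ⟨0, rfl⟩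
    have hp := (Ideal.Quotient.isDomain_iff_prime _).1 (ih (h.quotient ho))
    have := h.nontrivial
    have : NoZeroDivisors R := by
      refine ⟨fun {a b} hab => ?_⟩
      by_contra! H
      obtain ⟨p, a', rfl, ha⟩ := h.exists_eq_pow_mul hzm H.1
      obtain ⟨q, b', rfl, hb⟩ := h.exists_eq_pow_mul hzm H.2
      have h1 : a' * b' = 0 := by
        refine (mul_left_mem_nonZeroDivisors_eq_zero_iff (pow_mem hz (p + q))).1 ?_
        rw [← hab]; ring
      exact (hp.mem_or_mem (h1 ▸ Ideal.zero_mem _)).elim ha hb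
    exact NoZeroDivisors.to_isDomain R

theorem isPrime_span {m : ℕ} (h : Germ φ 𝔪 (m + 1)) {z : R} {o : Fin m → R}
    (ho : Ideal.span (insert z (Set.range o)) = 𝔪) : (Ideal.span {z}).IsPrime :=
  (Ideal.Quotient.isDomain_iff_prime _).1 (h.quotient ho).isDomain

theorem isPrime_span_of_order_one (h : Germ φ 𝔪 n) {z : R} (hz : z ∈ 𝔪) (hz2 : z ∉ 𝔪 ^ 2) :
    (Ideal.span {z}).IsPrime := by
  obtain ⟨m, -, hm⟩ := h.quotient_of_order_one hz hz2
  exact (Ideal.Quotient.isDomain_iff_prime _).1 hm.isDomain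

theorem ringKrullDim_eq (h : Germ φ 𝔪 n) : ringKrullDim R = n := by
  induction n generalizing R with
  | zero =>
    have := h.isDomain
    have hf : IsField R := by
      refine ⟨⟨0, 1, zero_ne_one⟩, mul_comm, fun {a} ha => ?_⟩
      refine (h.isUnit_iff.2 ?_).exists_right_inv
      rwa [h.eq_bot_of_zero]
    exact ringKrullDim_eq_zero_of_isField hf
  | succ m ih =>
    obtain ⟨x, d, hx, hl, hd⟩ := h.exists_coords
    have ho : Ideal.span (insert (x 0) (Set.range fun i : Fin m => x i.succ)) = 𝔪 := by
      rw [← hx]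
      congr 1
      ext r
      simp [Fin.exists_fin_succ, eq_comm]
    have hzm : x 0 ∈ 𝔪 := hx ▸ Ideal.subset_span ⟨0, rfl⟩
    have := h.isLocalRing
    have := h.isNoetherianRing
    rw [← ringKrullDim_quotient_span_singleton_succ_eq_ringKrullDim_of_mem_nonZeroDivisors
      (h.mem_nonZeroDivisors ho) (h.eq_maximalIdeal ▸ hzm), ih (h.quotient ho)]
    norm_cast

theorem isPartialDerivative_iff (h : Germ φ 𝔪 n) {z : R} {D : Derivation ℤ R R} :
    IsPartialDerivative φ 𝔪 z D ↔ ∃ (m : ℕ) (o : Fin m → R), n = m + 1 ∧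
      Ideal.span (insert z (Set.range o)) = 𝔪 ∧ IsLinearOver φ D ∧ (∀ j, D (o j) = 0) ∧
        D z = 1 := by
  refine exists₂_congr fun m o => and_congr_left fun _ => ?_
  rw [h.ringKrullDim_eq]
  norm_cast

end Germ

/-! ### Étale base change of derivations, germs and the invariant -/

section FormallyEtale

open scoped TensorProduct

variable {R A : Type u} [CommRing R] [CommRing A] {ψ : R →+* A}

/-- Derivations extend along formally étale homomorphisms. -/
theorem exists_derivation_extension (hψ : ψ.FormallyEtale) (D : Derivation ℤ R R) :
    ∃ D' : Derivation ℤ A A, ∀ r, D' (ψ r) = ψ (D r) := by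
  algebraize [ψ]
  let l : A ⊗[R] Ω[R⁄ℤ] →ₗ[A] A :=
    LinearMap.liftBaseChange A ((Algebra.linearMap R A).comp D.liftKaehlerDifferential)
  let e := KaehlerDifferential.tensorKaehlerEquivOfFormallyEtale ℤ R A
  refine ⟨(l.comp e.symm.toLinearMap).compDer (KaehlerDifferential.D ℤ A), fun r => ?_⟩
  change l (e.symm (KaehlerDifferential.D ℤ A (algebraMap R A r))) = algebraMap R A (D r)
  rw [KaehlerDifferential.tensorKaehlerEquivOfFormallyEtale_symm_D_algebraMap]
  simp [l]

theorem formallyEtale_quotientMap (hψ : ψ.FormallyEtale) {I : Ideal R} {J : Ideal A}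
    (hJ : J = I.map ψ) :
    (Ideal.quotientMap J ψ (hJ ▸ Ideal.le_comap_map)).FormallyEtale := by
  subst hJ
  algebraize [ψ]
  have := Algebra.FormallyEtale.of_equiv (Algebra.TensorProduct.quotIdealMapEquivQuotTensor A I).symm
  exact RingHom.formallyEtale_algebraMap.2 this

end FormallyEtale

/-- A formally étale homomorphism of local rings `(R, 𝔪) → A` such that `𝔪 A` is the maximal ideal
of the Noetherian local ring `A`. -/
structure EtaleGermHom {R A : Type u} [CommRing R] [CommRing A] (𝔪 : Ideal R) (ψ : R →+* A) :
    Prop where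
  formallyEtale : ψ.FormallyEtale
  isNoetherianRing : IsNoetherianRing A
  mem_iff : ∀ a, a ∈ 𝔪.map ψ ↔ ¬ IsUnit a

namespace EtaleGermHom

variable {k R A : Type u} [Field k] [CharZero k] [CommRing R] [CommRing A] {φ : k →+* R}
  {𝔪 : Ideal R} {n : ℕ} {ψ : R →+* A}

theorem exists_extension (hψ : EtaleGermHom 𝔪 ψ) (φ : k →+* R) {D : Derivation ℤ R R}
    (hD : IsLinearOver φ D) :
    ∃ D' : Derivation ℤ A A, IsLinearOver (ψ.comp φ) D' ∧ ∀ r, D' (ψ r) = ψ (D r) := by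
  obtain ⟨D', hD'⟩ := exists_derivation_extension hψ.formallyEtale D
  exact ⟨D', fun c => by rw [RingHom.comp_apply, hD', hD, map_zero], hD'⟩

theorem germ (hψ : EtaleGermHom 𝔪 ψ) (h : Germ φ 𝔪 n) : Germ (ψ.comp φ) (𝔪.map ψ) n := by
  obtain ⟨x, d, hx, hl, hd⟩ := h.exists_coords
  choose d' hl' hd' using fun i => hψ.exists_extension φ (hl i)
  refine ⟨hψ.isNoetherianRing, hψ.mem_iff, fun i => ψ (x i), d', ?_, hl', fun i j => ?_⟩
  · rw [← hx, Ideal.map_span, ← Set.range_comp]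
    rfl
  · rw [hd', hd]
    split_ifs <;> simp

/-- Derivations extend along `ψ`, and they decide the order by `mem_pow_succ`. So no element gains
order in `A`, and flatness is not needed. -/
theorem mem_pow_iff (hψ : EtaleGermHom 𝔪 ψ) (h : Germ φ 𝔪 n) {q : ℕ} {f : R} :
    ψ f ∈ (𝔪.map ψ) ^ q ↔ f ∈ 𝔪 ^ q := by
  refine ⟨fun hf => ?_, fun hf => by rw [← Ideal.map_pow]; exact Ideal.mem_map_of_mem _ hf⟩
  obtain ⟨x, d, hx, hl, hd⟩ := h.exists_coords
  choose d' hl' hd' using fun i => hψ.exists_extension φ (hl i)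
  induction q generalizing f with
  | zero => simp
  | succ q ih =>
    rcases Nat.eq_zero_or_pos q with rfl | hq
    · simp only [zero_add, pow_one] at hf ⊢
      rw [h.mem_iff]
      rw [hψ.mem_iff] at hf
      exact fun hu => hf (hu.map ψ)
    · refine h.mem_pow_succ hx hd hq.ne' (ih (Ideal.pow_le_pow_right (Nat.le_succ q) hf))
        fun i => ih ?_
      rw [← hd']
      exact derivation_mem_pow _ _ _ hf

theorem map_le_pow_iff (hψ : EtaleGermHom 𝔪 ψ) (h : Germ φ 𝔪 n) {q : ℕ} {I : Ideal R} :
    I.map ψ ≤ (𝔪.map ψ) ^ q ↔ I ≤ 𝔪 ^ q := by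
  rw [Ideal.map_le_iff_le_comap]
  exact forall₂_congr fun f _ => hψ.mem_pow_iff h

theorem idealOrder_map (hψ : EtaleGermHom 𝔪 ψ) (h : Germ φ 𝔪 n) {I : Ideal R} :
    idealOrder (𝔪.map ψ) (I.map ψ) = idealOrder 𝔪 I := by
  unfold idealOrder
  simp only [Set.mem_ofPred_eq, hψ.map_le_pow_iff h]

theorem quotient (hψ : EtaleGermHom 𝔪 ψ) (h : Germ φ 𝔪 n) {z : R} (hz : z ∈ 𝔪) :
    EtaleGermHom (𝔪.map (Ideal.Quotient.mk (Ideal.span {z})))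
      (Ideal.quotientMap (I := Ideal.span {z}) (Ideal.span {ψ z}) ψ
        (by rw [← Set.image_singleton, ← Ideal.map_span]; exact Ideal.le_comap_map)) := by
  have hz' : ψ z ∈ 𝔪.map ψ := Ideal.mem_map_of_mem ψ hz
  refine ⟨formallyEtale_quotientMap hψ.formallyEtale
    (by rw [Ideal.map_span, Set.image_singleton]), ?_, fun a => ?_⟩
  · have := hψ.isNoetherianRing
    infer_instance
  · obtain ⟨a, rfl⟩ := Ideal.Quotient.mk_surjective a
    rw [(hψ.germ h).isUnit_mk_iff hz', Ideal.map_map, Ideal.quotientMap_comp_mk, ← Ideal.map_map,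
      Germ.mk_mem_map_iff ((Ideal.span_singleton_le_iff_mem _).2 hz'), hψ.mem_iff]

theorem derivClosure_map_le (hψ : EtaleGermHom 𝔪 ψ) (I : Ideal R) :
    (derivClosure φ I).map ψ ≤ derivClosure (ψ.comp φ) (I.map ψ) := by
  rw [Ideal.map_le_iff_le_comap, derivClosure_le_iff]
  refine ⟨fun f hf => le_derivClosure _ (Ideal.mem_map_of_mem ψ hf), fun D hD f hf => ?_⟩
  obtain ⟨D', hl, hD'⟩ := hψ.exists_extension φ hD
  rw [Ideal.mem_comap, ← hD']
  exact derivation_mem_derivClosure hl (Ideal.mem_map_of_mem ψ hf)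

theorem iterate_derivClosure_map_le (hψ : EtaleGermHom 𝔪 ψ) (I : Ideal R) (j : ℕ) :
    ((derivClosure φ)^[j] I).map ψ ≤ (derivClosure (ψ.comp φ))^[j] (I.map ψ) := by
  induction j with
  | zero => exact le_rfl
  | succ j ih =>
    rw [Function.iterate_succ_apply', Function.iterate_succ_apply']
    exact (hψ.derivClosure_map_le _).trans (derivClosure_mono ih)

end EtaleGermHom

theorem partialClosure_map {R A : Type u} [CommRing R] [CommRing A] {ψ : R →+* A}
    {D : Derivation ℤ R R} {D' : Derivation ℤ A A} (h : ∀ r, D' (ψ r) = ψ (D r)) (I : Ideal R) :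
    (partialClosure D I).map ψ = partialClosure D' (I.map ψ) := by
  apply le_antisymm
  · rw [Ideal.map_le_iff_le_comap, partialClosure_le_iff]
    refine ⟨fun f hf => le_partialClosure _ _ (Ideal.mem_map_of_mem ψ hf), fun f hf => ?_⟩
    rw [Ideal.mem_comap, ← h]
    exact derivation_mem_partialClosure (Ideal.mem_map_of_mem ψ hf)
  · refine partialClosure_le_iff.2 ⟨Ideal.map_mono (le_partialClosure _ _), fun f hf => ?_⟩
    refine derivation_mem_sup_span _ (Ideal.map_mono (le_partialClosure _ D)) rfl ?_ hf
    rintro _ ⟨f, hf, rfl⟩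
    rw [h]
    exact Ideal.mem_map_of_mem _ (derivation_mem_partialClosure hf)

theorem coeffIdeal_map {R A : Type u} [CommRing R] [CommRing A] {ψ : R →+* A}
    {D : Derivation ℤ R R} {D' : Derivation ℤ A A} (h : ∀ r, D' (ψ r) = ψ (D r)) (m : ℕ)
    (I : Ideal R) : (coeffIdeal D m I).map ψ = coeffIdeal D' m (I.map ψ) := by
  have hj : ∀ j, ((partialClosure D)^[j] I).map ψ = (partialClosure D')^[j] (I.map ψ) := by
    intro j
    induction j with
    | zero => rfl
    | succ j ih =>
      rw [Function.iterate_succ_apply', Function.iterate_succ_apply', partialClosure_map h, ih]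
  unfold coeffIdeal
  simp only [Ideal.map_iSup, Ideal.map_pow, hj]

/-- Order, maximal contact, coordinates and coefficient ideals all pull back along an étale
homomorphism, so choices made below give choices above with the same values. This direction
suffices: once every choice above yields one sequence, so does every choice below. -/
theorem hasInv_map {k R A : Type u} [Field k] [CharZero k] [CommRing R] [CommRing A] {φ : k →+* R}
    {𝔪 I : Ideal R} {n d : ℕ} {s : List (WithTop ℚ)} {ψ : R →+* A} (hs : HasInv φ 𝔪 I d s)
    (h : Germ φ 𝔪 n) (hψ : EtaleGermHom 𝔪 ψ) :
    HasInv (ψ.comp φ) (𝔪.map ψ) (I.map ψ) d s := by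
  induction hs generalizing n A with
  | zero φ 𝔪 d => rw [Ideal.map_bot]; exact .zero _ _ _
  | @step R _ φ 𝔪 I d m z D s hm hI hz hD hs ih =>
    obtain ⟨p, o, rfl, ho, hl, hDo, hDz⟩ := h.isPartialDerivative_iff.1 hD
    obtain ⟨D', hl', hD'⟩ := hψ.exists_extension φ hl
    refine .step _ _ _ _ m (ψ z) D' s hm ((hψ.idealOrder_map h).trans hI) ⟨?_, ?_⟩ ?_ ?_
    · rw [← hz.1, ← hψ.idealOrder_map h, Ideal.map_span, Set.image_singleton]
    · exact hψ.iterate_derivClosure_map_le I _ (Ideal.mem_map_of_mem ψ hz.2)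
    · refine (hψ.germ h).isPartialDerivative_iff.2 ⟨p, fun j => ψ (o j), rfl, ?_, hl',
        fun j => by rw [hD', hDo, map_zero], by rw [hD', hDz, map_one]⟩
      rw [← ho, Ideal.map_span, Set.image_insert_eq, ← Set.range_comp]
      rfl
    · have := ih (h.quotient ho) (hψ.quotient h (ho ▸ Ideal.subset_span (Set.mem_insert _ _)))
      rwa [Ideal.map_map, Ideal.map_map, Ideal.quotientMap_comp_mk, ← RingHom.comp_assoc,
        Ideal.quotientMap_comp_mk, ← Ideal.map_map, ← Ideal.map_map, coeffIdeal_map hD'] at this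


/-! ### Coefficient ideals and existence of choices -/

section Coefficient

variable {R : Type u} [CommRing R]

theorem dvd_coeffMultiplicity {m j : ℕ} (hj : j < m) : m - j ∣ coeffMultiplicity m :=
  Finset.dvd_lcm (f := fun j => m - j) (Finset.mem_range.2 hj)

theorem coeffMultiplicity_ne_zero (m : ℕ) : coeffMultiplicity m ≠ 0 := by
  rw [coeffMultiplicity, Ne, Finset.lcm_eq_zero_iff]
  rintro ⟨j, hj, h⟩
  have := Finset.mem_range.1 hj
  omega

theorem coeffMultiplicity_two : coeffMultiplicity 2 = 2 := by decide

theorem coeffMultiplicity_three : coeffMultiplicity 3 = 6 := by decide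

theorem coeffIdeal_le_iff {D : Derivation ℤ R R} {m : ℕ} {I K : Ideal R} :
    coeffIdeal D m I ≤ K ↔
      ∀ j < m, ((partialClosure D)^[j] I) ^ (coeffMultiplicity m / (m - j)) ≤ K := by
  simp [coeffIdeal]

theorem le_coeffIdeal (D : Derivation ℤ R R) (I : Ideal R) {m j : ℕ} (hj : j < m) :
    ((partialClosure D)^[j] I) ^ (coeffMultiplicity m / (m - j)) ≤ coeffIdeal D m I :=
  coeffIdeal_le_iff.1 le_rfl j hj

/-- A `j`-th derivative of an element of `J ^ m` stays in `J ^ (m - j)`, and the exponent `l / (m -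
j)` brings every term back to the common level `J ^ l`. -/
theorem coeffIdeal_le_pow {D : Derivation ℤ R R} {m : ℕ} {I J : Ideal R} (hI : I ≤ J ^ m) :
    coeffIdeal D m I ≤ J ^ coeffMultiplicity m := by
  refine coeffIdeal_le_iff.2 fun j hj => ?_
  have h1 : (partialClosure D)^[j] I ≤ J ^ (m - j) :=
    iterate_partialClosure_le (partialClosure_pow_le J D) (m - j) j
      (by rwa [Nat.sub_add_cancel hj.le])
  refine (Ideal.pow_right_mono h1 _).trans ?_
  rw [← pow_mul, Nat.mul_div_cancel' (dvd_coeffMultiplicity hj)]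

end Coefficient

theorem hasInv_cases {k R : Type u} [Field k] [CommRing R] {φ : k →+* R} {𝔪 I : Ideal R} {d : ℕ}
    {s : List (WithTop ℚ)} (hs : HasInv φ 𝔪 I d s) :
    (I = ⊥ ∧ s = [⊤]) ∨ ∃ (m : ℕ) (z : R) (D : Derivation ℤ R R) (s' : List (WithTop ℚ)),
      0 < m ∧ (I ≤ 𝔪 ^ m ∧ ¬ I ≤ 𝔪 ^ (m + 1)) ∧ (z ∈ 𝔪 ∧ z ∉ 𝔪 ^ 2) ∧
      z ∈ (derivClosure φ)^[m - 1] I ∧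
      IsPartialDerivative φ 𝔪 z D ∧
      HasInv ((Ideal.Quotient.mk (Ideal.span {z})).comp φ)
        (𝔪.map (Ideal.Quotient.mk (Ideal.span {z})))
        ((coeffIdeal D m I).map (Ideal.Quotient.mk (Ideal.span {z})))
        (coeffMultiplicity m) s' ∧
      s = (((m : ℚ) / (d : ℚ) : ℚ) : WithTop ℚ) :: 0 :: s' := by
  cases hs with
  | zero => exact .inl ⟨rfl, rfl⟩
  | step _ _ _ _ m z D s' hm hI hz hD h =>
    exact .inr ⟨m, z, D, s', hm, idealOrder_eq_iff.1 hI, idealOrder_span_singleton_eq_one.1 hz.1,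
      hz.2, hD, h, rfl⟩

theorem hasInv_bot {k R : Type u} [Field k] [CommRing R] {φ : k →+* R} {𝔪 : Ideal R} {d : ℕ}
    {s : List (WithTop ℚ)} (hs : HasInv φ 𝔪 ⊥ d s) : s = [⊤] := by
  obtain ⟨-, rfl⟩ | ⟨m, z, D, s', hm, hI, -⟩ := hasInv_cases hs
  · rfl
  · exact absurd bot_le hI.2

namespace Germ

variable {k R : Type u} [Field k] [CharZero k] [CommRing R] {φ : k →+* R} {𝔪 : Ideal R} {n : ℕ}

theorem exists_order (h : Germ φ 𝔪 n) {I : Ideal R} (hI : I ≤ 𝔪) (hI0 : I ≠ ⊥) :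
    ∃ m, 0 < m ∧ I ≤ 𝔪 ^ m ∧ ¬ I ≤ 𝔪 ^ (m + 1) := by
  by_contra! H
  refine hI0 (h.bot_of_le_pow fun q => ?_)
  induction q with
  | zero => simp
  | succ q ih =>
    rcases Nat.eq_zero_or_pos q with rfl | hq
    · simpa using hI
    · exact H q hq ih

/-- An element of exact order `m` has a derivative of exact order `m - 1`. After `m - 1` derivatives
the order is one. -/
theorem exists_maximalContact (h : Germ φ 𝔪 n) {I : Ideal R} {m : ℕ} (hm : 0 < m) (hI : I ≤ 𝔪 ^ m)
    (hI' : ¬ I ≤ 𝔪 ^ (m + 1)) :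
    ∃ z ∈ (derivClosure φ)^[m - 1] I, z ∈ 𝔪 ∧ z ∉ 𝔪 ^ 2 := by
  have key : ∀ j < m, ∃ g ∈ (derivClosure φ)^[j] I, g ∈ 𝔪 ^ (m - j) ∧ g ∉ 𝔪 ^ (m - j + 1) := by
    intro j
    induction j with
    | zero =>
      intro _
      obtain ⟨g, hg, hg'⟩ := SetLike.not_le_iff_exists.1 hI'
      exact ⟨g, hg, hI hg, hg'⟩
    | succ j ih =>
      intro hj
      obtain ⟨g, hg, hg1, hg2⟩ := ih (by omega)
      obtain ⟨D, hD, hDg⟩ := h.exists_derivation_notMem (by omega) hg1 hg2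
      refine ⟨D g, ?_, ?_, ?_⟩
      · rw [Function.iterate_succ_apply']
        exact derivation_mem_derivClosure hD hg
      · refine derivation_mem_pow 𝔪 D _ ?_
        rwa [show m - (j + 1) + 1 = m - j by omega]
      · rwa [show m - (j + 1) + 1 = m - j by omega]
  obtain ⟨g, hg, hg1, hg2⟩ := key (m - 1) (by omega)
  rw [show m - (m - 1) = 1 by omega] at hg1 hg2
  exact ⟨g, hg, by simpa using hg1, hg2⟩

/-- The inductive construction of the invariant always terminates. -/
theorem exists_hasInv (h : Germ φ 𝔪 n) {I : Ideal R} (hI : I ≤ 𝔪) (d : ℕ) :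
    ∃ s, HasInv φ 𝔪 I d s := by
  induction n generalizing R d with
  | zero =>
    obtain rfl : I = ⊥ := by rwa [h.eq_bot_of_zero, le_bot_iff] at hI
    exact ⟨_, .zero _ _ _⟩
  | succ n ih =>
    by_cases hI0 : I = ⊥
    · subst hI0
      exact ⟨_, .zero _ _ _⟩
    obtain ⟨m, hm, h1, h2⟩ := h.exists_order hI hI0
    obtain ⟨z, hz, hz1, hz2⟩ := h.exists_maximalContact hm h1 h2
    obtain ⟨p, o, hp, ho⟩ := h.exists_params hz1 hz2
    obtain rfl : n = p := by omega
    obtain ⟨D, -, ⟨hl, hDz, hDo⟩, -⟩ := h.exists_dual_insert ho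
    obtain ⟨s, hs⟩ := ih (h.quotient ho)
      (I := (coeffIdeal D m I).map (Ideal.Quotient.mk (Ideal.span {z}))) (Ideal.map_mono
        ((coeffIdeal_le_pow h1).trans (Ideal.pow_le_self (coeffMultiplicity_ne_zero m))))
      (coeffMultiplicity m)
    exact ⟨_, .step φ 𝔪 I d m z D s hm (idealOrder_eq_iff.2 ⟨h1, h2⟩)
      ⟨idealOrder_span_singleton_eq_one.2 ⟨hz1, hz2⟩, hz⟩
      (h.isPartialDerivative_iff.2 ⟨n, o, rfl, ho, hl, hDo, hDz⟩) hs⟩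

theorem pow_notMem (h : Germ φ 𝔪 n) {t : R} (ht : t ∈ 𝔪) (ht2 : t ∉ 𝔪 ^ 2) (N : ℕ) :
    t ^ N ∉ 𝔪 ^ (N + 1) := by
  obtain ⟨p, o, rfl, ho⟩ := h.exists_params ht ht2
  obtain ⟨D, -, ⟨-, hD, -⟩, -⟩ := h.exists_dual_insert ho
  induction N with
  | zero => simpa using h.one_notMem
  | succ N ih =>
    intro hN
    have h1 := derivation_mem_pow 𝔪 D _ hN
    rw [D.leibniz_pow, hD, smul_eq_mul, mul_one, nsmul_eq_mul, Nat.add_sub_cancel] at h1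
    exact ih ((Ideal.unit_mul_mem_iff_mem _ (h.isUnit_natCast (Nat.succ_ne_zero N))).1 h1)

/-- The invariant of a power of a coordinate. -/
theorem hasInv_span_pow (h : Germ φ 𝔪 n) {t : R} (ht : t ∈ 𝔪) (ht2 : t ∉ 𝔪 ^ 2) {N d : ℕ}
    (hN : N ≠ 0) {s : List (WithTop ℚ)} (hs : HasInv φ 𝔪 (Ideal.span {t} ^ N) d s) :
    s = [(((N : ℚ) / (d : ℚ) : ℚ) : WithTop ℚ), 0, ⊤] := by
  have htm : Ideal.span {t} ≤ 𝔪 := (Ideal.span_singleton_le_iff_mem _).2 ht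
  have hle : Ideal.span {t} ^ N ≤ 𝔪 ^ N := Ideal.pow_right_mono htm N
  have hnle : ¬ Ideal.span {t} ^ N ≤ 𝔪 ^ (N + 1) := fun H =>
    h.pow_notMem ht ht2 N (H (Ideal.pow_mem_pow (Ideal.mem_span_singleton_self t) N))
  obtain ⟨h0, -⟩ | ⟨m, z, D, s', hm, hI, hz, hzI, hD, hs', rfl⟩ := hasInv_cases hs
  · exact absurd (h0 ▸ bot_le) hnle
  obtain rfl : m = N := by
    by_contra hne
    rcases Nat.lt_or_gt_of_ne hne with hlt | hlt
    · exact hI.2 (hle.trans (Ideal.pow_le_pow_right hlt))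
    · exact hnle (hI.1.trans (Ideal.pow_le_pow_right hlt))
  -- Derivatives of order at most `m - 1` of `(t) ^ m` stay in `(t)`. So every maximal contact
  -- element is a unit times `t`, and the coefficient ideal vanishes on `V(z)`.
  have hzt : z ∈ Ideal.span {t} := by
    have := iterate_derivClosure_le (φ := φ) (derivClosure_pow_le (Ideal.span {t})) 1 (m - 1)
      (I := Ideal.span {t} ^ m) (by rw [show 1 + (m - 1) = m by omega]) hzI
    simpa using this
  obtain ⟨u, hu⟩ := Ideal.mem_span_singleton'.1 hzt
  have huu : IsUnit u := by
    rw [h.isUnit_iff]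
    intro hum
    refine hz.2 (hu ▸ ?_)
    rw [pow_two]
    exact Ideal.mul_mem_mul hum ht
  have htz : t ∈ Ideal.span {z} := by
    refine (Ideal.unit_mul_mem_iff_mem _ huu).1 ?_
    rw [hu]
    exact Ideal.mem_span_singleton_self z
  have hbot : (coeffIdeal D m (Ideal.span {t} ^ m)).map (Ideal.Quotient.mk (Ideal.span {z})) = ⊥ := by
    rw [Ideal.map_eq_bot_iff_le_ker, Ideal.mk_ker]
    exact ((coeffIdeal_le_pow le_rfl).trans
      (Ideal.pow_le_self (coeffMultiplicity_ne_zero m))).trans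
      ((Ideal.span_singleton_le_iff_mem _).2 htz)
  rw [hbot] at hs'
  rw [hasInv_bot hs']

end Germ
-- The invariant of `z² + c w²`
namespace Germ

variable {k R : Type u} [Field k] [CharZero k] [CommRing R] {φ : k →+* R} {𝔪 : Ideal R} {n : ℕ}

theorem exists_derivation_isUnit (h : Germ φ 𝔪 n) {w : R} (hw : w ∈ 𝔪) (hw2 : w ∉ 𝔪 ^ 2) :
    ∃ D : Derivation ℤ R R, IsLinearOver φ D ∧ IsUnit (D w) := by
  obtain ⟨D, hD, hDw⟩ := h.exists_derivation_notMem one_ne_zero (by simpa using hw) hw2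
  exact ⟨D, hD, h.isUnit_iff.2 (by simpa using hDw)⟩

/-- A single derivation `E` takes unit values on both `w` and `c`: one of `D`, `D'`, `D + D'` always
works. The third derivative of `w ^ 2 * c` along `E` is the unit `6 (E w)² (E c)` modulo `𝔪`. -/
theorem sq_mul_notMem (h : Germ φ 𝔪 n) {w c : R} (hw : w ∈ 𝔪) (hw2 : w ∉ 𝔪 ^ 2) (hc : c ∈ 𝔪)
    (hc2 : c ∉ 𝔪 ^ 2) : w ^ 2 * c ∉ 𝔪 ^ 4 := by
  obtain ⟨E, hEw, hEc⟩ : ∃ E : Derivation ℤ R R, IsUnit (E w) ∧ IsUnit (E c) := by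
    obtain ⟨D, -, hD⟩ := h.exists_derivation_isUnit hw hw2
    obtain ⟨D', -, hD'⟩ := h.exists_derivation_isUnit hc hc2
    by_cases h1 : IsUnit (D c)
    · exact ⟨D, hD, h1⟩
    by_cases h2 : IsUnit (D' w)
    · exact ⟨D', h2, hD'⟩
    refine ⟨D + D', ?_, ?_⟩
    · exact h.isUnit_add hD ((h.mem_iff _).2 h2)
    · rw [Derivation.add_apply, add_comm]
      exact h.isUnit_add hD' ((h.mem_iff _).2 h1)
  intro H
  have h1 := derivation_mem_pow 𝔪 E 0 (derivation_mem_pow 𝔪 E 1 (derivation_mem_pow 𝔪 E 2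
    (derivation_mem_pow 𝔪 E 3 H)))
  have h2 := derivation_mem_pow 𝔪 E 1 (derivation_mem_pow 𝔪 E 2 (derivation_mem_pow 𝔪 E 3 H))
  have e : E (E (E (w ^ 2 * c))) = 6 * ((E w) ^ 2 * E c) + (w * (2 * c * E (E (E w)) +
      6 * E w * E (E c) + 6 * E (E w) * E c + w * E (E (E c))) + c * (6 * E w * E (E w))) := by
    simp only [pow_two, Derivation.leibniz, smul_eq_mul, map_add]
    ring
  rw [e, pow_one] at h2
  have h3 := (𝔪.add_mem_iff_left (𝔪.add_mem (𝔪.mul_mem_right _ hw) (𝔪.mul_mem_right _ hc))).1 h2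
  exact h.isUnit_iff.1 ((h.isUnit_ofNat 6).mul ((hEw.pow 2).mul hEc)) h3

end Germ

theorem map_span_insert {R : Type u} [CommRing R] (z : R) (S : Set R) :
    (Ideal.span (insert z S)).map (Ideal.Quotient.mk (Ideal.span {z})) =
      Ideal.span (Ideal.Quotient.mk (Ideal.span {z}) '' S) := by
  rw [Ideal.map_span, Set.image_insert_eq,
    Ideal.Quotient.eq_zero_iff_mem.2 (Ideal.mem_span_singleton_self z), Ideal.span_insert_zero]

theorem map_span_insert_insert {R : Type u} [CommRing R] {m : ℕ} (z w : R) (o : Fin m → R) :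
    (Ideal.span (insert z (insert w (Set.range o)))).map (Ideal.Quotient.mk (Ideal.span {z})) =
      Ideal.span (insert (Ideal.Quotient.mk (Ideal.span {z}) w)
        (Set.range fun j => Ideal.Quotient.mk (Ideal.span {z}) (o j))) := by
  rw [map_span_insert, Set.image_insert_eq, ← Set.range_comp]
  rfl

theorem map_span_insert_insert_insert {R : Type u} [CommRing R] {m : ℕ} (z w x : R)
    (o : Fin m → R) :
    (Ideal.span (insert z (insert w (insert x (Set.range o))))).map
      (Ideal.Quotient.mk (Ideal.span {z})) =
      Ideal.span (insert (Ideal.Quotient.mk (Ideal.span {z}) w)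
        (insert (Ideal.Quotient.mk (Ideal.span {z}) x)
        (Set.range fun j => Ideal.Quotient.mk (Ideal.span {z}) (o j)))) := by
  rw [map_span_insert, Set.image_insert_eq, Set.image_insert_eq, ← Set.range_comp]
  rfl

/-- The second coefficient ideal of an ideal between `(w²c)` and `(w, c)³`. -/
theorem coeffIdeal_three_map {k R S : Type u} [Field k] [CharZero k] [CommRing R] [CommRing S]
    {φ : k →+* S} {𝔫 : Ideal S} {n : ℕ} (h : Germ φ 𝔫 n) {π : R →+* S}
    {I : Ideal R} {w c z α β : R} {τ : S} {D : Derivation ℤ R R}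
    (hI : I ≤ Ideal.span {w, c} ^ 3) (hwc : w ^ 2 * c ∈ I) (hz : α * w + β * c = z)
    (hπz : π z = 0) (hDz : D z = 1) (hτ : τ ≠ 0) (hτn : τ ∈ 𝔫)
    (hJ : (Ideal.span {w, c}).map π = Ideal.span {τ}) :
    (coeffIdeal D 3 I).map π = Ideal.span {τ} ^ 6 := by
  have hdom := h.isDomain
  have hw : π w ∈ Ideal.span {τ} := hJ ▸ Ideal.mem_map_of_mem π (Ideal.subset_span (by simp))
  have hc : π c ∈ Ideal.span {τ} := hJ ▸ Ideal.mem_map_of_mem π (Ideal.subset_span (by simp))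
  obtain ⟨p, hp⟩ := Ideal.mem_span_singleton'.1 hw
  obtain ⟨q, hq⟩ := Ideal.mem_span_singleton'.1 hc
  have hrs : ∃ r s, r * p + s * q = 1 := by
    have h1 : τ ∈ (Ideal.span {w, c}).map π := hJ ▸ Ideal.mem_span_singleton_self τ
    rw [Ideal.map_span, Set.image_pair, Ideal.mem_span_pair] at h1
    obtain ⟨r, s, hrs⟩ := h1
    refine ⟨r, s, mul_right_cancel₀ hτ ?_⟩
    linear_combination hrs + r * hp + s * hq
  apply le_antisymm
  · refine (Ideal.map_mono (coeffIdeal_le_pow hI)).trans ?_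
    rw [Ideal.map_pow, hJ, coeffMultiplicity_three]
  rw [Ideal.span_singleton_pow, Ideal.span_singleton_le_iff_mem]
  by_contra hτ6
  -- The coefficient ideal contains the power `6 / (3 - j)` of `D^[j] (w ^ 2 * c)`. If this
  -- derivative restricted to a unit times `τ ^ (3 - j)`, then `τ ^ 6` would be in the image.
  have key : ∀ j e, j < 3 → (3 - j) * e = 6 → ∀ a, π (D^[j] (w ^ 2 * c)) = a * τ ^ (3 - j) →
      a ∈ 𝔫 := by
    intro j e hj he a ha
    rw [h.mem_iff]
    intro hu
    have h1 : (D^[j] (w ^ 2 * c)) ^ (coeffMultiplicity 3 / (3 - j)) ∈ coeffIdeal D 3 I :=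
      le_coeffIdeal D I hj (Ideal.pow_mem_pow (iterate_derivation_mem hwc j) _)
    rw [coeffMultiplicity_three, ← he, Nat.mul_div_cancel_left _ (by omega)] at h1
    have h2 := Ideal.mem_map_of_mem π h1
    rw [map_pow, ha, mul_pow, ← pow_mul, he, Ideal.unit_mul_mem_iff_mem _ (hu.pow e)] at h2
    exact hτ6 h2
  have h0 := key 0 2 (by norm_num) (by norm_num) (p ^ 2 * q) (by
    simp only [Function.iterate_zero, id_eq, map_mul, map_pow, ← hp, ← hq]
    ring)
  have h1 := key 1 3 (by norm_num) (by norm_num) (2 * p * q * π (D w) + p ^ 2 * π (D c)) (by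
    simp only [Function.iterate_one, Derivation.leibniz, pow_two, smul_eq_mul, map_add, map_mul,
      ← hp, ← hq]
    ring)
  have h2 := key 2 6 (by norm_num) (by norm_num) (2 * π (D w) ^ 2 * q + 4 * p * π (D w) * π (D c) +
    τ * (2 * p * q * π (D (D w)) + p ^ 2 * π (D (D c)))) (by
    simp only [Function.iterate_succ, Function.iterate_zero, Function.comp_apply, id_eq,
      Derivation.leibniz, pow_two, smul_eq_mul, map_add, map_mul, ← hp, ← hq]
    ring)
  -- Modulo `𝔫`, the form `(α, β)` vanishes on the nonzero vector `(p, q)` and equals 1 on `(D w, D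
  -- c)`, so the two vectors form a basis. Then `h0`, `h1`, `h2` say that, in the coordinates of
  -- this basis, the cubic `W² C` is a multiple of the cube of a linear form, which is impossible.
  -- The case split on `p'` carries this out.
  have h3 : π α * p + π β * q = 0 := by
    refine mul_right_cancel₀ hτ ?_
    rw [← hz, map_add, map_mul, map_mul] at hπz
    linear_combination hπz + π α * hp + π β * hq
  have h4 : π α * π (D w) + π β * π (D c) + τ * (p * π (D α) + q * π (D β)) = 1 := by
    rw [← map_one π, ← hDz, ← hz]
    simp only [map_add, Derivation.leibniz, smul_eq_mul, map_mul]
    linear_combination π (D α) * hp + π (D β) * hq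
  have h5 := h.isUnit_iff.1 (h.isUnit_ofNat 2)
  obtain ⟨r, s, hrs⟩ := hrs
  have hprime := h.isPrime
  have hκ : IsDomain (S ⧸ 𝔫) := (Ideal.Quotient.isDomain_iff_prime _).2 hprime
  have hτ0 : Ideal.Quotient.mk 𝔫 τ = 0 := Ideal.Quotient.eq_zero_iff_mem.2 hτn
  rw [← Ideal.Quotient.eq_zero_iff_mem] at h0 h1 h2 h5
  replace h3 := congrArg (Ideal.Quotient.mk 𝔫) h3
  replace h4 := congrArg (Ideal.Quotient.mk 𝔫) h4
  replace hrs := congrArg (Ideal.Quotient.mk 𝔫) hrs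
  simp only [map_add, map_mul, map_pow, map_zero, map_one, hτ0, zero_mul, add_zero, map_ofNat]
    at h0 h1 h2 h3 h4 h5 hrs
  generalize Ideal.Quotient.mk 𝔫 p = p', Ideal.Quotient.mk 𝔫 q = q',
    Ideal.Quotient.mk 𝔫 (π α) = α', Ideal.Quotient.mk 𝔫 (π β) = β',
    Ideal.Quotient.mk 𝔫 (π (D w)) = a, Ideal.Quotient.mk 𝔫 (π (D c)) = b,
    Ideal.Quotient.mk 𝔫 r = r', Ideal.Quotient.mk 𝔫 s = s' at h0 h1 h2 h3 h4 h5 hrs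
  by_cases hp0 : p' = 0
  · subst hp0
    have hq0 : q' ≠ 0 := by rintro rfl; simp at hrs
    have ha : a = 0 := by simpa [h5, hq0] using h2
    have hβ : β' = 0 := by simpa [hq0] using h3
    simp [ha, hβ] at h4
  · have hq0 : q' = 0 := by simpa [hp0] using h0
    subst hq0
    have hb : b = 0 := by simpa [hp0] using h1
    have hα : α' = 0 := by simpa [hp0] using h3
    simp [hb, hα] at h4

namespace Germ

variable {k R : Type u} [Field k] [CharZero k] [CommRing R] {φ : k →+* R} {𝔪 : Ideal R} {n : ℕ}

/-- A coordinate hyperplane meeting `(w, x ^ q)` transversally. -/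
theorem exists_coordinate_of_isUnit {m : ℕ} (h : Germ φ 𝔪 (m + 2)) {w x z α β : R} {q : ℕ}
    {o : Fin m → R} (ho : Ideal.span (insert w (insert x (Set.range o))) = 𝔪) (hq : q ≠ 0)
    (hα : IsUnit α) (hz : α * w + β * x ^ q = z) :
    Ideal.Quotient.mk (Ideal.span {z}) x ∈ 𝔪.map (Ideal.Quotient.mk (Ideal.span {z})) ∧
    Ideal.Quotient.mk (Ideal.span {z}) x ∉ 𝔪.map (Ideal.Quotient.mk (Ideal.span {z})) ^ 2 ∧
    (Ideal.span {w, x ^ q}).map (Ideal.Quotient.mk (Ideal.span {z})) =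
      Ideal.span {Ideal.Quotient.mk (Ideal.span {z}) x ^ q} := by
  have hxm : x ∈ 𝔪 := ho ▸ Ideal.subset_span (by simp)
  have hwm : w ∈ 𝔪 := ho ▸ Ideal.subset_span (by simp)
  have hz' : Ideal.span (insert z (insert x (Set.range o))) = 𝔪 := by
    apply le_antisymm
    · rw [Ideal.span_le]
      rintro r (rfl | rfl | ⟨j, rfl⟩)
      · rw [← hz]
        exact 𝔪.add_mem (𝔪.mul_mem_left _ hwm) (𝔪.mul_mem_left _ (𝔪.pow_mem_of_mem hxm q hq.bot_lt))
      · exact hxm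
      · exact ho ▸ Ideal.subset_span (by simp)
    · rw [← ho, Ideal.span_le]
      rintro r (rfl | rfl | ⟨j, rfl⟩)
      · refine (Ideal.unit_mul_mem_iff_mem _ hα).1 ?_
        rw [eq_sub_of_add_eq hz]
        refine Ideal.sub_mem _ (Ideal.subset_span (by simp)) (Ideal.mul_mem_left _ _ ?_)
        exact Ideal.pow_mem_of_mem _ (Ideal.subset_span (by simp)) q hq.bot_lt
      · exact Ideal.subset_span (by simp)
      · exact Ideal.subset_span (by simp)
  have hquot : Germ ((Ideal.Quotient.mk (Ideal.span {z})).comp φ)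
      (𝔪.map (Ideal.Quotient.mk (Ideal.span {z}))) (m + 1) :=
    h.quotient (o := Fin.cons x o) (by rwa [Fin.range_cons])
  refine ⟨Ideal.mem_map_of_mem _ hxm, hquot.notMem_sq_of_params
    (o := fun j => Ideal.Quotient.mk (Ideal.span {z}) (o j)) ?_, ?_⟩
  · rw [← map_span_insert_insert, hz']
  · have hwx : Ideal.Quotient.mk (Ideal.span {z}) w ∈
        Ideal.span {Ideal.Quotient.mk (Ideal.span {z}) x ^ q} := by
      refine (Ideal.unit_mul_mem_iff_mem _ (hα.map (Ideal.Quotient.mk (Ideal.span {z})))).1 ?_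
      have h1 : Ideal.Quotient.mk (Ideal.span {z}) z = 0 :=
        Ideal.Quotient.eq_zero_iff_mem.2 (Ideal.mem_span_singleton_self z)
      rw [← map_mul, eq_sub_of_add_eq hz, map_sub, h1, map_mul, map_pow, zero_sub]
      exact neg_mem (Ideal.mul_mem_left _ _ (Ideal.mem_span_singleton_self _))
    rw [Ideal.map_span, Set.image_pair, map_pow]
    exact Submodule.span_insert_eq_span hwx

/-- The bounds give order 3 and put every maximal contact element `z` in `(w, x ^ q)`. That ideal
restricts to `(t ^ q)` on `V(z)` for a coordinate `t`, so the coefficient ideal is `(t) ^ (6 q)`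
with multiplicity 6, whence the entry `q`. -/
theorem hasInv_two {m : ℕ} (h : Germ φ 𝔪 (m + 2)) {I : Ideal R} {w x c : R} {q : ℕ}
    {o : Fin m → R} (ho : Ideal.span (insert w (insert x (Set.range o))) = 𝔪)
    (hq : q = 1 ∨ q = 2) (hJ : Ideal.span {w, c} = Ideal.span {w, x ^ q})
    (hI : I ≤ Ideal.span {w, c} ^ 3) (hwc : w ^ 2 * c ∈ I) (hI4 : ¬ I ≤ 𝔪 ^ 4)
    {s : List (WithTop ℚ)} (hs : HasInv φ 𝔪 I 2 s) :
    s = [((3 / 2 : ℚ) : WithTop ℚ), 0, ((q : ℚ) : WithTop ℚ), 0, ⊤] := by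
  have hq0 : q ≠ 0 := by omega
  have hxm : x ∈ 𝔪 := ho ▸ Ideal.subset_span (by simp)
  have hwm : w ∈ 𝔪 := ho ▸ Ideal.subset_span (by simp)
  have hJm : Ideal.span {w, c} ≤ 𝔪 := by
    rw [hJ, Ideal.span_le]
    rintro r (rfl | rfl)
    · exact hwm
    · exact 𝔪.pow_mem_of_mem hxm q hq0.bot_lt
  have hI3 : I ≤ 𝔪 ^ 3 := hI.trans (Ideal.pow_right_mono hJm 3)
  obtain ⟨h0, -⟩ | ⟨m', z, D, s', hm, hIm, hz, hzI, hD, hs', rfl⟩ := hasInv_cases hs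
  · exact absurd (h0 ▸ bot_le) hI4
  obtain rfl : m' = 3 := by
    by_contra hne
    rcases Nat.lt_or_gt_of_ne hne with hlt | hlt
    · exact hIm.2 (hI3.trans (Ideal.pow_le_pow_right hlt))
    · exact hI4 (hIm.1.trans (Ideal.pow_le_pow_right hlt))
  have hzJ : z ∈ Ideal.span {w, c} := by
    have := iterate_derivClosure_le (φ := φ) (derivClosure_pow_le (Ideal.span {w, c})) 1 2 hI hzI
    simpa using this
  obtain ⟨-, -, -, -, -, -, hDz⟩ := h.isPartialDerivative_iff.1 hD
  obtain ⟨p, hp, hquot⟩ := h.quotient_of_order_one hz.1 hz.2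
  have ht : ∃ t, t ∈ 𝔪.map (Ideal.Quotient.mk (Ideal.span {z})) ∧
      t ∉ 𝔪.map (Ideal.Quotient.mk (Ideal.span {z})) ^ 2 ∧
      (Ideal.span {w, c}).map (Ideal.Quotient.mk (Ideal.span {z})) = Ideal.span {t ^ q} := by
    rw [hJ, Ideal.mem_span_pair] at hzJ
    obtain ⟨α, β, hαβ⟩ := hzJ
    rw [hJ]
    -- A non-unit `α` is possible only for `q = 1`. Then `β` is a unit and `w` replaces `x` as the
    -- coordinate on `V(z)`. For `q = 2` it would put `z` in `𝔪 ^ 2`.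
    by_cases hα : IsUnit α
    · exact ⟨_, h.exists_coordinate_of_isUnit ho hq0 hα hαβ⟩
    have hα' : α ∈ 𝔪 := (h.mem_iff _).2 hα
    have hαw : α * w ∈ 𝔪 ^ 2 := by rw [pow_two]; exact Ideal.mul_mem_mul hα' hwm
    rcases hq with rfl | rfl
    · have hβ : IsUnit β := by
        rw [h.isUnit_iff]
        intro hβ
        apply hz.2
        rw [← hαβ]
        refine Ideal.add_mem _ hαw ?_
        rw [pow_two, pow_one]
        exact Ideal.mul_mem_mul hβ hxm
      have ho' : Ideal.span (insert x (insert w (Set.range o))) = 𝔪 := by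
        rw [Set.insert_comm, ho]
      have := h.exists_coordinate_of_isUnit (z := z) (β := α) ho' one_ne_zero hβ
        (by rw [← hαβ, pow_one, pow_one, add_comm])
      simp only [pow_one] at this ⊢
      rw [Set.pair_comm w x]
      exact ⟨_, this⟩
    · refine absurd ?_ hz.2
      rw [← hαβ]
      exact Ideal.add_mem _ hαw (Ideal.mul_mem_left _ _ (Ideal.pow_mem_pow hxm 2))
  obtain ⟨t, ht, ht2, hJt⟩ := ht
  have hdom := hquot.isDomain
  have ht0 : t ≠ 0 := by rintro rfl; exact ht2 (Ideal.zero_mem _)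
  rw [Ideal.mem_span_pair] at hzJ
  obtain ⟨α, β, hαβ⟩ := hzJ
  rw [coeffIdeal_three_map hquot hI hwc hαβ
    (Ideal.Quotient.eq_zero_iff_mem.2 (Ideal.mem_span_singleton_self z)) hDz (pow_ne_zero q ht0)
    (Ideal.pow_mem_of_mem _ ht q hq0.bot_lt) hJt, ← Ideal.span_singleton_pow, ← pow_mul,
    coeffMultiplicity_three] at hs'
  rw [hquot.hasInv_span_pow ht ht2 (by omega) hs']
  have e : (((q * 6 : ℕ) : ℚ) / ((6 : ℕ) : ℚ)) = (q : ℚ) := by push_cast; field_simp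
  rw [e]
  norm_num

end Germ
namespace Germ

variable {k R : Type u} [Field k] [CharZero k] [CommRing R] {φ : k →+* R} {𝔪 : Ideal R} {n : ℕ}

theorem sq_add_notMem (h : Germ φ 𝔪 n) {z w c : R} {D : Derivation ℤ R R} (hzm : z ∈ 𝔪)
    (hw : w ∈ 𝔪) (hDz : IsUnit (D z)) (hDw : D w = 0) :
    z ^ 2 + c * w ^ 2 ∉ 𝔪 ^ 3 := by
  intro H
  have h1 := derivation_mem_pow 𝔪 D 1 (derivation_mem_pow 𝔪 D 2 H)
  have e : D (D (z ^ 2 + c * w ^ 2)) = 2 * (D z) ^ 2 + (z * (2 * D (D z)) + w * (w * D (D c))) := by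
    simp only [pow_two, Derivation.leibniz, smul_eq_mul, map_add, hDw, map_zero]
    ring
  rw [e, pow_one] at h1
  have h2 := (𝔪.add_mem_iff_left (𝔪.add_mem (𝔪.mul_mem_right _ hzm) (𝔪.mul_mem_right _ hw))).1 h1
  exact h.isUnit_iff.1 ((h.isUnit_ofNat 2).mul (hDz.pow 2)) h2

/-- All first derivatives of the equation lie in `(z) + w (w, c)`, so any maximal contact element is
`y = v z + w g` with `v` a unit and `g ∈ (w, c)`. On `V(y)` one has `z = -w g'`, the equation
becomes `w² c'` with `c' = c + g'²`, and `(w, c') = (w, c)`. Squares of derivatives restrict into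
`(w, c)⁴`, so `hasInv_two` applies. The derivation `E` serves to show that `c'` keeps order one on
`V(y)`. -/
theorem hasInv_sq_add {m : ℕ} (h : Germ φ 𝔪 (m + 3)) {z w x c : R} {q : ℕ}
    {o : Fin m → R} (ho : Ideal.span (insert z (insert w (insert x (Set.range o)))) = 𝔪)
    (hq : q = 1 ∨ q = 2) (hJ : Ideal.span {w, c} = Ideal.span {w, x ^ q})
    {E : Derivation ℤ R R} (hEz : E z = 0) (hEc : IsUnit (E c))
    {s : List (WithTop ℚ)} (hs : HasInv φ 𝔪 (Ideal.span {z ^ 2 + c * w ^ 2}) 1 s) :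
    s = [2, 0, ((3 / 2 : ℚ) : WithTop ℚ), 0, ((q : ℚ) : WithTop ℚ), 0, ⊤] := by
  have hq0 : q ≠ 0 := by omega
  have hzm : z ∈ 𝔪 := ho ▸ Ideal.subset_span (by simp)
  have hwm : w ∈ 𝔪 := ho ▸ Ideal.subset_span (by simp)
  have hxm : x ∈ 𝔪 := ho ▸ Ideal.subset_span (by simp)
  have hJm : Ideal.span {w, c} ≤ 𝔪 := by
    rw [hJ, Ideal.span_le]
    rintro r (rfl | rfl)
    · exact hwm
    · exact 𝔪.pow_mem_of_mem hxm q hq0.bot_lt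
  have hwJ : w ∈ Ideal.span {w, c} := Ideal.subset_span (by simp)
  have hcJ : c ∈ Ideal.span {w, c} := Ideal.subset_span (by simp)
  have hcm : c ∈ 𝔪 := hJm hcJ
  obtain ⟨Dz, hDz, hDw⟩ : ∃ D : Derivation ℤ R R, D z = 1 ∧ D w = 0 := by
    obtain ⟨D, -, ⟨-, hD, hDo⟩, -⟩ := h.exists_dual_insert (z := z) (o := Fin.cons w (Fin.cons x o))
      (by rwa [Fin.range_cons, Fin.range_cons])
    exact ⟨D, hD, hDo 0⟩
  have hf2 : z ^ 2 + c * w ^ 2 ∈ 𝔪 ^ 2 := Ideal.add_mem _ (Ideal.pow_mem_pow hzm 2)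
    (Ideal.mul_mem_left _ _ (Ideal.pow_mem_pow hwm 2))
  have hf3 : z ^ 2 + c * w ^ 2 ∉ 𝔪 ^ 3 :=
    h.sq_add_notMem hzm hwm (hDz ▸ isUnit_one) hDw
  have hdom := h.isDomain
  set f := z ^ 2 + c * w ^ 2 with hf
  obtain ⟨h0, -⟩ | ⟨m', y, D, s', hm, hIm, hy, hyI, hD, hs', rfl⟩ := hasInv_cases hs
  · rw [Ideal.span_singleton_eq_bot] at h0
    exact absurd (h0 ▸ Ideal.zero_mem _) hf3
  rw [Ideal.span_singleton_le_iff_mem, Ideal.span_singleton_le_iff_mem] at hIm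
  obtain rfl : m' = 2 := by
    by_contra hne
    rcases Nat.lt_or_gt_of_ne hne with hlt | hlt
    · exact hIm.2 (Ideal.pow_le_pow_right hlt hf2)
    · exact hf3 (Ideal.pow_le_pow_right hlt hIm.1)
  have hK : ∀ D : Derivation ℤ R R, D f ∈ Ideal.span {z} ⊔ Ideal.span {w} * Ideal.span {w, c} := by
    intro D
    have e : D f = z * (2 * D z) + w * (w * D c + c * (2 * D w)) := by
      simp only [hf, pow_two, Derivation.leibniz, smul_eq_mul, map_add]
      ring
    rw [e]
    exact Submodule.add_mem_sup (Ideal.mul_mem_right _ _ (Ideal.mem_span_singleton_self z))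
      (Ideal.mul_mem_mul (Ideal.mem_span_singleton_self w)
        (Ideal.add_mem _ (Ideal.mul_mem_right _ _ hwJ) (Ideal.mul_mem_right _ _ hcJ)))
  have hfK : f ∈ Ideal.span {z} ⊔ Ideal.span {w} * Ideal.span {w, c} := by
    rw [hf, show z ^ 2 + c * w ^ 2 = z * z + w * (c * w) by ring]
    exact Submodule.add_mem_sup (Ideal.mul_mem_right _ _ (Ideal.mem_span_singleton_self z))
      (Ideal.mul_mem_mul (Ideal.mem_span_singleton_self w) (Ideal.mul_mem_right _ _ hcJ))
  have hfK' : Ideal.span {f} ≤ Ideal.span {z} ⊔ Ideal.span {w} * Ideal.span {w, c} :=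
    (Ideal.span_singleton_le_iff_mem _).2 hfK
  have hyK : y ∈ Ideal.span {z} ⊔ Ideal.span {w} * Ideal.span {w, c} := by
    refine (derivClosure_le_iff.2 ⟨hfK', fun D _ g hg => ?_⟩ : derivClosure φ _ ≤ _) hyI
    refine derivation_mem_sup_span _ hfK' rfl ?_ hg
    rintro _ rfl
    exact hK D
  obtain ⟨z', hz', wh, hwh, hyzw⟩ := Submodule.mem_sup.1 hyK
  obtain ⟨v, rfl⟩ := Ideal.mem_span_singleton'.1 hz'
  obtain ⟨g, hg, rfl⟩ := Ideal.mem_span_singleton_mul.1 hwh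
  have hwg : w * g ∈ 𝔪 ^ 2 := by rw [pow_two]; exact Ideal.mul_mem_mul hwm (hJm hg)
  have hv : IsUnit v := by
    rw [h.isUnit_iff]
    intro hv
    apply hy.2
    rw [← hyzw]
    refine Ideal.add_mem _ ?_ hwg
    rw [pow_two]
    exact Ideal.mul_mem_mul hv hzm
  obtain ⟨v, rfl⟩ := hv
  obtain ⟨g', hg', hz⟩ : ∃ g' ∈ Ideal.span {w, c}, z = ↑v⁻¹ * y - w * g' :=
    ⟨↑v⁻¹ * g, Ideal.mul_mem_left _ _ hg, by
      rw [← hyzw]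
      linear_combination (-z) * v.inv_mul⟩
  have hyp : Ideal.span (insert y (insert w (insert x (Set.range o)))) = 𝔪 := by
    apply le_antisymm
    · rw [Ideal.span_le]
      rintro r (rfl | hr)
      · exact hy.1
      · exact ho ▸ Ideal.subset_span (Set.mem_insert_of_mem _ hr)
    · rw [← ho, Ideal.span_le]
      rintro r (hr | hr)
      · rw [hr, hz]
        exact Ideal.sub_mem _ (Ideal.mul_mem_left _ _ (Ideal.subset_span (by simp)))
          (Ideal.mul_mem_right _ _ (Ideal.subset_span (by simp)))
      · exact Ideal.subset_span (Set.mem_insert_of_mem _ hr)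
  have hquot : Germ ((Ideal.Quotient.mk (Ideal.span {y})).comp φ)
      (𝔪.map (Ideal.Quotient.mk (Ideal.span {y}))) (m + 2) :=
    h.quotient (o := Fin.cons w (Fin.cons x o)) (by rwa [Fin.range_cons, Fin.range_cons])
  have hπy : Ideal.Quotient.mk (Ideal.span {y}) y = 0 :=
    Ideal.Quotient.eq_zero_iff_mem.2 (Ideal.mem_span_singleton_self y)
  have hym : Ideal.span {y} ≤ 𝔪 := (Ideal.span_singleton_le_iff_mem _).2 hy.1
  set c' := c + g' ^ 2 with hc'
  have hJ' : Ideal.span {w, c'} = Ideal.span {w, c} := by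
    obtain ⟨a, b, hab⟩ := Ideal.mem_span_pair.1 hg'
    have hu : IsUnit (1 + (b ^ 2 * c + 2 * a * b * w)) :=
      h.isUnit_add isUnit_one (𝔪.add_mem (𝔪.mul_mem_left _ hcm) (𝔪.mul_mem_left _ hwm))
    have e : c' = (1 + (b ^ 2 * c + 2 * a * b * w)) * c + a ^ 2 * w * w := by
      rw [hc', ← hab]; ring
    apply le_antisymm
    · rw [Ideal.span_le]
      rintro r (rfl | rfl)
      · exact hwJ
      · exact Ideal.add_mem _ hcJ (Ideal.pow_mem_of_mem _ hg' 2 two_pos)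
    · rw [Ideal.span_le]
      rintro r (rfl | rfl)
      · exact Ideal.subset_span (by simp)
      · refine (Ideal.unit_mul_mem_iff_mem _ hu).1 ?_
        rw [← sub_eq_iff_eq_add.2 e]
        exact Ideal.sub_mem _ (Ideal.subset_span (by simp))
          (Ideal.mul_mem_left _ _ (Ideal.subset_span (by simp)))
  have hc'm : c' ∈ 𝔪 := 𝔪.add_mem hcm (𝔪.pow_mem_of_mem (hJm hg') 2 two_pos)
  have hπf : Ideal.Quotient.mk (Ideal.span {y}) f = Ideal.Quotient.mk (Ideal.span {y}) w ^ 2 *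
      Ideal.Quotient.mk (Ideal.span {y}) c' := by
    rw [hf, hc', hz]
    simp only [map_add, map_sub, map_mul, map_pow, hπy]
    ring
  have hπJ : (Ideal.span {w, c}).map (Ideal.Quotient.mk (Ideal.span {y})) =
      Ideal.span {Ideal.Quotient.mk (Ideal.span {y}) w, Ideal.Quotient.mk (Ideal.span {y}) c'} := by
    rw [← hJ', Ideal.map_span, Set.image_pair]
  have hπK : (Ideal.span {z} ⊔ Ideal.span {w} * Ideal.span {w, c}).map
      (Ideal.Quotient.mk (Ideal.span {y})) ≤
      (Ideal.span {w, c}).map (Ideal.Quotient.mk (Ideal.span {y})) ^ 2 := by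
    have h1 : Ideal.span {w} * Ideal.span {w, c} ≤ Ideal.span {w, c} ^ 2 := by
      rw [pow_two]
      exact Ideal.mul_mono_left ((Ideal.span_singleton_le_iff_mem _).2 hwJ)
    rw [Ideal.map_sup, ← Ideal.map_pow, sup_le_iff]
    refine ⟨?_, Ideal.map_mono h1⟩
    rw [Ideal.map_span, Set.image_singleton, Ideal.span_singleton_le_iff_mem, hz, map_sub, map_mul,
      hπy, mul_zero, zero_sub]
    exact neg_mem (Ideal.mem_map_of_mem _
      (h1 (Ideal.mul_mem_mul (Ideal.mem_span_singleton_self w) hg')))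
  have hpc : partialClosure D (Ideal.span {f}) ≤
      Ideal.span {z} ⊔ Ideal.span {w} * Ideal.span {w, c} := by
    refine partialClosure_le_iff.2 ⟨hfK', fun g hg => ?_⟩
    refine derivation_mem_sup_span _ hfK' rfl ?_ hg
    rintro _ rfl
    exact hK D
  have hI3 : (coeffIdeal D 2 (Ideal.span {f})).map (Ideal.Quotient.mk (Ideal.span {y})) ≤
      (Ideal.span {w, c}).map (Ideal.Quotient.mk (Ideal.span {y})) ^ 3 := by
    rw [Ideal.map_le_iff_le_comap, coeffIdeal_le_iff]
    intro j hj
    rw [← Ideal.map_le_iff_le_comap, Ideal.map_pow, coeffMultiplicity_two]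
    interval_cases j
    · simp only [Function.iterate_zero, id_eq, Ideal.map_span, Set.image_singleton, tsub_zero,
        Nat.div_self, two_pos, pow_one]
      rw [Ideal.span_singleton_le_iff_mem, hπf, ← map_pow, ← map_mul,
        ← Ideal.map_span, ← Ideal.map_pow, ← hJ']
      refine Ideal.mem_map_of_mem _ ?_
      rw [pow_succ]
      exact Ideal.mul_mem_mul (Ideal.pow_mem_pow (Ideal.subset_span (by simp)) 2)
        (Ideal.subset_span (by simp))
    · refine (Ideal.pow_right_mono ((Ideal.map_mono hpc).trans hπK) _).trans ?_
      rw [← pow_mul]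
      exact Ideal.pow_le_pow_right (by norm_num)
  have hfI : Ideal.Quotient.mk (Ideal.span {y}) f ∈
      (coeffIdeal D 2 (Ideal.span {f})).map (Ideal.Quotient.mk (Ideal.span {y})) := by
    refine Ideal.mem_map_of_mem _ (le_coeffIdeal D _ two_pos ?_)
    rw [coeffMultiplicity_two]
    simp
  have hyp' := map_span_insert_insert_insert y w x o
  rw [hyp] at hyp'
  have hπw2 : Ideal.Quotient.mk (Ideal.span {y}) w ∉
      𝔪.map (Ideal.Quotient.mk (Ideal.span {y})) ^ 2 :=
    hquot.notMem_sq_of_params (o := Fin.cons (Ideal.Quotient.mk (Ideal.span {y}) x)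
      fun j => Ideal.Quotient.mk (Ideal.span {y}) (o j)) (by rw [Fin.range_cons, hyp'])
  have hπc2 : Ideal.Quotient.mk (Ideal.span {y}) c' ∉
      𝔪.map (Ideal.Quotient.mk (Ideal.span {y})) ^ 2 := by
    rw [← Ideal.map_pow]
    intro H
    rw [← Ideal.mem_comap, Ideal.comap_map_of_surjective _ Ideal.Quotient.mk_surjective,
      ← RingHom.ker_eq_comap_bot, Ideal.mk_ker] at H
    obtain ⟨r, hr, r', hr', hrr⟩ := Submodule.mem_sup.1 H
    obtain ⟨r', rfl⟩ := Ideal.mem_span_singleton'.1 hr'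
    have h1 : E r ∈ 𝔪 := by simpa using derivation_mem_pow 𝔪 E 1 hr
    have h2 : E (w * g) ∈ 𝔪 := by simpa using derivation_mem_pow 𝔪 E 1 hwg
    have h3 : E y ∈ 𝔪 := by
      rw [← hyzw, map_add, E.leibniz, hEz, smul_zero, zero_add, smul_eq_mul]
      exact 𝔪.add_mem (𝔪.mul_mem_right _ hzm) h2
    have h4 : E c' = E c + 2 * g' * E g' := by
      rw [hc', map_add, pow_two, E.leibniz, smul_eq_mul]; ring
    have h5 : E c = E r + (r' * E y + y * E r') - 2 * g' * E g' := by
      rw [eq_sub_iff_add_eq, ← h4, ← hrr, map_add, E.leibniz, smul_eq_mul, smul_eq_mul]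
    refine h.isUnit_iff.1 hEc ?_
    rw [h5]
    exact 𝔪.sub_mem (𝔪.add_mem h1 (𝔪.add_mem (𝔪.mul_mem_left _ h3) (𝔪.mul_mem_right _ hy.1)))
      (𝔪.mul_mem_right _ (𝔪.mul_mem_left _ (hJm hg')))
  have hI4 : ¬ (coeffIdeal D 2 (Ideal.span {f})).map (Ideal.Quotient.mk (Ideal.span {y})) ≤
      𝔪.map (Ideal.Quotient.mk (Ideal.span {y})) ^ 4 := fun H =>
    hquot.sq_mul_notMem (Ideal.mem_map_of_mem _ hwm) hπw2 (Ideal.mem_map_of_mem _ hc'm) hπc2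
      (hπf ▸ H hfI)
  have hJq : Ideal.span {Ideal.Quotient.mk (Ideal.span {y}) w,
      Ideal.Quotient.mk (Ideal.span {y}) c'} = Ideal.span {Ideal.Quotient.mk (Ideal.span {y}) w,
      Ideal.Quotient.mk (Ideal.span {y}) x ^ q} := by
    rw [← hπJ, hJ, Ideal.map_span, Set.image_pair, map_pow]
  rw [hquot.hasInv_two hyp'.symm hq hJq (hπJ ▸ hI3) (hπf ▸ hfI) hI4 hs']
  norm_num

end Germ

/-! ### Binary cubics contained in a prime -/

section PairPowers

variable {R : Type u} [CommRing R]

theorem span_pair_pow_le {a b : R} (p : ℕ) {K : Ideal R}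
    (h : ∀ i j, i + j = p → a ^ i * b ^ j ∈ K) : Ideal.span {a, b} ^ p ≤ K := by
  induction p generalizing K with
  | zero =>
    have := h 0 0 rfl
    simp only [pow_zero, mul_one] at this
    rw [(Ideal.eq_top_iff_one K).2 this]
    exact le_top
  | succ p ih =>
    rw [pow_succ', Ideal.mul_le]
    intro r hr s hs
    obtain ⟨u, v, rfl⟩ := Ideal.mem_span_pair.1 hr
    have h1 : s ∈ Submodule.comap (LinearMap.mulLeft R a) K := by
      refine ih (fun i j hij => ?_) hs
      change a * (a ^ i * b ^ j) ∈ K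
      rw [← mul_assoc, ← pow_succ']
      exact h _ _ (by omega)
    have h2 : s ∈ Submodule.comap (LinearMap.mulLeft R b) K := by
      refine ih (fun i j hij => ?_) hs
      change b * (a ^ i * b ^ j) ∈ K
      rw [mul_left_comm, ← pow_succ']
      exact h _ _ (by omega)
    change a * s ∈ K at h1
    change b * s ∈ K at h2
    rw [add_mul, mul_assoc, mul_assoc]
    exact K.add_mem (K.mul_mem_left _ h1) (K.mul_mem_left _ h2)

theorem pow_mul_pow_mem_span_pair_pow (a b : R) (i j : ℕ) :
    a ^ i * b ^ j ∈ Ideal.span {a, b} ^ (i + j) := by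
  rw [pow_add]
  exact Ideal.mul_mem_mul (Ideal.pow_mem_pow (Ideal.subset_span (by simp)) i)
    (Ideal.pow_mem_pow (Ideal.subset_span (by simp)) j)

theorem mem_span_pair_pow_three {a b g : R} (hg : g ∈ Ideal.span {a, b} ^ 3) :
    ∃ r₀ r₁ r₂ r₃, g = r₀ * b ^ 3 + r₁ * (a * b ^ 2) + r₂ * (a ^ 2 * b) + r₃ * a ^ 3 := by
  have h1 : Ideal.span {a, b} ^ 3 ≤ Ideal.span {b ^ 3, a * b ^ 2, a ^ 2 * b, a ^ 3} := by
    refine span_pair_pow_le 3 fun i j hij => Ideal.subset_span ?_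
    obtain rfl : j = 3 - i := by omega
    have : i ≤ 3 := by omega
    interval_cases i <;> simp
  have h2 := h1 hg
  simp only [Ideal.mem_span_insert, Ideal.mem_span_singleton'] at h2
  obtain ⟨r₀, _, ⟨r₁, _, ⟨r₂, _, ⟨r₃, rfl⟩, rfl⟩, rfl⟩, rfl⟩ := h2
  exact ⟨r₀, r₁, r₂, r₃, by ring⟩

end PairPowers

namespace Germ

variable {k R : Type u} [Field k] [CharZero k] [CommRing R] {φ : k →+* R} {𝔪 : Ideal R} {n : ℕ}

theorem not_pow_le_sup_mul (h : Germ φ 𝔪 n) {Q J : Ideal R} (hQ : Q.IsPrime) (hJQ : ¬ J ≤ Q)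
    (p : ℕ) : ¬ J ^ p ≤ Q ⊔ 𝔪 * J ^ p :=
  fun H => hJQ (hQ.le_of_pow_le (h.le_of_le_sup_mul H))

/-- Nakayama removes the `𝔪`-term, so with `q = p + 1` the monomial `η τ ^ p` is a multiple `ρ τ ^
(p + 1)` modulo `Q`. If `τ ^ p` were in `Q`, so would be `(η, τ) ^ q`; hence `τ ^ p` cancels. -/
theorem exists_sub_mul_mem (h : Germ φ 𝔪 n) {Q : Ideal R} {η τ : R} (hQ : Q.IsPrime)
    (hJQ : ¬ Ideal.span {η, τ} ≤ Q) {q : ℕ} (hq : q ≠ 0)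
    (H : Ideal.span {η, τ} ^ q ≤ Q ⊔ Ideal.span {τ ^ q} ⊔ 𝔪 * Ideal.span {η, τ} ^ q) :
    ∃ ρ, η - ρ * τ ∈ Q := by
  obtain ⟨p, rfl⟩ := Nat.exists_eq_succ_of_ne_zero hq
  rw [Nat.succ_eq_add_one] at H
  have h1 := h.le_of_le_sup_mul H
  have h2 : η ^ 1 * τ ^ p ∈ Ideal.span {η, τ} ^ (1 + p) := pow_mul_pow_mem_span_pair_pow η τ 1 p
  rw [add_comm] at h2
  obtain ⟨r, hr, r', hr', e⟩ := Submodule.mem_sup.1 (h1 h2)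
  obtain ⟨ρ, rfl⟩ := Ideal.mem_span_singleton'.1 hr'
  refine ⟨ρ, ?_⟩
  have h3 : τ ^ p * (η - ρ * τ) ∈ Q := by
    convert hr using 1
    rw [eq_sub_of_add_eq e]; ring
  refine (hQ.mem_or_mem h3).resolve_left fun h4 => hJQ ?_
  refine hQ.le_of_pow_le (h1.trans (sup_le le_rfl ?_))
  rw [Ideal.span_singleton_le_iff_mem, pow_succ]
  exact Q.mul_mem_right _ h4

/-- The first derivative of a binary cubic. -/
theorem derivation_cubic_mem {Q : Ideal R} {η τ e' a b c d : R} {D : Derivation ℤ R R}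
    (hη : η ∈ 𝔪) (hτ : τ ∈ 𝔪) (hDη : D η = 1 + τ * e') (hDτ : D τ = 0)
    (hQ : D (a * τ ^ 3 + b * (η * τ ^ 2) + c * (η ^ 2 * τ) + d * η ^ 3) ∈ Q) :
    b * τ ^ 2 + 2 * c * (η * τ) + 3 * d * η ^ 2 ∈ Q ⊔ 𝔪 * Ideal.span {η, τ} ^ 2 := by
  have hmon : ∀ (i j : ℕ), i + j = 2 → ∀ r ∈ 𝔪,
      r * (η ^ i * τ ^ j) ∈ 𝔪 * Ideal.span {η, τ} ^ 2 := by
    intro i j hij r hr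
    rw [← hij]
    exact Ideal.mul_mem_mul hr (pow_mul_pow_mem_span_pair_pow η τ i j)
  have h1 : (τ * D a + η * D b + τ * e' * b) * (η ^ 0 * τ ^ 2) ∈
      𝔪 * Ideal.span {η, τ} ^ 2 :=
    hmon _ _ rfl _ (𝔪.add_mem (𝔪.add_mem (𝔪.mul_mem_right _ hτ) (𝔪.mul_mem_right _ hη))
        (𝔪.mul_mem_right _ (𝔪.mul_mem_right _ hτ)))
  have h2 : (η * D c + τ * e' * (2 * c)) * (η ^ 1 * τ ^ 1) ∈ 𝔪 * Ideal.span {η, τ} ^ 2 :=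
    hmon _ _ rfl _ (𝔪.add_mem (𝔪.mul_mem_right _ hη) (𝔪.mul_mem_right _ (𝔪.mul_mem_right _ hτ)))
  have h3 : (η * D d + τ * e' * (3 * d)) * (η ^ 2 * τ ^ 0) ∈ 𝔪 * Ideal.span {η, τ} ^ 2 :=
    hmon _ _ rfl _ (𝔪.add_mem (𝔪.mul_mem_right _ hη) (𝔪.mul_mem_right _ (𝔪.mul_mem_right _ hτ)))
  have h4 := Ideal.neg_mem_iff _ |>.2 (Ideal.add_mem _ (Ideal.add_mem _ h1 h2) h3)
  convert Submodule.add_mem_sup hQ h4 using 1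
  simp only [pow_succ, pow_zero, one_mul, map_add, Derivation.leibniz, smul_eq_mul, hDη, hDτ]
  ring

set_option maxHeartbeats 400000 in
/-- A prime containing a nondegenerate family of binary cubics in `(ζ, τ)` together with their first
derivatives, but not `(ζ, τ)`, contains a linear form. -/
theorem exists_linear_mem (h : Germ φ 𝔪 n) {I Q : Ideal R} {ζ τ : R} {D : Derivation ℤ R R}
    (hQ : Q.IsPrime) (hζ : ζ ∈ 𝔪) (hτ : τ ∈ 𝔪) (hDζ : D ζ = 1) (hDτ : D τ = 0)
    (hI : I ≤ Ideal.span {ζ, τ} ^ 3) (hIQ : I ≤ Q) (hDQ : ∀ g ∈ I, D g ∈ Q)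
    (hJQ : ¬ Ideal.span {ζ, τ} ≤ Q)
    (hnd : ∀ η ∈ Ideal.span {ζ, τ}, ¬ I ≤ Ideal.span {η} ^ 3 ⊔ 𝔪 * Ideal.span {ζ, τ} ^ 3)
    (hg : ∃ a b c d, a * τ ^ 3 + b * (ζ * τ ^ 2) + c * (ζ ^ 2 * τ) + d * ζ ^ 3 ∈ I ∧ IsUnit d) :
    ∃ ρ, ζ - ρ * τ ∈ Q := by
  obtain ⟨a, b, c, d, hgI, hd⟩ := hg
  have h3 : IsUnit (3 : R) := h.isUnit_ofNat 3
  have h2 : IsUnit (2 : R) := h.isUnit_ofNat 2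
  -- Tschirnhaus substitution: `η = ζ + e τ` with `e = c / (3 d)` removes the term in `η² τ`.
  obtain ⟨e, he⟩ : ∃ e, 3 * d * e = c := by
    obtain ⟨v, hv⟩ := h3.mul hd
    exact ⟨↑v⁻¹ * c, by rw [← hv, Units.mul_inv_cancel_left]⟩
  obtain ⟨η, hη⟩ : ∃ η, η = ζ + e * τ := ⟨_, rfl⟩
  suffices H : ∃ ρ, η - ρ * τ ∈ Q by
    obtain ⟨ρ, hρ⟩ := H
    exact ⟨ρ - e, by convert hρ using 1; rw [hη]; ring⟩
  have hζη : ζ = η - e * τ := by rw [hη]; ring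
  have hJ : Ideal.span {ζ, τ} = Ideal.span {η, τ} := by
    apply le_antisymm <;> rw [Ideal.span_le]
    · rintro r (rfl | rfl)
      · rw [hζη]
        exact Ideal.sub_mem _ (Ideal.subset_span (by simp))
          (Ideal.mul_mem_left _ _ (Ideal.subset_span (by simp)))
      · exact Ideal.subset_span (by simp)
    · rintro r (rfl | rfl)
      · rw [hη]
        exact Ideal.add_mem _ (Ideal.subset_span (by simp))
          (Ideal.mul_mem_left _ _ (Ideal.subset_span (by simp)))
      · exact Ideal.subset_span (by simp)
  have hηJ : η ∈ Ideal.span {η, τ} := Ideal.subset_span (by simp)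
  have hτJ : τ ∈ Ideal.span {η, τ} := Ideal.subset_span (by simp)
  have hηm : η ∈ 𝔪 := hη ▸ 𝔪.add_mem hζ (𝔪.mul_mem_left _ hτ)
  have hDη : D η = 1 + τ * D e := by
    rw [hη, map_add, D.leibniz, hDζ, hDτ, smul_eq_mul, smul_eq_mul]; ring
  rw [hJ] at hI hJQ hnd
  have hsub1 : ∀ p, p ≠ 0 → Ideal.span {η, τ} ^ p ≤
      Q ⊔ Ideal.span {τ ^ p} ⊔ 𝔪 * Ideal.span {η, τ} ^ p → ∃ ρ, η - ρ * τ ∈ Q :=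
    fun p hp => h.exists_sub_mul_mem hQ hJQ hp
  have hder : ∀ a b c d, a * τ ^ 3 + b * (η * τ ^ 2) + c * (η ^ 2 * τ) + d * η ^ 3 ∈ I →
      b * τ ^ 2 + 2 * c * (η * τ) + 3 * d * η ^ 2 ∈ Q ⊔ 𝔪 * Ideal.span {η, τ} ^ 2 := by
    intro a b c d hg
    exact derivation_cubic_mem hηm hτ hDη hDτ (hDQ _ hg)
  have hpw : ∀ (p : ℕ) (K : Ideal R), (∀ i j, i + j = p → η ^ i * τ ^ j ∈ K) →
    Ideal.span {η, τ} ^ p ≤ K := fun p K => span_pair_pow_le p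
  have hcub : ∀ g ∈ I, ∃ r₀ r₁ r₂ r₃,
      g = r₀ * τ ^ 3 + r₁ * (η * τ ^ 2) + r₂ * (η ^ 2 * τ) + r₃ * η ^ 3 :=
    fun g hg => mem_span_pair_pow_three (hI hg)
  have hpm : ∀ i j, η ^ i * τ ^ j ∈ Ideal.span {η, τ} ^ (i + j) :=
    fun i j => pow_mul_pow_mem_span_pair_pow η τ i j
  generalize Ideal.span {η, τ} = J at *
  have hmon : ∀ (i j p : ℕ), i + j = p → ∀ r ∈ 𝔪, r * (η ^ i * τ ^ j) ∈ Q ⊔ 𝔪 * J ^ p := by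
    rintro i j _ rfl r hr
    exact Ideal.mem_sup_right (Ideal.mul_mem_mul hr (hpm i j))
  have hmulJ : ∀ p, ∀ r ∈ J, ∀ s ∈ Q ⊔ 𝔪 * J ^ p, r * s ∈ Q ⊔ 𝔪 * J ^ (p + 1) := by
    intro p r hr s hs
    obtain ⟨s₁, hs₁, s₂, hs₂, rfl⟩ := Submodule.mem_sup.1 hs
    rw [mul_add]
    refine Submodule.add_mem_sup (Q.mul_mem_left _ hs₁) ?_
    rw [mul_comm r s₂, pow_succ, ← mul_assoc]
    exact Ideal.mul_mem_mul hs₂ hr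
  -- Congruences modulo `M p` are identities in degree `p` of the fibre cone of the image of `J` in
  -- `R ⧸ Q`. There only the residues of the coefficients count, and `D` differentiates by `η`. By
  -- Nakayama the cone is nonzero in every degree, here used in degree 4.
  obtain ⟨M, hM⟩ : ∃ M : ℕ → Ideal R, ∀ p, M p = Q ⊔ 𝔪 * J ^ p := ⟨_, fun _ => rfl⟩
  simp only [← hM] at hmon hmulJ hder
  have hQM : ∀ p, ∀ r ∈ Q, r ∈ M p := fun p r hr => by
    rw [hM]
    exact Ideal.mem_sup_left hr
  have hMK : ∀ p, M p ≤ Q ⊔ Ideal.span {τ ^ p} ⊔ 𝔪 * J ^ p := fun p => by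
    rw [hM]
    exact sup_le_sup_right le_sup_left _
  have hM4 : ¬ J ^ 4 ≤ M 4 := by
    rw [hM]
    exact h.not_pow_le_sup_mul hQ hJQ 4
  have hcontra : η ^ 2 ∈ M 2 → τ ^ 3 ∈ M 3 → False := by
    intro h1 h2
    refine hM4 (hpw 4 _ fun i j hij => ?_)
    obtain rfl : j = 4 - i := by omega
    have : i ≤ 4 := by omega
    interval_cases i
    · convert hmulJ 3 τ hτJ _ h2 using 1; ring
    · convert hmulJ 3 η hηJ _ h2 using 1; ring
    · convert hmulJ 3 τ hτJ _ (hmulJ 2 τ hτJ _ h1) using 1; ring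
    · convert hmulJ 3 τ hτJ _ (hmulJ 2 η hηJ _ h1) using 1; ring
    · convert hmulJ 3 η hηJ _ (hmulJ 2 η hηJ _ h1) using 1; ring
  obtain ⟨B, hB⟩ : ∃ B, B = 3 * d * e ^ 2 - 2 * c * e + b := ⟨_, rfl⟩
  obtain ⟨A, hA⟩ : ∃ A, A = - d * e ^ 3 + c * e ^ 2 - b * e + a := ⟨_, rfl⟩
  have hgη : a * τ ^ 3 + b * (ζ * τ ^ 2) + c * (ζ ^ 2 * τ) + d * ζ ^ 3 =
      A * τ ^ 3 + B * (η * τ ^ 2) + 0 * (η ^ 2 * τ) + d * η ^ 3 := by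
    rw [hA, hB, hζη]
    linear_combination (- η ^ 2 * τ) * he
  rw [hgη] at hgI
  have hi : B * τ ^ 2 + 3 * d * η ^ 2 ∈ M 2 := by
    simpa using hder _ _ _ _ hgI
  -- Three times the cubic minus `η` times its derivative eliminates `η³`.
  have hii : 2 * B * (η * τ ^ 2) + 3 * A * τ ^ 3 ∈ M 3 := by
    have h1 : A * τ ^ 3 + B * (η * τ ^ 2) + 0 * (η ^ 2 * τ) + d * η ^ 3 ∈ M 3 :=
      hQM _ _ (hIQ hgI)
    have := Ideal.sub_mem _ (Ideal.mul_mem_left _ 3 h1) (hmulJ 2 η hηJ _ hi)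
    convert this using 1
    ring
  -- If `B` is a unit, the relations express `η τ²`, then `η² τ` and `η³`, through `τ³`. So `τ³`
  -- spans degree 3 and the linear form follows.
  by_cases hBu : IsUnit B
  · refine hsub1 3 (by norm_num) (hpw 3 _ ?_)
    have hK := hMK 3
    have k0 : τ ^ 3 ∈ Q ⊔ Ideal.span {τ ^ 3} ⊔ 𝔪 * J ^ 3 :=
      Ideal.mem_sup_left (Ideal.mem_sup_right (Ideal.mem_span_singleton_self _))
    generalize Q ⊔ Ideal.span {τ ^ 3} ⊔ 𝔪 * J ^ 3 = K at hK k0 ⊢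
    have k1 : η * τ ^ 2 ∈ K := by
      refine (Ideal.unit_mul_mem_iff_mem _ (h2.mul hBu)).1 ?_
      exact (Ideal.add_mem_iff_left _ (Ideal.mul_mem_left _ _ k0)).1 (hK hii)
    have k2 : η ^ 2 * τ ∈ K := by
      refine (Ideal.unit_mul_mem_iff_mem _ (h3.mul hd)).1 ?_
      convert Ideal.sub_mem _ (hK (hmulJ 2 τ hτJ _ hi)) (Ideal.mul_mem_left _ B k0) using 1
      ring
    have k3 : η ^ 3 ∈ K := by
      refine (Ideal.unit_mul_mem_iff_mem _ (h3.mul hd)).1 ?_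
      convert Ideal.sub_mem _ (hK (hmulJ 2 η hηJ _ hi)) (Ideal.mul_mem_left _ B k1) using 1
      ring
    intro i j hij
    obtain rfl : j = 3 - i := by omega
    have : i ≤ 3 := by omega
    interval_cases i
    · simpa using k0
    · simpa using k1
    · simpa using k2
    · simpa using k3
  have hBm : B ∈ 𝔪 := (h.mem_iff _).2 hBu
  have hη2 : η ^ 2 ∈ M 2 := by
    refine (Ideal.unit_mul_mem_iff_mem _ (h3.mul hd)).1 ?_
    have := Ideal.sub_mem _ hi (hmon 0 2 2 rfl B hBm)
    convert this using 1
    ring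
  by_cases hAu : IsUnit A
  · refine (hcontra hη2 ?_).elim
    refine (Ideal.unit_mul_mem_iff_mem _ (h3.mul hAu)).1 ?_
    have := Ideal.sub_mem _ hii (hmon 1 2 3 rfl (2 * B) (𝔪.mul_mem_left _ hBm))
    convert this using 1
    ring
  have hAm : A ∈ 𝔪 := (h.mem_iff _).2 hAu
  -- The first cubic is now `d η³` modulo `𝔪 J³`, so nondegeneracy supplies a second one with some
  -- unit among `a', b', c'`. A unit `c'` makes `τ²` span degree 2 and yields the linear form.
  -- Otherwise `τ²` or `τ³` vanishes along with `η²`, contrary to `hcontra`.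
  obtain ⟨g', hg'I, hg'⟩ := SetLike.not_le_iff_exists.1 (hnd η hηJ)
  obtain ⟨a', b', c', d', rfl⟩ := hcub _ hg'I
  have hiii : b' * τ ^ 2 + 2 * c' * (η * τ) ∈ M 2 :=
    (Ideal.add_mem_iff_left _ (Ideal.mul_mem_left _ _ hη2)).1 (hder _ _ _ _ hg'I)
  have hiv : a' * τ ^ 3 + b' * (η * τ ^ 2) ∈ M 3 := by
    have h1 : η ^ 2 * τ ∈ M 3 := by
      convert hmulJ 2 τ hτJ _ hη2 using 1; ring
    have h4 : η ^ 3 ∈ M 3 := by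
      convert hmulJ 2 η hηJ _ hη2 using 1; ring
    have h5 := (Ideal.add_mem_iff_left _ (Ideal.mul_mem_left _ d' h4)).1
      (hQM 3 _ (hIQ hg'I))
    exact (Ideal.add_mem_iff_left _ (Ideal.mul_mem_left _ c' h1)).1 h5
  by_cases hc' : IsUnit c'
  · refine hsub1 2 (by norm_num) (hpw 2 _ ?_)
    have hK := hMK 2
    have k0 : τ ^ 2 ∈ Q ⊔ Ideal.span {τ ^ 2} ⊔ 𝔪 * J ^ 2 :=
      Ideal.mem_sup_left (Ideal.mem_sup_right (Ideal.mem_span_singleton_self _))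
    generalize Q ⊔ Ideal.span {τ ^ 2} ⊔ 𝔪 * J ^ 2 = K at hK k0 ⊢
    have k1 : η * τ ∈ K := by
      refine (Ideal.unit_mul_mem_iff_mem _ (h2.mul hc')).1 ?_
      exact (Ideal.add_mem_iff_right _ (Ideal.mul_mem_left _ _ k0)).1 (hK hiii)
    intro i j hij
    obtain rfl : j = 2 - i := by omega
    have : i ≤ 2 := by omega
    interval_cases i
    · simpa using k0
    · simpa using k1
    · simpa using hK hη2
  have hc'm : c' ∈ 𝔪 := (h.mem_iff _).2 hc'
  have hτ2 : b' * τ ^ 2 ∈ M 2 := by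
    have := Ideal.sub_mem _ hiii (hmon 1 1 2 rfl (2 * c') (𝔪.mul_mem_left _ hc'm))
    convert this using 1
    ring
  by_cases hb' : IsUnit b'
  · rw [Ideal.unit_mul_mem_iff_mem _ hb'] at hτ2
    refine (hcontra hη2 ?_).elim
    convert hmulJ 2 τ hτJ _ hτ2 using 1; ring
  have hb'm : b' ∈ 𝔪 := (h.mem_iff _).2 hb'
  by_cases ha' : IsUnit a'
  · refine (hcontra hη2 ?_).elim
    refine (Ideal.unit_mul_mem_iff_mem _ ha').1 ?_
    have := Ideal.sub_mem _ hiv (hmon 1 2 3 rfl b' hb'm)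
    convert this using 1
    ring
  have ha'm : a' ∈ 𝔪 := (h.mem_iff _).2 ha'
  refine (hg' ?_).elim
  have hmon' : ∀ (i j : ℕ), i + j = 3 → ∀ r ∈ 𝔪, r * (η ^ i * τ ^ j) ∈
      Ideal.span {η} ^ 3 ⊔ 𝔪 * J ^ 3 := by
    intro i j hij r hr
    refine Ideal.mem_sup_right (Ideal.mul_mem_mul hr ?_)
    rw [← hij]
    exact hpm i j
  have f0 := hmon' 0 3 (by norm_num) a' ha'm
  have f1 := hmon' 1 2 (by norm_num) b' hb'm
  have f2 := hmon' 2 1 (by norm_num) c' hc'm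
  have f3 : d' * η ^ 3 ∈ Ideal.span {η} ^ 3 ⊔ 𝔪 * J ^ 3 :=
    Ideal.mem_sup_left (Ideal.mul_mem_left _ _
      (Ideal.pow_mem_pow (Ideal.mem_span_singleton_self η) 3))
  convert Ideal.add_mem _ (Ideal.add_mem _ (Ideal.add_mem _ f0 f1) f2) f3 using 1
  ring

end Germ

/-! ### Reading the ideal off the invariant -/

theorem span_insert_eq_of_map_mk {R : Type u} [CommRing R] {𝔪 : Ideal R} {z : R} {S : Set R}
    (hz : z ∈ 𝔪) (h : Ideal.span (Ideal.Quotient.mk (Ideal.span {z}) '' S) =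
      𝔪.map (Ideal.Quotient.mk (Ideal.span {z}))) : Ideal.span (insert z S) = 𝔪 := by
  have hz' : Ideal.span {z} ≤ 𝔪 := (Ideal.span_singleton_le_iff_mem _).2 hz
  have hz2 : Ideal.span {z} ≤ Ideal.span (insert z S) := Ideal.span_mono (by simp)
  rw [← map_span_insert] at h
  ext r
  rw [← Germ.mk_mem_map_iff hz2, h, Germ.mk_mem_map_iff hz']

theorem derivation_mem_sup_mul {R : Type u} [CommRing R] {𝔪 J A : Ideal R} (hJ : J ≤ 𝔪)
    (D : Derivation ℤ R R) (p : ℕ) {f : R} (hf : f ∈ A ^ (p + 1) ⊔ 𝔪 * J ^ (p + 1)) :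
    D f ∈ A ^ p ⊔ 𝔪 * J ^ p := by
  obtain ⟨a, ha, b, hb, rfl⟩ := Submodule.mem_sup.1 hf
  rw [map_add]
  refine Submodule.add_mem_sup (derivation_mem_pow A D p ha) ?_
  induction hb using Submodule.mul_induction_on' with
  | mem_mul_mem r hr s hs =>
    rw [D.leibniz]
    refine Ideal.add_mem _ (Ideal.mul_mem_mul hr (derivation_mem_pow J D p hs)) ?_
    refine Ideal.mul_mem_right _ _ ?_
    rw [pow_succ'] at hs
    exact Ideal.mul_mono_left hJ hs
  | add x hx y hy ihx ihy =>
    rw [map_add]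
    refine Ideal.add_mem _ (ihx (Submodule.add_mem_sup ha hx)) (ihy (Submodule.add_mem_sup ha hy))

theorem sup_mul_pow_le {R : Type u} [CommRing R] (𝔪 J A : Ideal R) (p : ℕ) :
    A ^ (p + 1) ⊔ 𝔪 * J ^ (p + 1) ≤ A ^ p ⊔ 𝔪 * J ^ p :=
  sup_le_sup (Ideal.pow_le_pow_right (by omega)) (Ideal.mul_mono_right
    (Ideal.pow_le_pow_right (by omega)))

theorem mem_mul_span_pair {R : Type u} [CommRing R] {𝔪 : Ideal R} {a b r : R}
    (hr : r ∈ 𝔪 * Ideal.span {a, b}) : ∃ u ∈ 𝔪, ∃ v ∈ 𝔪, r = u * a + v * b := by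
  rw [Ideal.span_insert, Ideal.mul_sup] at hr
  obtain ⟨x, hx, y, hy, rfl⟩ := Submodule.mem_sup.1 hr
  obtain ⟨u, hu, rfl⟩ := Ideal.mem_mul_span_singleton.1 hx
  obtain ⟨v, hv, rfl⟩ := Ideal.mem_mul_span_singleton.1 hy
  exact ⟨u, hu, v, hv, rfl⟩

/-- Taylor expansion in `ζ`: the three conditions control the coefficients of `1`, `ζ` and `ζ²`
modulo `τ³`, `τ²` and `τ`. -/
theorem mem_span_pair_pow_three_of_derivation {R : Type u} [CommRing R] {ζ τ g : R}
    {D : Derivation ℤ R R} (hD : D ζ = 1) (h2 : IsUnit (2 : R))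
    (hg : g ∈ Ideal.span {ζ, τ ^ 3}) (hg1 : D g ∈ Ideal.span {ζ, τ ^ 2})
    (hg2 : D (D g) ∈ Ideal.span {ζ, τ}) : g ∈ Ideal.span {ζ, τ} ^ 3 := by
  obtain ⟨u, a, rfl⟩ := Ideal.mem_span_pair.1 hg
  have hu : u ∈ Ideal.span {ζ, τ ^ 2} := by
    have : u = D (u * ζ + a * τ ^ 3) - (D u * ζ + (D a * τ + 3 * a * D τ) * τ ^ 2) := by
      simp only [map_add, D.leibniz, D.leibniz_pow, smul_eq_mul, nsmul_eq_mul, hD]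
      push_cast
      ring
    rw [this]
    exact Ideal.sub_mem _ hg1 (Ideal.mem_span_pair.2 ⟨_, _, rfl⟩)
  obtain ⟨v, b, rfl⟩ := Ideal.mem_span_pair.1 hu
  have hζ : ζ ∈ Ideal.span {ζ, τ} := Ideal.subset_span (by simp)
  have hτ : τ ∈ Ideal.span {ζ, τ} := Ideal.subset_span (by simp)
  have hv : v ∈ Ideal.span {ζ, τ} := by
    rw [← Ideal.unit_mul_mem_iff_mem _ h2]
    have e : D ((v * ζ + b * τ ^ 2) * ζ + a * τ ^ 3) = 2 * v * ζ + (D v * (ζ ^ 2 * τ ^ 0) +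
        D b * ζ * (ζ ^ 0 * τ ^ 2) + 2 * b * D τ * (ζ ^ 1 * τ ^ 1) + b * (ζ ^ 0 * τ ^ 2)
        + D a * τ * (ζ ^ 0 * τ ^ 2) + 3 * a * D τ * (ζ ^ 0 * τ ^ 2)) := by
      simp only [map_add, D.leibniz, D.leibniz_pow, smul_eq_mul, nsmul_eq_mul, hD]
      push_cast
      ring
    rw [e, map_add, D.leibniz] at hg2
    have h1 := (Ideal.add_mem_iff_left _ ?_).1 hg2
    · rw [hD, smul_eq_mul, smul_eq_mul, mul_one] at h1
      exact (Ideal.add_mem_iff_left _ (Ideal.mul_mem_right _ _ hζ)).1 h1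
    · rw [← pow_one (Ideal.span {ζ, τ})]
      refine derivation_mem_pow _ D 1 ?_
      have k0 : ζ ^ 2 * τ ^ 0 ∈ Ideal.span {ζ, τ} ^ 2 := pow_mul_pow_mem_span_pair_pow ζ τ 2 0
      have k1 : ζ ^ 1 * τ ^ 1 ∈ Ideal.span {ζ, τ} ^ 2 := pow_mul_pow_mem_span_pair_pow ζ τ 1 1
      have k2 : ζ ^ 0 * τ ^ 2 ∈ Ideal.span {ζ, τ} ^ 2 := pow_mul_pow_mem_span_pair_pow ζ τ 0 2
      exact Ideal.add_mem _ (Ideal.add_mem _ (Ideal.add_mem _ (Ideal.add_mem _ (Ideal.add_mem _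
        (Ideal.mul_mem_left _ _ k0) (Ideal.mul_mem_left _ _ k2)) (Ideal.mul_mem_left _ _ k1))
        (Ideal.mul_mem_left _ _ k2)) (Ideal.mul_mem_left _ _ k2)) (Ideal.mul_mem_left _ _ k2)
  have k0 : ζ ^ 2 * τ ^ 0 ∈ Ideal.span {ζ, τ} ^ 2 := pow_mul_pow_mem_span_pair_pow ζ τ 2 0
  have k1 : ζ ^ 1 * τ ^ 2 ∈ Ideal.span {ζ, τ} ^ 3 := pow_mul_pow_mem_span_pair_pow ζ τ 1 2
  have k2 : ζ ^ 0 * τ ^ 3 ∈ Ideal.span {ζ, τ} ^ 3 := pow_mul_pow_mem_span_pair_pow ζ τ 0 3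
  have k3 : v * (ζ ^ 2 * τ ^ 0) ∈ Ideal.span {ζ, τ} ^ 3 := by
    rw [pow_succ']
    exact Ideal.mul_mem_mul hv k0
  convert Ideal.add_mem _ (Ideal.add_mem _ k3 (Ideal.mul_mem_left _ b k1))
    (Ideal.mul_mem_left _ a k2) using 1
  ring

namespace Germ
variable {k R : Type u} [Field k] [CharZero k] [CommRing R] {φ : k →+* R} {𝔪 : Ideal R} {n : ℕ}

theorem exists_dual_insert_insert {m : ℕ} (h : Germ φ 𝔪 (m + 2)) {ζ t : R} {o : Fin m → R}
    (ho : Ideal.span (insert ζ (insert t (Set.range o))) = 𝔪) :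
    (∃ D : Derivation ℤ R R, IsLinearOver φ D ∧ D ζ = 1 ∧ D t = 0 ∧ ∀ j, D (o j) = 0) ∧
    ∃ D : Derivation ℤ R R, IsLinearOver φ D ∧ D ζ = 0 ∧ D t = 1 ∧ ∀ j, D (o j) = 0 := by
  have ho' : Ideal.span (insert ζ (Set.range (Fin.cons t o : Fin (m + 1) → R))) = 𝔪 := by
    rw [Fin.range_cons, ho]
  obtain ⟨D, d, ⟨hD, hDζ, hDo⟩, hd, hdo⟩ := h.exists_dual_insert ho'
  refine ⟨⟨D, hD, hDζ, hDo 0, fun j => hDo j.succ⟩, ⟨d 0, (hd 0).1, (hd 0).2, hdo 0 0, fun j => ?_⟩⟩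
  simpa [Fin.succ_ne_zero, eq_comm] using hdo 0 j.succ

theorem mem_span_pow_of_pow_mem (h : Germ φ 𝔪 n) {t a : R} (ht : t ∈ 𝔪) (ht2 : t ∉ 𝔪 ^ 2)
    {M e : ℕ} (he : e ≠ 0) (ha : a ^ e ∈ Ideal.span {t ^ (M * e)}) : a ∈ Ideal.span {t ^ M} := by
  have := h.isDomain
  have hp := h.isPrime_span_of_order_one ht ht2
  have ht0 : t ≠ 0 := fun h0 => ht2 (h0 ▸ Ideal.zero_mem _)
  by_cases ha0 : a = 0
  · rw [ha0]
    exact Ideal.zero_mem _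
  obtain ⟨q, b, rfl, hb⟩ := h.exists_eq_pow_mul ht ha0
  by_cases hq : M ≤ q
  · exact Ideal.mem_span_singleton.2 (Dvd.dvd.mul_right (pow_dvd_pow t hq) b)
  · refine (hb (hp.mem_of_pow_mem e ?_)).elim
    obtain ⟨c, hc⟩ := Ideal.mem_span_singleton.1 ha
    have h1 : M * e = q * e + ((M - q) * e - 1) + 1 := by
      obtain ⟨r, rfl⟩ : ∃ r, M = q + r + 1 := ⟨M - q - 1, by omega⟩
      have h2 : q + r + 1 - q = r + 1 := by omega
      obtain ⟨e', rfl⟩ := Nat.exists_eq_succ_of_ne_zero he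
      rw [h2, Nat.succ_eq_add_one]
      have : (r + 1) * (e' + 1) - 1 = (r + 1) * e' + r := by
        rw [mul_add]; omega
      rw [this]; ring
    rw [h1, mul_pow, ← pow_mul, pow_succ, pow_add, mul_assoc, mul_assoc] at hc
    have hc' := mul_left_cancel₀ (pow_ne_zero _ ht0) hc
    rw [hc']
    exact Ideal.mul_mem_left _ _ (Ideal.mul_mem_right _ _ (Ideal.mem_span_singleton_self t))

theorem mem_span_pow_of_derivation (h : Germ φ 𝔪 n) {t : R} (ht2 : t ∉ 𝔪 ^ 2)
    {D : Derivation ℤ R R} (hD : D t = 1) (N : ℕ) {g : R}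
    (hg : ∀ j < N, D^[j] g ∈ Ideal.span {t}) : g ∈ Ideal.span {t ^ N} := by
  have := h.isDomain
  have ht0 : t ≠ 0 := fun h0 => ht2 (h0 ▸ Ideal.zero_mem _)
  induction N generalizing g with
  | zero => simp
  | succ N ih =>
    obtain rfl | hN := eq_or_ne N 0
    · simpa using hg 0 (by omega)
    obtain ⟨N, rfl⟩ := Nat.exists_eq_succ_of_ne_zero hN
    rw [Nat.succ_eq_add_one] at *
    obtain ⟨b, rfl⟩ := Ideal.mem_span_singleton.1 (ih fun j hj => hg j (by omega))
    obtain ⟨c, hc⟩ := Ideal.mem_span_singleton.1 (ih (g := D (t ^ (N + 1) * b)) fun j hj => by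
      have := hg (j + 1) (by omega)
      rwa [Function.iterate_succ_apply] at this)
    rw [D.leibniz, D.leibniz_pow, hD, smul_eq_mul, smul_eq_mul, nsmul_eq_mul, smul_eq_mul,
      Nat.add_sub_cancel] at hc
    have h1 : t ^ N * ((N + 1 : ℕ) * b) = t ^ N * (t * (c - D b)) := by
      linear_combination hc
    have h2 := mul_left_cancel₀ (pow_ne_zero _ ht0) h1
    have h3 : b ∈ Ideal.span {t} := by
      rw [← Ideal.unit_mul_mem_iff_mem _ (h.isUnit_natCast (Nat.succ_ne_zero N)), Nat.succ_eq_add_one,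
        h2]
      exact Ideal.mul_mem_right _ _ (Ideal.mem_span_singleton_self t)
    obtain ⟨b', rfl⟩ := Ideal.mem_span_singleton.1 h3
    exact Ideal.mem_span_singleton.2 ⟨b', by ring⟩

/-- As `(t)` is prime, a vanishing coefficient ideal means that the derivatives along `D` of order
less than `N` of every member of `I` vanish on `V(t)`, so `I ≤ (t) ^ N`. A member outside `𝔪 ^ (N +
1)` is then a unit times `t ^ N`. -/
theorem eq_span_pow_of_coeffIdeal_eq_bot (h : Germ φ 𝔪 n) {I : Ideal R} {t : R}
    {D : Derivation ℤ R R} {N : ℕ} (hI : ¬ I ≤ 𝔪 ^ (N + 1)) (ht : t ∈ 𝔪) (ht2 : t ∉ 𝔪 ^ 2)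
    (hD : D t = 1)
    (hb : (coeffIdeal D N I).map (Ideal.Quotient.mk (Ideal.span {t})) = ⊥) :
    I = Ideal.span {t} ^ N := by
  have hp := h.isPrime_span_of_order_one ht ht2
  rw [Ideal.map_eq_bot_iff_le_ker, Ideal.mk_ker, coeffIdeal_le_iff] at hb
  have h1 : I ≤ Ideal.span {t} ^ N := by
    intro g hg
    rw [Ideal.span_singleton_pow]
    refine h.mem_span_pow_of_derivation ht2 hD N fun j hj => ?_
    exact hp.le_of_pow_le (hb j hj) (iterate_derivation_mem hg j)
  refine le_antisymm h1 ?_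
  obtain ⟨g, hg, hg'⟩ := SetLike.not_le_iff_exists.1 hI
  have h2 := h1 hg
  rw [Ideal.span_singleton_pow] at h2 ⊢
  obtain ⟨b, rfl⟩ := Ideal.mem_span_singleton.1 h2
  rw [Ideal.span_singleton_le_iff_mem]
  have hbu : IsUnit b := by
    rw [h.isUnit_iff]
    intro hbm
    exact hg' (pow_succ 𝔪 N ▸ Ideal.mul_mem_mul (Ideal.pow_mem_pow ht N) hbm)
  exact (Ideal.mul_unit_mem_iff_mem _ hbu).1 hg

/-- Put `J = (ζ, t ^ q)`. If `I` were in `(η)³ + 𝔪 J³`, differentiating twice would put `ζ` in `(η)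
+ 𝔪 J`. Then `η` is a unit times `ζ` modulo `𝔪 J`, so `I ≤ (ζ)³ + 𝔪 J³`, and the coefficient ideal
restricted to `V(ζ)` has order above `6 q`, against `hC`. -/
theorem not_le_span_pow_sup {m : ℕ} (h : Germ φ 𝔪 (m + 2)) {I : Ideal R} {ζ t : R} {q : ℕ}
    {o : Fin m → R} (hq : q ≠ 0) {D : Derivation ℤ R R}
    (ho : Ideal.span (insert ζ (insert t (Set.range o))) = 𝔪)
    (hζ : ζ ∈ (derivClosure φ)^[2] I)
    (hC : (coeffIdeal D 3 I).map (Ideal.Quotient.mk (Ideal.span {ζ})) =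
      Ideal.span {Ideal.Quotient.mk (Ideal.span {ζ}) t} ^ (6 * q))
    {η : R} (hη : η ∈ Ideal.span {ζ, t ^ q}) :
    ¬ I ≤ Ideal.span {η} ^ 3 ⊔ 𝔪 * Ideal.span {ζ, t ^ q} ^ 3 := by
  intro hI
  have hζm : ζ ∈ 𝔪 := ho ▸ Ideal.subset_span (by simp)
  have htm : t ∈ 𝔪 := ho ▸ Ideal.subset_span (by simp)
  have hτm : t ^ q ∈ 𝔪 := 𝔪.pow_mem_of_mem htm q (Nat.pos_of_ne_zero hq)
  obtain ⟨⟨E, hE, hEζ, hEt, -⟩, ⟨E', hE', hE'ζ, hE't, -⟩⟩ := h.exists_dual_insert_insert ho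
  have hζ2 : ζ ∉ 𝔪 ^ 2 := h.notMem_sq_of_derivation (hEζ ▸ isUnit_one)
  have hJm : Ideal.span {ζ, t ^ q} ≤ 𝔪 := by
    rw [Ideal.span_le]
    rintro r (rfl | rfl)
    exacts [hζm, hτm]
  have hEτ : E (t ^ q) = 0 := by rw [E.leibniz_pow, hEt]; simp
  have hW : ∀ p, derivClosure φ (Ideal.span {η} ^ (p + 1) ⊔ 𝔪 * Ideal.span {ζ, t ^ q} ^ (p + 1)) ≤
      Ideal.span {η} ^ p ⊔ 𝔪 * Ideal.span {ζ, t ^ q} ^ p := fun p =>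
    derivClosure_le_iff.2 ⟨sup_mul_pow_le _ _ _ _, fun D _ f hf => derivation_mem_sup_mul hJm D p hf⟩
  have h1 : ζ ∈ Ideal.span {η} ^ 1 ⊔ 𝔪 * Ideal.span {ζ, t ^ q} ^ 1 :=
    iterate_derivClosure_le (W := fun p => Ideal.span {η} ^ p ⊔ 𝔪 * Ideal.span {ζ, t ^ q} ^ p)
      hW 1 2 hI hζ
  rw [pow_one, pow_one] at h1
  obtain ⟨x, hx, y, hy, e⟩ := Submodule.mem_sup.1 h1
  obtain ⟨s, rfl⟩ := Ideal.mem_span_singleton'.1 hx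
  obtain ⟨u, hu, v, hv, rfl⟩ := mem_mul_span_pair hy
  obtain ⟨α, β, rfl⟩ := Ideal.mem_span_pair.1 hη
  have e1 : (1 - s * α - u) * ζ = (s * β + v) * t ^ q := by linear_combination -e
  have hsα : IsUnit (s * α) := by
    have h2 := congrArg E e1
    rw [E.leibniz, E.leibniz, hEζ, hEτ, smul_eq_mul, smul_eq_mul, smul_eq_mul, smul_eq_mul] at h2
    rw [h.isUnit_iff]
    intro h3
    refine h.one_notMem ?_
    have h4 : (1 : R) = s * α + u + (t ^ q * E (s * β + v) - ζ * E (1 - s * α - u)) := by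
      linear_combination h2
    rw [h4]
    exact 𝔪.add_mem (𝔪.add_mem h3 hu) (𝔪.sub_mem (𝔪.mul_mem_right _ hτm) (𝔪.mul_mem_right _ hζm))
  have hs : IsUnit s := isUnit_of_mul_isUnit_left hsα
  have hp := h.isPrime_span_of_order_one hζm hζ2
  have hβ : β ∈ 𝔪 := by
    have h2 : (s * β + v) * t ^ q ∈ Ideal.span {ζ} :=
      e1 ▸ Ideal.mul_mem_left _ _ (Ideal.mem_span_singleton_self ζ)
    have h3 : s * β + v ∈ Ideal.span {ζ} := by
      refine (hp.mem_or_mem h2).resolve_right fun h4 => ?_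
      obtain ⟨r, hr⟩ := Ideal.mem_span_singleton'.1 (hp.mem_of_pow_mem q h4)
      have h5 := congrArg E' hr
      rw [E'.leibniz, hE'ζ, hE't, smul_zero, zero_add, smul_eq_mul] at h5
      exact h.one_notMem (h5 ▸ 𝔪.mul_mem_right _ hζm)
    have h6 : s * β + v ∈ 𝔪 := (Ideal.span_singleton_le_iff_mem _).2 hζm h3
    exact (Ideal.unit_mul_mem_iff_mem _ hs).1 ((Ideal.add_mem_iff_left _ hv).1 h6)
  have hζJ : ζ ∈ Ideal.span {ζ, t ^ q} := Ideal.subset_span (by simp)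
  have hτJ : t ^ q ∈ Ideal.span {ζ, t ^ q} := Ideal.subset_span (by simp)
  have hI' : I ≤ Ideal.span {ζ} ^ 3 ⊔ 𝔪 * Ideal.span {ζ, t ^ q} ^ 3 := by
    refine hI.trans (sup_le ?_ le_sup_right)
    rw [Ideal.span_singleton_pow, Ideal.span_singleton_le_iff_mem]
    have e2 : (α * ζ + β * t ^ q) ^ 3 = α ^ 3 * ζ ^ 3 + β * (t ^ q *
        (3 * α ^ 2 * (ζ ^ 2 * (t ^ q) ^ 0) + 3 * α * β * (ζ ^ 1 * (t ^ q) ^ 1) +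
          β ^ 2 * (ζ ^ 0 * (t ^ q) ^ 2))) := by ring
    rw [e2]
    refine Submodule.add_mem_sup (Ideal.mul_mem_left _ _
      (Ideal.pow_mem_pow (Ideal.mem_span_singleton_self ζ) 3)) (Ideal.mul_mem_mul hβ ?_)
    rw [pow_succ' _ 2]
    have k0 : ζ ^ 2 * (t ^ q) ^ 0 ∈ Ideal.span {ζ, t ^ q} ^ 2 :=
      pow_mul_pow_mem_span_pair_pow ζ (t ^ q) 2 0
    have k1 : ζ ^ 1 * (t ^ q) ^ 1 ∈ Ideal.span {ζ, t ^ q} ^ 2 :=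
      pow_mul_pow_mem_span_pair_pow ζ (t ^ q) 1 1
    have k2 : ζ ^ 0 * (t ^ q) ^ 2 ∈ Ideal.span {ζ, t ^ q} ^ 2 :=
      pow_mul_pow_mem_span_pair_pow ζ (t ^ q) 0 2
    exact Ideal.mul_mem_mul hτJ (Ideal.add_mem _ (Ideal.add_mem _ (Ideal.mul_mem_left _ _ k0)
      (Ideal.mul_mem_left _ _ k1)) (Ideal.mul_mem_left _ _ k2))
  have hV : ∀ p, partialClosure D (Ideal.span {ζ} ^ (p + 1) ⊔
      𝔪 * Ideal.span {ζ, t ^ q} ^ (p + 1)) ≤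
      Ideal.span {ζ} ^ p ⊔ 𝔪 * Ideal.span {ζ, t ^ q} ^ p := fun p =>
    partialClosure_le_iff.2 ⟨sup_mul_pow_le _ _ _ _, fun f hf => derivation_mem_sup_mul hJm D p hf⟩
  obtain ⟨m', hm', hR⟩ := h.quotient_of_order_one hζm hζ2
  obtain rfl : m' = m + 1 := by omega
  set π := Ideal.Quotient.mk (Ideal.span {ζ}) with hπ
  have hπζ : π ζ = 0 := Ideal.Quotient.eq_zero_iff_mem.2 (Ideal.mem_span_singleton_self ζ)
  have hVπ : ∀ p, p ≠ 0 → (Ideal.span {ζ} ^ p ⊔ 𝔪 * Ideal.span {ζ, t ^ q} ^ p).map π ≤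
      𝔪.map π ^ (1 + q * p) := by
    intro p hp0
    rw [Ideal.map_sup, Ideal.map_pow, Ideal.map_mul, Ideal.map_pow, Ideal.map_span, Ideal.map_span,
      Set.image_singleton, Set.image_pair, hπζ, Ideal.span_singleton_zero, Ideal.bot_pow hp0,
      Ideal.span_insert_zero, bot_sup_eq, pow_add, pow_one, pow_mul]
    refine Ideal.mul_mono_right (Ideal.pow_right_mono ?_ p)
    rw [Ideal.span_singleton_le_iff_mem, map_pow]
    exact Ideal.pow_mem_pow (Ideal.mem_map_of_mem _ htm) q
  have hle : (coeffIdeal D 3 I).map π ≤ 𝔪.map π ^ (6 * q + 1) := by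
    rw [Ideal.map_le_iff_le_comap, coeffIdeal_le_iff]
    intro j hj
    rw [← Ideal.map_le_iff_le_comap, Ideal.map_pow, coeffMultiplicity_three]
    have h5 := iterate_partialClosure_le
      (W := fun p => Ideal.span {ζ} ^ p ⊔ 𝔪 * Ideal.span {ζ, t ^ q} ^ p) hV (I := I) (3 - j) j
      (by
        obtain rfl | rfl | rfl : j = 0 ∨ j = 1 ∨ j = 2 := by omega
        all_goals exact hI')
    refine (Ideal.pow_right_mono ((Ideal.map_mono h5).trans (hVπ _ (by omega))) _).trans ?_
    rw [← pow_mul]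
    refine Ideal.pow_le_pow_right ?_
    interval_cases j <;> norm_num <;> omega
  have htb : π t ∉ 𝔪.map π ^ 2 := by
    have hoπ := map_span_insert_insert ζ t o
    rw [ho] at hoπ
    exact hR.notMem_sq_of_params hoπ.symm
  refine hR.pow_notMem (Ideal.mem_map_of_mem π htm) htb (6 * q) (hle ?_)
  rw [hC]
  exact Ideal.pow_mem_pow (Ideal.mem_span_singleton_self _) _

end Germ

theorem span_insert_insert_add_mul {R : Type u} [CommRing R] (x y s : R) (S : Set R) :
    Ideal.span (insert x (insert (y + s * x) S)) = Ideal.span (insert x (insert y S)) := by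
  have key : ∀ (y s : R), Ideal.span (insert x (insert (y + s * x) S)) ≤
      Ideal.span (insert x (insert y S)) := by
    intro y s
    rw [Ideal.span_le]
    have hx : x ∈ Ideal.span (insert x (insert y S)) := Ideal.subset_span (by simp)
    rintro r (rfl | rfl | hr)
    · exact hx
    · exact Ideal.add_mem _ (Ideal.subset_span (by simp)) (Ideal.mul_mem_left _ _ hx)
    · exact Ideal.subset_span (by simp [hr])
  refine le_antisymm (key y s) ?_
  convert key (y + s * x) (-s) using 3
  congr 1
  ring

namespace Germ
variable {k R : Type u} [Field k] [CharZero k] [CommRing R] {φ : k →+* R} {𝔪 : Ideal R} {n : ℕ}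

/-- On `V(ζ)` the power `6 / (3 - j)` of `D^[j] g` is divisible by `t ^ (6 q)`. As `t` generates a
prime, `D^[j] g` is divisible by `t ^ (q (3 - j))`, and Taylor expansion in `ζ` concludes. -/
theorem le_span_pow_three {I : Ideal R} (h : Germ φ 𝔪 n) {ζ t : R} {q : ℕ} {D : Derivation ℤ R R}
    {N : ℕ} {𝔫 : Ideal (R ⧸ Ideal.span {ζ})}
    (hD : D ζ = 1) (hR : Germ ((Ideal.Quotient.mk (Ideal.span {ζ})).comp φ) 𝔫 N)
    (ht : Ideal.Quotient.mk (Ideal.span {ζ}) t ∈ 𝔫)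
    (ht2 : Ideal.Quotient.mk (Ideal.span {ζ}) t ∉ 𝔫 ^ 2)
    (hC : (coeffIdeal D 3 I).map (Ideal.Quotient.mk (Ideal.span {ζ})) =
      Ideal.span {Ideal.Quotient.mk (Ideal.span {ζ}) t} ^ (6 * q)) :
    I ≤ Ideal.span {ζ, t ^ q} ^ 3 := by
  intro g hg
  have key : ∀ j < 3, D^[j] g ∈ Ideal.span {ζ, (t ^ q) ^ (3 - j)} := by
    intro j hj
    have h1 := Ideal.mem_map_of_mem (Ideal.Quotient.mk (Ideal.span {ζ})) (le_coeffIdeal D I hj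
      (Ideal.pow_mem_pow (iterate_derivation_mem hg j) _))
    rw [hC, coeffMultiplicity_three, map_pow, Ideal.span_singleton_pow] at h1
    have h2 : 6 * q = (q * (3 - j)) * (6 / (3 - j)) := by
      interval_cases j <;> norm_num <;> omega
    rw [h2] at h1
    have h3 := hR.mem_span_pow_of_pow_mem ht ht2 (by interval_cases j <;> norm_num) h1
    obtain ⟨c, hc⟩ := Ideal.mem_span_singleton'.1 h3
    obtain ⟨c, rfl⟩ := Ideal.Quotient.mk_surjective c
    rw [← map_pow, ← map_mul, eq_comm, Ideal.Quotient.eq] at hc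
    obtain ⟨b, hb⟩ := Ideal.mem_span_singleton'.1 hc
    exact Ideal.mem_span_pair.2 ⟨b, c, by rw [hb, ← pow_mul]; ring⟩
  refine mem_span_pair_pow_three_of_derivation hD (h.isUnit_ofNat 2) ?_ ?_ ?_
  · exact key 0 (by norm_num)
  · exact key 1 (by norm_num)
  · have := key 2 (by norm_num)
    norm_num at this
    exact this

/-- After a change of coordinates, some member of a family of binary cubics of order three has a
unit as coefficient of the cube of the first variable. -/
theorem exists_isUnit_cubic {m : ℕ} (h : Germ φ 𝔪 n) {I : Ideal R} {ζ t : R} {q : ℕ}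
    {o : Fin m → R} (hq : q = 1 ∨ q = 2)
    (ho : Ideal.span (insert ζ (insert t (Set.range o))) = 𝔪)
    (hI : I ≤ Ideal.span {ζ, t ^ q} ^ 3) (hI4 : ¬ I ≤ 𝔪 ^ 4) :
    ∃ t', Ideal.span (insert ζ (insert t' (Set.range o))) = 𝔪 ∧
      Ideal.span {ζ, t' ^ q} = Ideal.span {ζ, t ^ q} ∧
      ∃ a b c d, a * (t' ^ q) ^ 3 + b * (ζ * (t' ^ q) ^ 2) + c * (ζ ^ 2 * t' ^ q) + d * ζ ^ 3 ∈ I ∧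
        IsUnit d := by
  have hζm : ζ ∈ 𝔪 := ho ▸ Ideal.subset_span (by simp)
  have htm : t ∈ 𝔪 := ho ▸ Ideal.subset_span (by simp)
  obtain ⟨g, hg, hg4⟩ := SetLike.not_le_iff_exists.1 hI4
  obtain ⟨a, b, c, d, rfl⟩ := mem_span_pair_pow_three (hI hg)
  have hmon : ∀ (r : R) (i j e : ℕ), 4 ≤ i + j + e → r ∈ 𝔪 ^ e → r * (ζ ^ i * t ^ j) ∈ 𝔪 ^ 4 := by
    intro r i j e hij hr
    refine Ideal.pow_le_pow_right hij ?_
    rw [add_comm, pow_add, pow_add]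
    exact Ideal.mul_mem_mul hr (Ideal.mul_mem_mul (Ideal.pow_mem_pow hζm i) (Ideal.pow_mem_pow htm j))
  have hone : ∀ r : R, r ∈ 𝔪 ^ 0 := fun r => by simp
  have hm1 : ∀ r : R, r ∈ 𝔪 → r ∈ 𝔪 ^ 1 := fun r hr => by rwa [pow_one]
  rcases hq with rfl | rfl
  -- Replacing `t` by `t - s ζ` makes this value the coefficient of `ζ³`. A cubic polynomial with
  -- values in `𝔪` at `0, 1, -1, 2` has all its coefficients in `𝔪`, since 6 is a unit.
  · obtain ⟨s, hs⟩ : ∃ s : R, a * s ^ 3 + b * s ^ 2 + c * s + d ∉ 𝔪 := by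
      by_contra! H
      have k0 := H 0
      have k1 := H 1
      have k2 := H (-1)
      have k3 := H 2
      have hd : d ∈ 𝔪 := by simpa using k0
      have hb : b ∈ 𝔪 := by
        rw [← Ideal.unit_mul_mem_iff_mem _ (h.isUnit_ofNat 2)]
        convert 𝔪.sub_mem (𝔪.add_mem k1 k2) (𝔪.add_mem hd hd) using 1
        ring
      have ha : a ∈ 𝔪 := by
        rw [← Ideal.unit_mul_mem_iff_mem _ (h.isUnit_ofNat 6)]
        convert 𝔪.sub_mem k3 (𝔪.add_mem (𝔪.add_mem k1 k1) (𝔪.sub_mem (𝔪.add_mem hb hb) hd)) using 1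
        ring
      have hc : c ∈ 𝔪 := by
        convert 𝔪.sub_mem k1 (𝔪.add_mem (𝔪.add_mem ha hb) hd) using 1
        ring
      refine hg4 ?_
      convert Ideal.add_mem (𝔪 ^ 4) (Ideal.add_mem _ (Ideal.add_mem _
        (hmon a 0 3 1 (by norm_num) (hm1 a ha)) (hmon b 1 2 1 (by norm_num) (hm1 b hb)))
        (hmon c 2 1 1 (by norm_num) (hm1 c hc))) (hmon d 3 0 1 (by norm_num) (hm1 d hd)) using 1
      ring
    refine ⟨t + (-s) * ζ, by rw [span_insert_insert_add_mul, ho], ?_, a, 3 * a * s + b,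
      3 * a * s ^ 2 + 2 * b * s + c, a * s ^ 3 + b * s ^ 2 + c * s + d, ?_, h.isUnit_iff.2 hs⟩
    · have := span_insert_insert_add_mul ζ t (-s) ∅
      simpa using this
    · convert hg using 1
      ring
  -- For `q = 2` the other three monomials have order at least 4, so `d` is already a unit.
  · refine ⟨t, ho, rfl, a, b, c, d, hg, h.isUnit_iff.2 fun hd => hg4 ?_⟩
    convert Ideal.add_mem (𝔪 ^ 4) (Ideal.add_mem _ (Ideal.add_mem _
      (hmon a 0 6 0 (by norm_num) (hone a)) (hmon b 1 4 0 (by norm_num) (hone b)))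
      (hmon c 2 2 0 (by norm_num) (hone c))) (hmon d 3 0 1 (by norm_num) (hm1 d hd)) using 1
    ring

/-- The entry `3/2` is order 3 over multiplicity 2, and the entry `q` is order `6 q` over
multiplicity 6. The final `∞` forces the second coefficient ideal to be exactly `(t) ^ (6 q)`, from
which the shape of the cubics is recovered. -/
theorem exists_nondegenerate (h : Germ φ 𝔪 n) {I : Ideal R} {q : ℕ} (hq : q = 1 ∨ q = 2)
    (hs : HasInv φ 𝔪 I 2 [((3 / 2 : ℚ) : WithTop ℚ), 0, ((q : ℚ) : WithTop ℚ), 0, ⊤]) :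
    (I ≤ 𝔪 ^ 3 ∧ ¬ I ≤ 𝔪 ^ 4) ∧ ∃ (m : ℕ) (ζ t : R) (o : Fin m → R), n = m + 2 ∧
      Ideal.span (insert ζ (insert t (Set.range o))) = 𝔪 ∧ I ≤ Ideal.span {ζ, t ^ q} ^ 3 ∧
      (∀ η ∈ Ideal.span {ζ, t ^ q},
        ¬ I ≤ Ideal.span {η} ^ 3 ⊔ 𝔪 * Ideal.span {ζ, t ^ q} ^ 3) ∧
      ∃ a b c d, a * (t ^ q) ^ 3 + b * (ζ * (t ^ q) ^ 2) + c * (ζ ^ 2 * t ^ q) + d * ζ ^ 3 ∈ I ∧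
        IsUnit d := by
  have hq0 : q ≠ 0 := by omega
  obtain ⟨-, hs⟩ | ⟨M, ζ, D, s, hM, ⟨hI, hI'⟩, ⟨hζm, hζ2⟩, hζ, hD, hs, e⟩ := hasInv_cases hs
  · simp at hs
  simp only [List.cons.injEq, WithTop.coe_inj, true_and] at e
  obtain ⟨e, rfl⟩ := e
  obtain rfl : M = 3 := by
    have : (M : ℚ) = 3 := by
      push_cast at e
      linarith
    exact_mod_cast this
  refine ⟨⟨hI, hI'⟩, ?_⟩
  rw [coeffMultiplicity_three] at hs
  obtain ⟨m₁, o₁, rfl, ho₁, hDl, hDo, hDζ⟩ := h.isPartialDerivative_iff.1 hD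
  have hR := h.quotient ho₁
  obtain ⟨-, hs⟩ | ⟨M, t, D', s, hM', ⟨hC, hC'⟩, ⟨htm, ht2⟩, -, hD', hs, e⟩ := hasInv_cases hs
  · simp at hs
  simp only [List.cons.injEq, WithTop.coe_inj, true_and] at e
  obtain ⟨e, rfl⟩ := e
  obtain rfl : M = 6 * q := by
    have : (M : ℚ) = 6 * q := by
      push_cast at e
      linarith
    exact_mod_cast this
  obtain ⟨m₂, o₂, e₂, ho₂, -, -, hD't⟩ := hR.isPartialDerivative_iff.1 hD'
  subst e₂
  obtain ⟨hbot, -⟩ | ⟨_, _, _, _, _, _, _, _, _, _, e⟩ := hasInv_cases hs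
  swap
  · simp at e
  have hCt := hR.eq_span_pow_of_coeffIdeal_eq_bot hC' htm ht2 hD't hbot
  obtain ⟨t, rfl⟩ := Ideal.Quotient.mk_surjective t
  choose o ho using fun j => Ideal.Quotient.mk_surjective (o₂ j)
  have hspan : Ideal.span (insert ζ (insert t (Set.range o))) = 𝔪 := by
    refine span_insert_eq_of_map_mk hζm ?_
    rw [Set.image_insert_eq, ← Set.range_comp, ← ho₂]
    congr 3
    exact funext ho
  have hle := h.le_span_pow_three (q := q) hDζ hR htm ht2 hCt
  obtain ⟨t', ht', hJ, hd⟩ := h.exists_isUnit_cubic hq hspan hle hI'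
  refine ⟨m₂, ζ, t', o, rfl, ht', hJ ▸ hle, ?_, hd⟩
  rw [hJ]
  intro η hη
  exact h.not_le_span_pow_sup hq0 hspan hζ hCt hη

end Germ

/-! ### Primes of height two and binary quadrics -/

theorem mem_span_pair_of_sq_mul_mem {R : Type u} [CommRing R] [IsDomain R] {y τ b : R}
    (hp : (Ideal.span {y}).IsPrime) (hy : y ≠ 0) (hτ : τ ∉ Ideal.span {y})
    (hb : y ^ 2 * b ∈ Ideal.span {y, τ} ^ 3) : b ∈ Ideal.span {y, τ} := by
  obtain ⟨r₀, r₁, r₂, r₃, e⟩ := mem_span_pair_pow_three hb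
  have h0 : r₀ * τ ^ 3 ∈ Ideal.span {y} :=
    Ideal.mem_span_singleton'.2 ⟨y * b - r₁ * τ ^ 2 - r₂ * y * τ - r₃ * y ^ 2, by
      linear_combination e⟩
  obtain ⟨a, rfl⟩ := Ideal.mem_span_singleton.1
    ((hp.mem_or_mem h0).resolve_right fun h => hτ (hp.mem_of_pow_mem 3 h))
  have e1 : y * b = (a * τ + r₁) * τ ^ 2 + r₂ * y * τ + r₃ * y ^ 2 :=
    mul_left_cancel₀ hy (by linear_combination e)
  have h1 : (a * τ + r₁) * τ ^ 2 ∈ Ideal.span {y} :=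
    Ideal.mem_span_singleton'.2 ⟨b - r₂ * τ - r₃ * y, by linear_combination e1⟩
  obtain ⟨c, hc⟩ := Ideal.mem_span_singleton.1
    ((hp.mem_or_mem h1).resolve_right fun h => hτ (hp.mem_of_pow_mem 2 h))
  have e2 : b = c * τ ^ 2 + r₂ * τ + r₃ * y :=
    mul_left_cancel₀ hy (by rw [hc] at e1; linear_combination e1)
  exact Ideal.mem_span_pair.2 ⟨r₃, c * τ + r₂, by rw [e2]; ring⟩

/-- The hypotheses `hs` and `hsf` say that `f` lies in the square of the maximal ideal of the
localization at `P`, that is, that `V(f)` is singular along `V(P)`. -/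
theorem derivation_mem_of_mul_mem_sq {R : Type u} [CommRing R] {P : Ideal R} (hP : P.IsPrime)
    {s f : R} (hs : s ∉ P) (hsf : s * f ∈ P ^ 2) (D : Derivation ℤ R R) : D f ∈ P := by
  have hf : f ∈ P := (hP.mem_or_mem (Ideal.pow_le_self two_ne_zero hsf)).resolve_left hs
  have h1 : D (s * f) ∈ P := by
    simpa using derivation_mem_pow P D 1 hsf
  rw [D.leibniz, smul_eq_mul, smul_eq_mul] at h1
  exact (hP.mem_or_mem ((Ideal.add_mem_iff_left _ (P.mul_mem_right _ hf)).1 h1)).resolve_left hs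

namespace Germ
variable {k R : Type u} [Field k] [CharZero k] [CommRing R] {φ : k →+* R} {𝔪 : Ideal R} {n : ℕ}

theorem isPrime_span_pair {m : ℕ} (h : Germ φ 𝔪 (m + 2)) {z y : R} {o : Fin m → R}
    (ho : Ideal.span (insert z (insert y (Set.range o))) = 𝔪) : (Ideal.span {z, y}).IsPrime := by
  have hR := h.quotient (o := Fin.cons y o) (by rwa [Fin.range_cons])
  have hoπ := map_span_insert_insert z y o
  rw [ho] at hoπ
  have h1 := hR.isPrime_span hoπ.symm
  have h2 : Ideal.span {z} ≤ Ideal.span {z, y} := Ideal.span_mono (by simp)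
  have h3 : (Ideal.span {z, y}) = (Ideal.span {Ideal.Quotient.mk (Ideal.span {z}) y}).comap
      (Ideal.Quotient.mk (Ideal.span {z})) := by
    have := map_span_insert z {y}
    rw [Set.image_singleton] at this
    rw [← this]
    ext r
    rw [Ideal.mem_comap, Germ.mk_mem_map_iff h2]
  rw [h3]
  exact h1.comap _

theorem notMem_span_of_derivation (h : Germ φ 𝔪 n) {S : Set R} {t : R} (hS : S ⊆ 𝔪)
    {D : Derivation ℤ R R} (hDS : ∀ s ∈ S, D s = 0) (hDt : D t = 1) : t ∉ Ideal.span S := by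
  intro ht
  have := derivation_mem_sup_span (D := D) 𝔪 (Ideal.span_le.2 hS) rfl
    (fun s hs => by rw [hDS s hs]; exact 𝔪.zero_mem) ht
  rw [hDt] at this
  exact h.one_notMem this

/-- Otherwise `0 < (z) < (z, y) < P` is a chain of primes, which makes the height at least 3. -/
theorem eq_span_pair_of_height_le {m : ℕ} (h : Germ φ 𝔪 (m + 2)) {z y : R} {o : Fin m → R}
    (ho : Ideal.span (insert z (insert y (Set.range o))) = 𝔪) {P : Ideal R} (hP : P.IsPrime)
    (hP2 : P.height ≤ 2) (hz : z ∈ P) (hy : y ∈ P) : P = Ideal.span {z, y} := by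
  by_contra hne
  have := h.isDomain
  have hzm : z ∈ 𝔪 := ho ▸ Ideal.subset_span (by simp)
  obtain ⟨⟨E, hE, hEz, hEy, -⟩, ⟨E', hE', hE'z, hE'y, -⟩⟩ := h.exists_dual_insert_insert ho
  have p0 : (⊥ : Ideal R).IsPrime := Ideal.isPrime_bot
  have p1 : (Ideal.span {z}).IsPrime := h.isPrime_span (o := Fin.cons y o) (by rwa [Fin.range_cons])
  have p2 := h.isPrime_span_pair ho
  have l1 : (⊥ : Ideal R) < Ideal.span {z} := by
    rw [bot_lt_iff_ne_bot, Ne, Ideal.span_singleton_eq_bot]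
    rintro rfl
    have := h.nontrivial
    simp at hEz
  have l2 : Ideal.span {z} < Ideal.span {z, y} := by
    refine lt_of_le_of_ne (Ideal.span_mono (by simp)) fun h1 => ?_
    refine h.notMem_span_of_derivation (S := {z}) (by simpa using hzm) (by simpa using hE'z) hE'y ?_
    rw [h1]
    exact Ideal.subset_span (by simp)
  have l3 : Ideal.span {z, y} < P := by
    refine lt_of_le_of_ne ?_ (Ne.symm hne)
    rw [Ideal.span_le]
    rintro r (rfl | rfl)
    exacts [hz, hy]
  have a1 := Ideal.height_add_one_le_of_lt_of_isPrime l1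
  have a2 := Ideal.height_add_one_le_of_lt_of_isPrime l2
  have a3 := Ideal.height_add_one_le_of_lt_of_isPrime l3
  have : (3 : ℕ∞) ≤ 2 := by
    calc (3 : ℕ∞) = 0 + 1 + 1 + 1 := by norm_num
      _ ≤ (⊥ : Ideal R).height + 1 + 1 + 1 := by gcongr; exact zero_le
      _ ≤ (Ideal.span {z}).height + 1 + 1 := by gcongr
      _ ≤ (Ideal.span {z, y}).height + 1 := by gcongr
      _ ≤ _ := a3.trans hP2
  norm_num at this

/-- The symbolic square of `(z, y)` is its ordinary square: the derivatives of `f = a z + b y` along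
`z` and `y` lie in the prime, and so do `a` and `b`. -/
theorem exists_eq_binary_quadric {m : ℕ} (h : Germ φ 𝔪 (m + 2)) {z y s f : R} {o : Fin m → R}
    (ho : Ideal.span (insert z (insert y (Set.range o))) = 𝔪)
    (hs : s ∉ Ideal.span {z, y}) (hsf : s * f ∈ Ideal.span {z, y} ^ 2) :
    ∃ d c b, f = d * z ^ 2 + c * (y * z) + b * y ^ 2 := by
  have hP := h.isPrime_span_pair ho
  obtain ⟨⟨E, hE, hEz, hEy, -⟩, ⟨E', hE', hE'z, hE'y, -⟩⟩ := h.exists_dual_insert_insert ho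
  have hf : f ∈ Ideal.span {z, y} :=
    (hP.mem_or_mem (Ideal.pow_le_self two_ne_zero hsf)).resolve_left hs
  have e1 := derivation_mem_of_mul_mem_sq hP hs hsf E
  have e2 := derivation_mem_of_mul_mem_sq hP hs hsf E'
  obtain ⟨a, b, rfl⟩ := Ideal.mem_span_pair.1 hf
  have hz : z ∈ Ideal.span {z, y} := Ideal.subset_span (by simp)
  have hy : y ∈ Ideal.span {z, y} := Ideal.subset_span (by simp)
  have ha : a ∈ Ideal.span {z, y} := by
    convert Ideal.sub_mem _ e1 (Ideal.add_mem _ (Ideal.mul_mem_left _ (E a) hz)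
      (Ideal.mul_mem_left _ (E b) hy)) using 1
    simp only [map_add, Derivation.leibniz, hEz, hEy, smul_eq_mul]
    ring
  have hb : b ∈ Ideal.span {z, y} := by
    convert Ideal.sub_mem _ e2 (Ideal.add_mem _ (Ideal.mul_mem_left _ (E' a) hz)
      (Ideal.mul_mem_left _ (E' b) hy)) using 1
    simp only [map_add, Derivation.leibniz, hE'z, hE'y, smul_eq_mul]
    ring
  obtain ⟨a₁, a₂, rfl⟩ := Ideal.mem_span_pair.1 ha
  obtain ⟨b₁, b₂, rfl⟩ := Ideal.mem_span_pair.1 hb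
  exact ⟨a₁, a₂ + b₁, b₂, by ring⟩

end Germ

/-! ### Normal form from the invariant and the singular locus -/

namespace Germ
variable {k R : Type u} [Field k] [CharZero k] [CommRing R] {φ : k →+* R} {𝔪 : Ideal R} {n : ℕ}

theorem mem_of_sq_mem_pow_three (h : Germ φ 𝔪 n) {a : R} (ha : a ^ 2 ∈ 𝔪 ^ 3) : a ∈ 𝔪 ^ 2 := by
  have h1 : a ∈ 𝔪 := h.isPrime.mem_of_pow_mem 2 (Ideal.pow_le_self three_ne_zero ha)
  by_contra h2
  exact h.pow_notMem h1 h2 2 ha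

theorem mem_of_mul_mem_pow_succ (h : Germ φ 𝔪 n) {y b : R} (hy : y ∈ 𝔪) (hy2 : y ∉ 𝔪 ^ 2) {N : ℕ}
    (hb : b * y ^ N ∈ 𝔪 ^ (N + 1)) : b ∈ 𝔪 := by
  by_contra hbm
  exact h.pow_notMem hy hy2 N ((Ideal.unit_mul_mem_iff_mem _ (h.isUnit_iff.2 hbm)).1 hb)

/-- With `z' = z + e y` and `B = b - d e²` the quadric is `d z'² + B y²`, so its derivatives lie in
`(z', y B, y²)`. Since `z` lies there too, `e y` does; cancelling `y` modulo the prime `(z')` gives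
`e ∈ (z', B, y)`, hence `e ∈ (z, y, b)` because `e ∈ 𝔪`. -/
theorem exists_complete_square (h : Germ φ 𝔪 n) {z y d c b : R} (hy : y ∈ 𝔪)
    (hc : c ∈ 𝔪) (hd : IsUnit d) (hprime : ∀ e ∈ 𝔪, (Ideal.span {z + e * y}).IsPrime ∧
      y ∉ Ideal.span {z + e * y})
    (hz : z ∈ derivClosure φ (Ideal.span {d * z ^ 2 + c * (y * z) + b * y ^ 2})) :
    ∃ e ∈ 𝔪, c = 2 * d * e ∧ e ∈ Ideal.span {z, y, b} := by
  obtain ⟨u, hu⟩ := (h.isUnit_ofNat 2).mul hd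
  obtain ⟨e, he⟩ : ∃ e, e = ↑u⁻¹ * c := ⟨_, rfl⟩
  have hce : c = 2 * d * e := by rw [he, ← hu, Units.mul_inv_cancel_left]
  have hem : e ∈ 𝔪 := he ▸ 𝔪.mul_mem_left _ hc
  refine ⟨e, hem, hce, ?_⟩
  obtain ⟨hp, hyp⟩ := hprime e hem
  obtain ⟨z', hz'⟩ : ∃ z', z' = z + e * y := ⟨_, rfl⟩
  obtain ⟨B, hB⟩ : ∃ B, B = b - d * e ^ 2 := ⟨_, rfl⟩
  rw [← hz'] at hp hyp
  have hf : d * z ^ 2 + c * (y * z) + b * y ^ 2 = d * z' ^ 2 + B * y ^ 2 := by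
    rw [hz', hB, hce]; ring
  have hK : derivClosure φ (Ideal.span {d * z ^ 2 + c * (y * z) + b * y ^ 2}) ≤
      Ideal.span {z', y * B, y * y} := by
    have hmem : ∀ r s t : R, r * z' + s * (y * B) + t * (y * y) ∈ Ideal.span {z', y * B, y * y} :=
      fun r s t => Ideal.add_mem _ (Ideal.add_mem _ (Ideal.mul_mem_left _ _
        (Ideal.subset_span (by simp))) (Ideal.mul_mem_left _ _ (Ideal.subset_span (by simp))))
        (Ideal.mul_mem_left _ _ (Ideal.subset_span (by simp)))
    have h1 : Ideal.span {d * z' ^ 2 + B * y ^ 2} ≤ Ideal.span {z', y * B, y * y} := by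
      rw [Ideal.span_singleton_le_iff_mem]
      convert hmem (d * z') y 0 using 1
      ring
    rw [hf, derivClosure_le_iff]
    refine ⟨h1, fun D _ g hg => ?_⟩
    refine derivation_mem_sup_span _ h1 rfl ?_ hg
    rintro r rfl
    convert hmem (D d * z' + 2 * d * D z') (2 * D y) (D B) using 1
    simp only [map_add, Derivation.leibniz, Derivation.leibniz_pow, smul_eq_mul, nsmul_eq_mul]
    push_cast
    ring
  have h1 := hK hz
  simp only [Ideal.mem_span_insert, Ideal.mem_span_singleton'] at h1
  obtain ⟨r, _, ⟨s, _, ⟨t, rfl⟩, rfl⟩, h1⟩ := h1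
  have h2 : (e + s * B + t * y) * y ∈ Ideal.span {z'} :=
    Ideal.mem_span_singleton'.2 ⟨1 - r, by linear_combination (1 : R) * hz' + h1⟩
  obtain ⟨r', hr'⟩ := Ideal.mem_span_singleton'.1 ((hp.mem_or_mem h2).resolve_right hyp)
  have hU : IsUnit (1 + (- (r' * y) - s * d * e)) := by
    refine h.isUnit_add isUnit_one ?_
    exact 𝔪.sub_mem (𝔪.neg_mem (𝔪.mul_mem_left _ hy)) (𝔪.mul_mem_left _ hem)
  rw [← Ideal.unit_mul_mem_iff_mem _ hU]
  have e3 : (1 + (- (r' * y) - s * d * e)) * e = r' * z + (-t) * y + (-s) * b := by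
    rw [hz', hB] at hr'
    linear_combination -hr'
  rw [e3]
  exact Ideal.add_mem _ (Ideal.add_mem _ (Ideal.mul_mem_left _ _
        (Ideal.subset_span (by simp))) (Ideal.mul_mem_left _ _ (Ideal.subset_span (by simp))))
        (Ideal.mul_mem_left _ _ (Ideal.subset_span (by simp)))

/-- On `V(z)` the quadric is `b y²` and its derivative lies in `(y², y b)`. Of the products of two
generators, `y³ b` and `y² b²` are multiples of `y² b`, which leaves only `y⁴`. -/
theorem coeffIdeal_two_map_le {R S : Type u} [CommRing R] [CommRing S] {π : R →+* S}
    {D : Derivation ℤ R R} {z y d c b : R} (hz : π z = 0)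
    (hc : π c ∈ Ideal.span {π y, π b}) :
    (coeffIdeal D 2 (Ideal.span {d * z ^ 2 + c * (y * z) + b * y ^ 2})).map π ≤
      Ideal.span {π y ^ 2 * π b} ⊔ Ideal.span {π y} ^ 4 := by
  obtain ⟨u, v, huv⟩ := Ideal.mem_span_pair.1 hc
  have hmem : ∀ r s : S, r * (π y ^ 2) + s * (π y * π b) ∈
      Ideal.span {π y ^ 2, π y * π b} := fun r s =>
    Ideal.mem_span_pair.2 ⟨r, s, rfl⟩
  have h1 : partialClosure D (Ideal.span {d * z ^ 2 + c * (y * z) + b * y ^ 2}) ≤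
      (Ideal.span {π y ^ 2, π y * π b}).comap π := by
    have h2 : Ideal.span {d * z ^ 2 + c * (y * z) + b * y ^ 2} ≤
        (Ideal.span {π y ^ 2, π y * π b}).comap π := by
      rw [Ideal.span_singleton_le_iff_mem, Ideal.mem_comap]
      convert hmem (π b) 0 using 1
      simp [hz]
    refine partialClosure_le_iff.2 ⟨h2, fun g hg => derivation_mem_sup_span _ h2 rfl ?_ hg⟩
    rintro r rfl
    rw [Ideal.mem_comap]
    convert hmem (π (D b) + u * π (D z)) (2 * π (D y) + v * π (D z)) using 1
    simp only [map_add, Derivation.leibniz, Derivation.leibniz_pow, smul_eq_mul, nsmul_eq_mul,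
      map_mul, map_pow, hz, ← huv, map_natCast]
    push_cast
    ring
  rw [Ideal.map_le_iff_le_comap, coeffIdeal_le_iff]
  have hA : π y ^ 2 * π b ∈ Ideal.span {π y ^ 2 * π b} ⊔ Ideal.span {π y} ^ 4 :=
    Ideal.mem_sup_left (Ideal.mem_span_singleton_self _)
  intro j hj
  rw [coeffMultiplicity_two, ← Ideal.map_le_iff_le_comap, Ideal.map_pow]
  obtain rfl | rfl : j = 0 ∨ j = 1 := by omega
  · norm_num
    rw [Ideal.map_span, Set.image_singleton, Ideal.span_singleton_le_iff_mem]
    convert hA using 1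
    simp [hz, mul_comm]
  · norm_num
    refine (Ideal.pow_right_mono (Ideal.map_le_iff_le_comap.2 h1) 2).trans ?_
    refine span_pair_pow_le 2 fun i j hij => ?_
    have hB : (π y) ^ 4 ∈ Ideal.span {π y ^ 2 * π b} ⊔ Ideal.span {π y} ^ 4 :=
      Ideal.mem_sup_right (Ideal.pow_mem_pow (Ideal.mem_span_singleton_self _) 4)
    obtain rfl : j = 2 - i := by omega
    have : i ≤ 2 := by omega
    interval_cases i
    · convert Ideal.mul_mem_left _ (π b) hA using 1
      norm_num
      ring
    · convert Ideal.mul_mem_left _ (π y) hA using 1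
      norm_num
      ring
    · convert hB using 1
      norm_num
      ring

theorem exists_normal_form_of_binary_quadric {m : ℕ} (h : Germ φ 𝔪 (m + 3)) {z y t d c b : R} {q : ℕ}
    {o : Fin m → R} (hq : q = 1 ∨ q = 2) {D : Derivation ℤ R R} (hD : D z = 1)
    (ho : Ideal.span (insert z (insert y (insert t (Set.range o)))) = 𝔪)
    (hz : z ∈ derivClosure φ (Ideal.span {d * z ^ 2 + c * (y * z) + b * y ^ 2}))
    (hf3 : d * z ^ 2 + c * (y * z) + b * y ^ 2 ∉ 𝔪 ^ 3) {C : Ideal (R ⧸ Ideal.span {z})}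
    (hC : C = (coeffIdeal D 2 (Ideal.span {d * z ^ 2 + c * (y * z) + b * y ^ 2})).map
      (Ideal.Quotient.mk (Ideal.span {z})))
    (hC3 : C ≤ 𝔪.map (Ideal.Quotient.mk (Ideal.span {z})) ^ 3)
    (hC4 : ¬ C ≤ 𝔪.map (Ideal.Quotient.mk (Ideal.span {z})) ^ 4)
    (hCJ : C ≤ Ideal.span {Ideal.Quotient.mk (Ideal.span {z}) y,
      Ideal.Quotient.mk (Ideal.span {z}) (t ^ q)} ^ 3)
    (hnd : ¬ C ≤ Ideal.span {Ideal.Quotient.mk (Ideal.span {z}) y} ^ 3 ⊔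
      𝔪.map (Ideal.Quotient.mk (Ideal.span {z})) *
      Ideal.span {Ideal.Quotient.mk (Ideal.span {z}) y,
        Ideal.Quotient.mk (Ideal.span {z}) (t ^ q)} ^ 3) :
    ∃ (z' d' l α γ : R), Ideal.span (insert z' (insert y (insert t (Set.range o)))) = 𝔪 ∧
      IsUnit d' ∧ IsUnit l ∧ (q = 2 → IsUnit α) ∧
      d * z ^ 2 + c * (y * z) + b * y ^ 2 =
        d' * (z' ^ 2 + (α * y + l * t ^ q + γ * z') * y ^ 2) := by
  have hq0 : q ≠ 0 := by omega
  have hzm : z ∈ 𝔪 := ho ▸ Ideal.subset_span (by simp)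
  have hym : y ∈ 𝔪 := ho ▸ Ideal.subset_span (by simp)
  have htm : t ∈ 𝔪 := ho ▸ Ideal.subset_span (by simp)
  have hz𝔪 : Ideal.span {z} ≤ 𝔪 := (Ideal.span_singleton_le_iff_mem _).2 hzm
  have hR := h.quotient (o := Fin.cons y (Fin.cons t o)) (by rwa [Fin.range_cons, Fin.range_cons])
  have hoπ := map_span_insert_insert_insert z y t o
  rw [ho] at hoπ
  obtain ⟨⟨E, hE, hEy, hEt, hEo⟩, -⟩ := hR.exists_dual_insert_insert hoπ.symm
  have hy2 := hR.notMem_sq_of_derivation (hEy ▸ isUnit_one)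
  have hπym := Ideal.mem_map_of_mem (Ideal.Quotient.mk (Ideal.span {z})) hym
  have hπtm := Ideal.mem_map_of_mem (Ideal.Quotient.mk (Ideal.span {z})) htm
  have hmk : ∀ r, Ideal.Quotient.mk (Ideal.span {z}) r ∈
      𝔪.map (Ideal.Quotient.mk (Ideal.span {z})) ↔ r ∈ 𝔪 := fun r => Germ.mk_mem_map_iff hz𝔪
  have hunit : ∀ r, IsUnit (Ideal.Quotient.mk (Ideal.span {z}) r) ↔ IsUnit r :=
    fun r => h.isUnit_mk_iff hzm
  have hπz : Ideal.Quotient.mk (Ideal.span {z}) z = 0 :=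
    Ideal.Quotient.eq_zero_iff_mem.2 (Ideal.mem_span_singleton_self z)
  have hsurj := Ideal.Quotient.mk_surjective (I := Ideal.span {z})
  have hker : ∀ r, Ideal.Quotient.mk (Ideal.span {z}) r = 0 → r ∈ Ideal.span {z} :=
    fun r => Ideal.Quotient.eq_zero_iff_mem.1
  have hdomR := hR.isDomain
  have hpy := hR.isPrime_span_of_order_one hπym hy2
  have hτy : Ideal.Quotient.mk (Ideal.span {z}) (t ^ q) ∉
      Ideal.span {Ideal.Quotient.mk (Ideal.span {z}) y} := by
    intro h1
    rw [map_pow] at h1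
    obtain ⟨-, E', hE', hE'y, hE't, -⟩ := hR.exists_dual_insert_insert hoπ.symm
    exact hR.notMem_span_of_derivation (S := {Ideal.Quotient.mk (Ideal.span {z}) y})
      (by simpa using hπym) (by simpa using hE'y) hE't (hpy.mem_of_pow_mem q h1)
  generalize Ideal.Quotient.mk (Ideal.span {z}) = π at *
  have hI : (partialClosure D)^[0] (Ideal.span {d * z ^ 2 + c * (y * z) + b * y ^ 2}) ^ 1 ≤ _ :=
    le_coeffIdeal D (Ideal.span {d * z ^ 2 + c * (y * z) + b * y ^ 2}) (m := 2) (j := 0) (by norm_num)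
  rw [pow_one, Function.iterate_zero, id] at hI
  have hI' : (partialClosure D)^[1] (Ideal.span {d * z ^ 2 + c * (y * z) + b * y ^ 2}) ^ 2 ≤ _ :=
    le_coeffIdeal D (Ideal.span {d * z ^ 2 + c * (y * z) + b * y ^ 2}) (m := 2) (j := 1) (by norm_num)
  have hfC : π b * π y ^ 2 ∈ C := by
    rw [hC]
    convert Ideal.mem_map_of_mem π (hI (Ideal.mem_span_singleton_self _)) using 1
    simp [hπz]
  have hbm : b ∈ 𝔪 := (hmk b).1 (hR.mem_of_mul_mem_pow_succ hπym hy2 (hC3 hfC))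
  -- The square of the derivative along `D` lies in `C`, so that derivative has order at least 2 on
  -- `V(z)`, where it equals `c y` modulo order 2.
  have hcm : c ∈ 𝔪 := by
    have h1 := hC3 (hC ▸ Ideal.mem_map_of_mem π
      (hI' (Ideal.pow_mem_pow (iterate_derivation_mem (Ideal.mem_span_singleton_self _) 1) 2)))
    rw [map_pow, Function.iterate_one] at h1
    have h2 := hR.mem_of_sq_mem_pow_three h1
    refine (hmk c).1 (hR.mem_of_mul_mem_pow_succ (N := 1) hπym hy2 ?_)
    have e1 : π (D (d * z ^ 2 + c * (y * z) + b * y ^ 2)) =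
        π c * π y ^ 1 + (π (D b) * π y ^ 2 + 2 * π (D y) * (π b * π y)) := by
      simp only [map_add, Derivation.leibniz, Derivation.leibniz_pow, smul_eq_mul, nsmul_eq_mul,
        map_mul, map_pow, hπz, hD, map_natCast, map_one]
      push_cast
      ring
    rw [e1] at h2
    refine (Ideal.add_mem_iff_left _ ?_).1 h2
    refine Ideal.add_mem _ (Ideal.mul_mem_left _ _ (Ideal.pow_mem_pow hπym 2))
      (Ideal.mul_mem_left _ _ ?_)
    rw [pow_two]
    exact Ideal.mul_mem_mul ((hmk b).2 hbm) hπym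
  have hd : IsUnit d := by
    rw [h.isUnit_iff]
    intro hdm
    have hmon : ∀ r₁ ∈ 𝔪, ∀ r₂ ∈ 𝔪, ∀ r₃ ∈ 𝔪, r₁ * (r₂ * r₃) ∈ 𝔪 ^ 3 := fun r₁ h₁ r₂ h₂ r₃ h₃ => by
      rw [pow_succ', pow_two]
      exact Ideal.mul_mem_mul h₁ (Ideal.mul_mem_mul h₂ h₃)
    refine hf3 ?_
    rw [pow_two, pow_two]
    exact Ideal.add_mem _ (Ideal.add_mem _ (hmon _ hdm _ hzm _ hzm) (hmon _ hcm _ hym _ hzm))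
      (hmon _ hbm _ hym _ hym)
  have hcoord : ∀ e, Ideal.span (insert (z + e * y) (insert y (insert t (Set.range o)))) = 𝔪 := by
    intro e
    rw [Set.insert_comm, span_insert_insert_add_mul, Set.insert_comm, ho]
  obtain ⟨e, hem, rfl, he⟩ := h.exists_complete_square hym hcm hd (fun e _ => by
    have ho' : Ideal.span (insert (z + e * y) (insert y
        (Set.range (Fin.cons t o : Fin (m + 1) → R)))) = 𝔪 := by
      rw [Fin.range_cons, hcoord]
    refine ⟨h.isPrime_span (o := Fin.cons y (Fin.cons t o))
      (by rw [Fin.range_cons, Fin.range_cons, hcoord]), ?_⟩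
    obtain ⟨-, E', hE', hE'z, hE'y, -⟩ := h.exists_dual_insert_insert ho'
    exact h.notMem_span_of_derivation (S := {z + e * y})
      (by simpa using 𝔪.add_mem hzm (𝔪.mul_mem_left _ hym)) (by simpa using hE'z) hE'y) hz
  simp only [Ideal.mem_span_insert, Ideal.mem_span_singleton'] at he
  obtain ⟨e₁, _, ⟨e₂, _, ⟨e₃, rfl⟩, rfl⟩, he⟩ := he
  have hle : C ≤ Ideal.span {π y ^ 2 * π b} ⊔ Ideal.span {π y} ^ 4 := by
    rw [hC]
    refine coeffIdeal_two_map_le hπz (Ideal.mem_span_pair.2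
      ⟨2 * π d * π e₂, 2 * π d * π e₃, ?_⟩)
    rw [he]
    simp only [map_add, map_mul, hπz, map_ofNat]
    ring
  have hy0 : π y ≠ 0 := fun h0 => hy2 (h0 ▸ Ideal.zero_mem _)
  obtain ⟨A, L, hAL⟩ := Ideal.mem_span_pair.1 (mem_span_pair_of_sq_mul_mem hpy hy0 hτy
    (hCJ (mul_comm (π b) _ ▸ hfC)))
  obtain ⟨A, rfl⟩ := hsurj A
  obtain ⟨L, rfl⟩ := hsurj L
  -- If `L` were in `𝔪`, then `y² b`, and with it `C`, would lie in `(y)³ + 𝔪 (y, t ^ q)³`, against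
  -- nondegeneracy.
  have hL : IsUnit L := by
    rw [h.isUnit_iff]
    intro hLm
    refine hnd (hle.trans (sup_le ?_ ?_))
    · rw [Ideal.span_singleton_le_iff_mem, ← hAL]
      have k1 : π y ^ 2 * π (t ^ q) ^ 1 ∈ Ideal.span {π y, π (t ^ q)} ^ 3 :=
        pow_mul_pow_mem_span_pair_pow (π y) (π (t ^ q)) 2 1
      convert Submodule.add_mem_sup (Ideal.mul_mem_left (Ideal.span {π y} ^ 3) (π A)
        (Ideal.pow_mem_pow (Ideal.mem_span_singleton_self (π y)) 3))
        (Ideal.mul_mem_mul ((hmk L).2 hLm) k1) using 1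
      ring
    · exact (Ideal.pow_le_pow_right (by norm_num)).trans le_sup_left
  -- For `q = 2` the term `L t² y²` has order at least 4, so only `A y³` can give `C` order 3.
  have hA : q = 2 → IsUnit A := by
    rintro rfl
    rw [h.isUnit_iff]
    intro hAm
    refine hC4 (hle.trans (sup_le ?_ (Ideal.pow_right_mono
      ((Ideal.span_singleton_le_iff_mem _).2 hπym) 4)))
    rw [Ideal.span_singleton_le_iff_mem, ← hAL]
    have k1 : π y ^ 2 * π t ^ 2 ∈ 𝔪.map π ^ 4 := by
      rw [show 4 = 2 + 2 from rfl, pow_add]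
      exact Ideal.mul_mem_mul (Ideal.pow_mem_pow hπym 2) (Ideal.pow_mem_pow hπtm 2)
    have k2 : π A * π y ^ 3 ∈ 𝔪.map π ^ 4 := by
      rw [pow_succ' _ 3]
      exact Ideal.mul_mem_mul ((hmk A).2 hAm) (Ideal.pow_mem_pow hπym 3)
    convert Ideal.add_mem _ k2 (Ideal.mul_mem_left _ (π L) k1) using 1
    rw [map_pow]
    ring
  obtain ⟨g, hg⟩ := Ideal.mem_span_singleton'.1 (hker (b - (A * y + L * t ^ q)) (by
    rw [map_sub, map_add, map_mul, map_mul, hAL, sub_self]))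
  obtain ⟨v, rfl⟩ := hd
  have hU : IsUnit (1 + - (v * e * e₃)) :=
    h.isUnit_add isUnit_one (𝔪.neg_mem (𝔪.mul_mem_right _ (𝔪.mul_mem_left _ hem)))
  -- With `z' = z + e y` the equation is `v z'² + (b - v e²) y²`. These witnesses result from
  -- substituting `e = e₁ z + e₂ y + e₃ b` for one factor `e`, then `b = A y + L t ^ q + g z`, then
  -- `z = z' - e y`, and dividing by `v`.
  refine ⟨z + e * y, v, ↑v⁻¹ * (L * (1 + - (v * e * e₃))),
    ↑v⁻¹ * (A * (1 + - (v * e * e₃)) +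
      - (v * e * e₂ + (g * (1 + - (v * e * e₃)) - v * e * e₁) * e)),
    ↑v⁻¹ * (g * (1 + - (v * e * e₃)) - v * e * e₁), hcoord e, v.isUnit,
    v⁻¹.isUnit.mul (hL.mul hU), fun h2 => v⁻¹.isUnit.mul (h.isUnit_add ((hA h2).mul hU) ?_), ?_⟩
  · exact 𝔪.neg_mem (𝔪.add_mem (𝔪.mul_mem_right _ (𝔪.mul_mem_left _ hem)) (𝔪.mul_mem_left _ hem))
  · have hv : (v : R) * ↑v⁻¹ = 1 := v.mul_inv
    generalize ((v⁻¹ : Rˣ) : R) = w at *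
    generalize (v : R) = v at *
    linear_combination (-y ^ 2 * (1 - v * e * e₃)) * hg - (y ^ 2 * v * e) * he -
      ((L * t ^ q + A * y + g * z) * (1 - v * e * e₃) - v * e * (e₂ * y + e₁ * z)) * y ^ 2 * hv

end Germ

namespace Germ
variable {k R : Type u} [Field k] [CharZero k] [CommRing R] {φ : k →+* R} {𝔪 : Ideal R} {n : ℕ}

theorem coeffIdeal_two_le {D : Derivation ℤ R R} {P : Ideal R} {f : R}
    (h : ∀ g ∈ Ideal.span {f}, D g ∈ P) (hf : f ∈ P) :
    coeffIdeal D 2 (Ideal.span {f}) ≤ Ideal.span {f} ⊔ P ^ 2 := by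
  rw [coeffIdeal_le_iff]
  intro j hj
  rw [coeffMultiplicity_two]
  obtain rfl | rfl : j = 0 ∨ j = 1 := by omega
  · norm_num
  · norm_num
    refine le_sup_of_le_right (Ideal.pow_right_mono ?_ 2)
    exact partialClosure_le_iff.2 ⟨(Ideal.span_singleton_le_iff_mem _).2 hf, h⟩

/-- The first derivatives of `f` lie in `P`, so `z ∈ P`, and the coefficient ideal on `V(z)` and its
derivatives along `ζ` lie in the image of `P`. Then `exists_linear_mem` gives `y = ζ - ρ t ^ q` in
`P`, the height forces `P = (z, y)`, and `y` replaces `ζ` as a coordinate. -/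
theorem exists_normal_form (h : Germ φ 𝔪 n) {f s : R} {P : Ideal R} {q : ℕ} (hq : q = 1 ∨ q = 2)
    (hP : P.IsPrime) (hP2 : P.height ≤ 2) (hs : s ∉ P) (hsf : s * f ∈ P ^ 2)
    (hinv : HasInv φ 𝔪 (Ideal.span {f}) 1
      [2, 0, ((3 / 2 : ℚ) : WithTop ℚ), 0, ((q : ℚ) : WithTop ℚ), 0, ⊤]) :
    ∃ (m : ℕ) (z y t : R) (o : Fin m → R) (d l α γ : R), n = m + 3 ∧
      Ideal.span (insert z (insert y (insert t (Set.range o)))) = 𝔪 ∧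
      IsUnit d ∧ IsUnit l ∧ (q = 2 → IsUnit α) ∧
      f = d * (z ^ 2 + (α * y + l * t ^ q + γ * z) * y ^ 2) := by
  have hq0 : q ≠ 0 := by omega
  have hf : f ∈ P := (hP.mem_or_mem (Ideal.pow_le_self two_ne_zero hsf)).resolve_left hs
  have hDf : ∀ D : Derivation ℤ R R, ∀ g ∈ Ideal.span {f}, D g ∈ P := fun D g hg =>
    derivation_mem_sup_span P ((Ideal.span_singleton_le_iff_mem _).2 hf) rfl
      (by rintro r rfl; exact derivation_mem_of_mul_mem_sq hP hs hsf D) hg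
  obtain ⟨-, hinv⟩ | ⟨M, z, D, s', hM, ⟨hI, hI'⟩, ⟨hzm, hz2⟩, hz, hD, hinv, e⟩ := hasInv_cases hinv
  · simp at hinv
  simp only [List.cons.injEq, true_and] at e
  obtain ⟨e, rfl⟩ := e
  obtain rfl : M = 2 := by
    have e' : ((2 : ℚ) : WithTop ℚ) = (((M : ℚ) / (1 : ℕ) : ℚ) : WithTop ℚ) := e
    rw [WithTop.coe_inj] at e'
    have : (M : ℚ) = 2 := by
      push_cast at e'
      linarith
    exact_mod_cast this
  rw [coeffMultiplicity_two] at hinv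
  change z ∈ derivClosure φ (Ideal.span {f}) at hz
  obtain ⟨m₁, o₁, rfl, ho₁, hDl, hDo, hDz⟩ := h.isPartialDerivative_iff.1 hD
  have hR := h.quotient ho₁
  obtain ⟨⟨hC3, hC4⟩, m, ζ, t, o, hm, ho, hCJ, hnd, hg⟩ := hR.exists_nondegenerate hq hinv
  subst hm
  obtain ⟨ζ, rfl⟩ := Ideal.Quotient.mk_surjective ζ
  obtain ⟨t, rfl⟩ := Ideal.Quotient.mk_surjective t
  choose o' ho' using fun j => Ideal.Quotient.mk_surjective (o j)
  have hspan : Ideal.span (insert z (insert ζ (insert t (Set.range o')))) = 𝔪 := by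
    refine span_insert_eq_of_map_mk hzm ?_
    rw [Set.image_insert_eq, Set.image_insert_eq, ← Set.range_comp, ← ho]
    congr 4
    exact funext ho'
  have hζm : ζ ∈ 𝔪 := hspan ▸ Ideal.subset_span (by simp)
  have htm : t ∈ 𝔪 := hspan ▸ Ideal.subset_span (by simp)
  obtain ⟨E, hE, hEζ, hEz, hEo⟩ := (h.exists_dual_insert_insert (ζ := ζ) (t := z)
    (o := Fin.cons t o') (by rw [Fin.range_cons, Set.insert_comm, hspan])).1
  have hEt : E t = 0 := hEo 0
  have hzP : z ∈ P := derivClosure_le_iff.2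
    ⟨(Ideal.span_singleton_le_iff_mem _).2 hf, fun D _ => hDf D⟩ hz
  have hzP' : Ideal.span {z} ≤ P := (Ideal.span_singleton_le_iff_mem _).2 hzP
  have hmk : ∀ r, Ideal.Quotient.mk (Ideal.span {z}) r ∈
      P.map (Ideal.Quotient.mk (Ideal.span {z})) ↔ r ∈ P := fun r => Germ.mk_mem_map_iff hzP'
  have hPπ : (P.map (Ideal.Quotient.mk (Ideal.span {z}))).IsPrime :=
    Ideal.map_isPrime_of_surjective Ideal.Quotient.mk_surjective (by rwa [Ideal.mk_ker])
  obtain ⟨E', hE'⟩ := exists_derivation_of_surjective (Ideal.Quotient.mk (Ideal.span {z}))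
    Ideal.Quotient.mk_surjective E (fun r hr => by
      obtain ⟨a, rfl⟩ := Ideal.mem_span_singleton'.1 (Ideal.Quotient.eq_zero_iff_mem.1 hr)
      rw [E.leibniz, hEz, smul_zero, zero_add, smul_eq_mul, Ideal.Quotient.eq_zero_iff_mem]
      exact Ideal.mul_mem_right _ _ (Ideal.mem_span_singleton_self z))
  have hCP := coeffIdeal_two_le (hDf D) hf
  have hCP' : ∀ g ∈ (coeffIdeal D 2 (Ideal.span {f})).map (Ideal.Quotient.mk (Ideal.span {z})),
      g ∈ P.map (Ideal.Quotient.mk (Ideal.span {z})) ∧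
      E' g ∈ P.map (Ideal.Quotient.mk (Ideal.span {z})) := by
    intro g hg
    obtain ⟨g, hg', rfl⟩ := (Ideal.mem_map_iff_of_surjective _ Ideal.Quotient.mk_surjective).1 hg
    rw [hE', hmk, hmk]
    obtain ⟨a, ha, b, hb, rfl⟩ := Submodule.mem_sup.1 (hCP hg')
    refine ⟨P.add_mem ((Ideal.span_singleton_le_iff_mem _).2 hf ha)
      (Ideal.pow_le_self two_ne_zero hb), ?_⟩
    rw [map_add]
    exact P.add_mem (hDf E a ha) (by simpa using derivation_mem_pow P E 1 hb)
  -- `z`, `ζ` and `t` are independent coordinates, too many for a prime of height at most 2.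
  have hζt : ¬ (ζ ∈ P ∧ t ∈ P) := by
    rintro ⟨h1, h2⟩
    have h3 := h.eq_span_pair_of_height_le (z := z) (y := ζ) (o := Fin.cons t o')
      (by rwa [Fin.range_cons]) hP hP2 hzP h1
    obtain ⟨F, -, hFt, hFz, hFo⟩ := (h.exists_dual_insert_insert (ζ := t) (t := z)
      (o := Fin.cons ζ o') (by
        rw [Fin.range_cons, Set.insert_comm, Set.insert_comm t, hspan])).1
    refine h.notMem_span_of_derivation (S := {z, ζ}) (D := F) (t := t) ?_ ?_ hFt (h3 ▸ h2)
    · rintro r (rfl | rfl)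
      exacts [hzm, hζm]
    · rintro r (rfl | rfl)
      exacts [hFz, hFo 0]
  obtain ⟨ρ, hρ⟩ := hR.exists_linear_mem (τ := Ideal.Quotient.mk (Ideal.span {z}) t ^ q) hPπ
    (Ideal.mem_map_of_mem _ hζm)
    (Ideal.pow_mem_of_mem _ (Ideal.mem_map_of_mem _ htm) q (Nat.pos_of_ne_zero hq0))
    (D := E') (by rw [hE', hEζ, map_one])
    (by rw [E'.leibniz_pow, hE', hEt]; simp) hCJ (fun g hg => (hCP' g hg).1)
    (fun g hg => (hCP' g hg).2) (fun h1 => hζt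
      ⟨(hmk _).1 (h1 (Ideal.subset_span (by simp))),
        hP.mem_of_pow_mem q ((hmk _).1 (by rw [map_pow]; exact h1 (Ideal.subset_span (by simp))))⟩)
    hnd hg
  obtain ⟨ρ, rfl⟩ := Ideal.Quotient.mk_surjective ρ
  rw [← map_pow, ← map_mul, ← map_sub, hmk] at hρ
  obtain ⟨y, hy⟩ : ∃ y, y = ζ - ρ * t ^ q := ⟨_, rfl⟩
  rw [← hy] at hρ
  have hyspan : Ideal.span (insert z (insert y (insert t (Set.range o')))) = 𝔪 := by
    have e1 : y = ζ + (-(ρ * t ^ (q - 1))) * t := by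
      rw [hy]
      obtain rfl | rfl := hq <;> simp <;> ring
    rw [Set.insert_comm, Set.insert_comm z, Set.insert_comm y, e1, span_insert_insert_add_mul,
      Set.insert_comm t, Set.insert_comm t, Set.insert_comm ζ, hspan]
  have hPzy := h.eq_span_pair_of_height_le (z := z) (y := y) (o := Fin.cons t o')
      (by rwa [Fin.range_cons]) hP hP2 hzP hρ
  obtain ⟨d, c, b, rfl⟩ := h.exists_eq_binary_quadric (z := z) (y := y) (o := Fin.cons t o')
    (by rwa [Fin.range_cons]) (hPzy ▸ hs) (hPzy ▸ hsf)
  have hJ : Ideal.span {Ideal.Quotient.mk (Ideal.span {z}) y,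
      Ideal.Quotient.mk (Ideal.span {z}) (t ^ q)} = Ideal.span {Ideal.Quotient.mk (Ideal.span {z}) ζ,
      Ideal.Quotient.mk (Ideal.span {z}) t ^ q} := by
    have e1 : y = ζ + (-ρ) * t ^ q := by rw [hy]; ring
    have := span_insert_insert_add_mul (Ideal.Quotient.mk (Ideal.span {z}) (t ^ q))
      (Ideal.Quotient.mk (Ideal.span {z}) ζ) (Ideal.Quotient.mk (Ideal.span {z}) (-ρ)) ∅
    rw [← map_mul, ← map_add, ← e1] at this
    rw [← map_pow, Set.pair_comm, Set.pair_comm _ (Ideal.Quotient.mk (Ideal.span {z}) (t ^ q))]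
    simpa using this
  obtain ⟨z', d', l, α, γ, h1, h2, h3, h4, h5⟩ := h.exists_normal_form_of_binary_quadric hq hDz
    hyspan hz (fun h1 => hI' ((Ideal.span_singleton_le_iff_mem _).2 h1)) rfl hC3 hC4
    (hJ ▸ hCJ) (hJ ▸ hnd _ (hJ ▸ Ideal.subset_span (by simp)))
  exact ⟨m, z', y, t, o', d', l, α, γ, rfl, h1, h2, h3, h4, h5⟩

end Germ

/-! ### Coordinates for the two models -/

theorem span_insert_congr {R : Type u} [CommRing R] {x t u : R} {S : Set R} (hu : IsUnit u)
    (h : x - u * t ∈ Ideal.span S) : Ideal.span (insert x S) = Ideal.span (insert t S) := by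
  have hS : ∀ r : R, Ideal.span S ≤ Ideal.span (insert r S) := fun r => Ideal.span_mono (by simp)
  have hm : ∀ r : R, r ∈ Ideal.span (insert r S) := fun r => Ideal.subset_span (by simp)
  apply le_antisymm <;> rw [Ideal.span_le, Set.insert_subset_iff]
  · refine ⟨?_, (Set.subset_insert t S).trans Ideal.subset_span⟩
    have := Ideal.add_mem _ (hS t h) (Ideal.mul_mem_left _ u (hm t))
    rwa [sub_add_cancel] at this
  · refine ⟨(Ideal.unit_mul_mem_iff_mem _ hu).1 ?_, (Set.subset_insert x S).trans Ideal.subset_span⟩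
    have := Ideal.sub_mem _ (hm x) (hS x h)
    rwa [sub_sub_cancel] at this

theorem span_singleton_unit_mul {R : Type u} [CommRing R] {d r : R} (hd : IsUnit d) :
    Ideal.span {d * r} = Ideal.span {r} := by
  have := span_insert_congr (x := d * r) (t := r) (S := ∅) hd (by simp)
  simpa using this

theorem range_cons_cons_cons {R : Type u} {m : ℕ} (x y z : R) (o : Fin m → R) :
    Set.range (Fin.cons x (Fin.cons y (Fin.cons z o)) : Fin (m + 3) → R) =
      insert z (insert y (insert x (Set.range o))) := by
  rw [Fin.range_cons, Fin.range_cons, Fin.range_cons, Set.insert_comm, Set.insert_comm x,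
    Set.insert_comm y]

theorem derivation_two {R : Type u} [CommRing R] (D : Derivation ℤ R R) : D 2 = 0 :=
  mod_cast D.map_natCast 2

theorem derivation_three {R : Type u} [CommRing R] (D : Derivation ℤ R R) : D 3 = 0 :=
  mod_cast D.map_natCast 3

theorem cons_cons_cons_apply {R : Type u} {m : ℕ} (x y z : R) (o : Fin m → R) :
    ![(Fin.cons x (Fin.cons y (Fin.cons z o)) : Fin (m + 3) → R) 0,
      (Fin.cons x (Fin.cons y (Fin.cons z o)) : Fin (m + 3) → R) 1,
      (Fin.cons x (Fin.cons y (Fin.cons z o)) : Fin (m + 3) → R) 2] = ![x, y, z] := rfl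

theorem exists_eq_cons_cons_cons {R : Type u} {m : ℕ} (T : Fin (m + 3) → R) :
    ∃ o : Fin m → R, T = Fin.cons (T 0) (Fin.cons (T 1) (Fin.cons (T 2) o)) := by
  refine ⟨fun j => T j.succ.succ.succ, ?_⟩
  funext j
  refine Fin.cases rfl (fun j => ?_) j
  refine Fin.cases rfl (fun j => ?_) j
  refine Fin.cases rfl (fun j => ?_) j
  rfl

/-- For `q = 1` the whole bracket contains `t` with a unit coefficient, so it can itself serve as
the coordinate `x`. -/
theorem exists_pinch_coordinates {R : Type u} [CommRing R] {m : ℕ} {z y t d l α γ : R}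
    (o : Fin m → R) (hd : IsUnit d) (hl : IsUnit l) :
    ∃ T : Fin (m + 3) → R,
      Ideal.span (Set.range T) = Ideal.span (insert z (insert y (insert t (Set.range o)))) ∧
      Ideal.span {d * (z ^ 2 + (α * y + l * t ^ 1 + γ * z) * y ^ 2)} =
        Ideal.span {MvPolynomial.aeval ![T 0, T 1, T 2]
          (MvPolynomial.X 2 ^ 2 + MvPolynomial.X 0 * MvPolynomial.X 1 ^ 2 :
            MvPolynomial (Fin 3) ℤ)} := by
  refine ⟨Fin.cons (α * y + l * t ^ 1 + γ * z) (Fin.cons y (Fin.cons z o)), ?_, ?_⟩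
  · rw [range_cons_cons_cons, Set.insert_comm y, Set.insert_comm z,
      span_insert_congr (t := t) hl, Set.insert_comm t, Set.insert_comm t]
    refine Ideal.mem_span_insert.2 ⟨γ, α * y, ?_, by ring⟩
    exact Ideal.mul_mem_left _ _ (Ideal.subset_span (by simp))
  · rw [span_singleton_unit_mul hd]
    rw [cons_cons_cons_apply]
    congr 2
    simp

/-- Completing the square once more, by `z + γ y² / 2`, absorbs `γ` and changes `α` into a unit `a`.
With `w = a σ² y` and `Z = a σ³ (z + γ y² / 2)`, multiplication by `a² σ⁶` gives `Z² + (w + 3 t²)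
w²`. The model has `w = y - x²`, so its second coordinate is `w + t²`. -/
theorem exists_degenerate_pinch_coordinates {k R : Type u} [Field k] [CharZero k] [CommRing R]
    {φ : k →+* R} {𝔪 : Ideal R} {n m : ℕ} (h : Germ φ 𝔪 n) {z y t d l α γ σ : R}
    (o : Fin m → R) (ho : Ideal.span (insert z (insert y (insert t (Set.range o)))) = 𝔪)
    (hd : IsUnit d) (hα : IsUnit α) (hσ : l * σ ^ 2 = 3) :
    ∃ T : Fin (m + 3) → R, Ideal.span (Set.range T) = 𝔪 ∧
      Ideal.span {d * (z ^ 2 + (α * y + l * t ^ 2 + γ * z) * y ^ 2)} =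
        Ideal.span {MvPolynomial.aeval ![T 0, T 1, T 2]
          (MvPolynomial.X 2 ^ 2 + (MvPolynomial.X 1 + 2 * MvPolynomial.X 0 ^ 2) *
            (MvPolynomial.X 1 - MvPolynomial.X 0 ^ 2) ^ 2 : MvPolynomial (Fin 3) ℤ)} := by
  have hym : y ∈ 𝔪 := ho ▸ Ideal.subset_span (by simp)
  have h3 : IsUnit (3 : R) := h.isUnit_ofNat 3
  obtain ⟨i2, hi2⟩ := (h.isUnit_ofNat 2).exists_right_inv
  have hσu : IsUnit σ := (isUnit_pow_iff two_ne_zero).1 (isUnit_of_mul_isUnit_right (hσ ▸ h3))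
  obtain ⟨a, ha⟩ : ∃ a, a = α + - ((i2 * γ) ^ 2 * y) := ⟨_, rfl⟩
  have hau : IsUnit a := ha ▸ h.isUnit_add hα (𝔪.neg_mem (𝔪.mul_mem_left _ hym))
  obtain ⟨Z, hZ⟩ : ∃ Z, Z = a * σ ^ 3 * (z + i2 * γ * y ^ 2) := ⟨_, rfl⟩
  obtain ⟨w, hw⟩ : ∃ w, w = a * σ ^ 2 * y := ⟨_, rfl⟩
  refine ⟨Fin.cons t (Fin.cons (w + t ^ 2) (Fin.cons Z o)), ?_, ?_⟩
  · rw [range_cons_cons_cons]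
    rw [Set.insert_comm, span_insert_congr (t := y) (hau.mul (hσu.pow 2)), Set.insert_comm,
      span_insert_congr (t := z) (hau.mul (hσu.pow 3)), ho]
    · rw [hZ]
      convert Ideal.mul_mem_left _ (a * σ ^ 3 * (i2 * γ * y))
        (Ideal.subset_span (Set.mem_insert y (insert t (Set.range o)))) using 1
      ring
    · rw [hw, add_sub_cancel_left]
      exact Ideal.pow_mem_of_mem _ (Ideal.subset_span (by simp)) 2 (by norm_num)
  · rw [span_singleton_unit_mul hd]
    have e2 : a ^ 2 * σ ^ 6 * (z ^ 2 + (α * y + l * t ^ 2 + γ * z) * y ^ 2) =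
        Z ^ 2 + (w + 3 * t ^ 2) * w ^ 2 := by
      rw [hZ, hw]
      linear_combination (-a ^ 2 * σ ^ 6 * γ * z * y ^ 2) * hi2 - a ^ 2 * σ ^ 6 * y ^ 3 * ha +
        a ^ 2 * y ^ 2 * σ ^ 4 * t ^ 2 * hσ
    rw [← span_singleton_unit_mul ((hau.pow 2).mul (hσu.pow 6)), e2]
    rw [cons_cons_cons_apply]
    congr 2
    simp
    ring

/-! ### Invariant and singular locus of the two models -/

namespace Germ
variable {k R : Type u} [Field k] [CharZero k] [CommRing R] {φ : k →+* R} {𝔪 : Ideal R} {n : ℕ}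

theorem hasInv_pinch {m : ℕ} (h : Germ φ 𝔪 (m + 3)) {T : Fin (m + 3) → R}
    (hT : Ideal.span (Set.range T) = 𝔪) {s : List (WithTop ℚ)}
    (hs : HasInv φ 𝔪 (Ideal.span {MvPolynomial.aeval ![T 0, T 1, T 2]
      (MvPolynomial.X 2 ^ 2 + MvPolynomial.X 0 * MvPolynomial.X 1 ^ 2 :
        MvPolynomial (Fin 3) ℤ)}) 1 s) :
    s = [2, 0, ((3 / 2 : ℚ) : WithTop ℚ), 0, ((1 : ℕ) : ℚ), 0, ⊤] := by
  obtain ⟨o, ho⟩ := exists_eq_cons_cons_cons T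
  rw [ho, range_cons_cons_cons] at hT
  obtain ⟨E, -, hE0, hE2, -⟩ := (h.exists_dual_insert_insert (ζ := T 0) (t := T 2)
    (o := Fin.cons (T 1) o) (by
      rw [Fin.range_cons, Set.insert_comm, Set.insert_comm (T 0), hT])).1
  refine h.hasInv_sq_add (x := T 0) hT (Or.inl rfl) (by rw [pow_one]) hE2
    (hE0 ▸ isUnit_one) ?_
  simpa using hs

theorem hasInv_degenerate_pinch {m : ℕ} (h : Germ φ 𝔪 (m + 3)) {T : Fin (m + 3) → R}
    (hT : Ideal.span (Set.range T) = 𝔪) {s : List (WithTop ℚ)}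
    (hs : HasInv φ 𝔪 (Ideal.span {MvPolynomial.aeval ![T 0, T 1, T 2]
      (MvPolynomial.X 2 ^ 2 + (MvPolynomial.X 1 + 2 * MvPolynomial.X 0 ^ 2) *
        (MvPolynomial.X 1 - MvPolynomial.X 0 ^ 2) ^ 2 : MvPolynomial (Fin 3) ℤ)}) 1 s) :
    s = [2, 0, ((3 / 2 : ℚ) : WithTop ℚ), 0, ((2 : ℕ) : ℚ), 0, ⊤] := by
  obtain ⟨o, ho⟩ := exists_eq_cons_cons_cons T
  rw [ho, range_cons_cons_cons] at hT
  obtain ⟨E, -, hE1, hE2, hEo⟩ := (h.exists_dual_insert_insert (ζ := T 1) (t := T 2)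
    (o := Fin.cons (T 0) o) (by
      rw [Fin.range_cons, Set.insert_comm, hT])).1
  have hE0 : E (T 0) = 0 := hEo 0
  have hspan : Ideal.span (insert (T 2) (insert (T 1 - T 0 ^ 2) (insert (T 0) (Set.range o)))) =
      𝔪 := by
    rw [Set.insert_comm, span_insert_congr (t := T 1) isUnit_one, Set.insert_comm, hT]
    rw [one_mul, sub_sub_cancel_left]
    exact Ideal.neg_mem_iff _ |>.2
      (Ideal.pow_mem_of_mem _ (Ideal.subset_span (by simp)) 2 (by norm_num))
  refine h.hasInv_sq_add (x := T 0) (c := T 1 + 2 * T 0 ^ 2) hspan (Or.inr rfl) ?_ hE2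
    (by simp [E.leibniz, E.leibniz_pow, hE0, hE1, derivation_two]) ?_
  · rw [Set.pair_comm, Set.pair_comm _ (T 0 ^ 2)]
    refine span_insert_congr (h.isUnit_ofNat 3) ?_
    rw [Ideal.mem_span_singleton]
    exact ⟨1, by norm_num; ring⟩
  · simpa using hs

theorem two_le_height {m : ℕ} (h : Germ φ 𝔪 (m + 2)) {z y : R} {o : Fin m → R}
    (ho : Ideal.span (insert z (insert y (Set.range o))) = 𝔪) {P : Ideal R} (hP : P.IsPrime)
    (hz : z ∈ P) (hy : y ∈ P) : 2 ≤ P.height := by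
  by_contra hlt
  rw [not_le] at hlt
  have h1 := h.eq_span_pair_of_height_le ho hP hlt.le hz hy
  have := h.isDomain
  have p1 : (Ideal.span {z}).IsPrime := h.isPrime_span (o := Fin.cons y o) (by rwa [Fin.range_cons])
  have hzm : z ∈ 𝔪 := ho ▸ Ideal.subset_span (by simp)
  obtain ⟨⟨E, hE, hEz, hEy, -⟩, ⟨E', hE', hE'z, hE'y, -⟩⟩ := h.exists_dual_insert_insert ho
  have p0 : (⊥ : Ideal R).IsPrime := Ideal.isPrime_bot
  have l1 : (⊥ : Ideal R) < Ideal.span {z} := by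
    rw [bot_lt_iff_ne_bot, Ne, Ideal.span_singleton_eq_bot]
    rintro rfl
    have := h.nontrivial
    simp at hEz
  have l2 : Ideal.span {z} < P := by
    refine lt_of_le_of_ne ((Ideal.span_singleton_le_iff_mem _).2 hz) fun h2 => ?_
    exact h.notMem_span_of_derivation (S := {z}) (by simpa using hzm) (by simpa using hE'z) hE'y
      (h2 ▸ hy)
  have a1 := Ideal.height_add_one_le_of_lt_of_isPrime l1
  have a2 := Ideal.height_add_one_le_of_lt_of_isPrime l2
  have : (2 : ℕ∞) ≤ P.height := by
    calc (2 : ℕ∞) = 0 + 1 + 1 := by norm_num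
      _ ≤ (⊥ : Ideal R).height + 1 + 1 := by gcongr; exact zero_le
      _ ≤ (Ideal.span {z}).height + 1 := by gcongr
      _ ≤ _ := a2
  exact absurd this (not_le.2 hlt)

/-- Gives both halves of the codimension: the equation is singular along `V(z, w)`, and every prime
containing its first derivatives contains `z` and `w`. -/
theorem singular_pinch {m : ℕ} (h : Germ φ 𝔪 (m + 3)) {T : Fin (m + 3) → R}
    (hT : Ideal.span (Set.range T) = 𝔪) {f : R} (hf : f = MvPolynomial.aeval ![T 0, T 1, T 2]
      (MvPolynomial.X 2 ^ 2 + MvPolynomial.X 0 * MvPolynomial.X 1 ^ 2 :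
        MvPolynomial (Fin 3) ℤ)) :
    ∃ (z w : R) (o : Fin (m + 1) → R), Ideal.span (insert z (insert w (Set.range o))) = 𝔪 ∧
      f ∈ Ideal.span {z, w} ^ 2 ∧
      ∀ P : Ideal R, P.IsPrime → (∀ D : Derivation ℤ R R, D f ∈ P) → z ∈ P ∧ w ∈ P := by
  obtain ⟨o, ho⟩ := exists_eq_cons_cons_cons T
  rw [ho, range_cons_cons_cons] at hT
  have hf' : f = T 2 ^ 2 + T 0 * T 1 ^ 2 := by simpa using hf
  have hz : T 2 ∈ Ideal.span {T 2, T 1} := Ideal.subset_span (by simp)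
  have hw : T 1 ∈ Ideal.span {T 2, T 1} := Ideal.subset_span (by simp)
  refine ⟨T 2, T 1, Fin.cons (T 0) o, by rw [Fin.range_cons, hT], ?_, fun P hP hD => ?_⟩
  · rw [hf']
    exact Ideal.add_mem _ (Ideal.pow_mem_pow hz 2) (Ideal.mul_mem_left _ _ (Ideal.pow_mem_pow hw 2))
  obtain ⟨⟨E, -, hE2, hE0, hEo⟩, ⟨E', -, hE'2, hE'0, hE'o⟩⟩ := h.exists_dual_insert_insert
    (ζ := T 2) (t := T 0) (o := Fin.cons (T 1) o) (by
      rw [Fin.range_cons, Set.insert_comm (T 0), hT])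
  have hE1 : E (T 1) = 0 := hEo 0
  have hE'1 : E' (T 1) = 0 := hE'o 0
  have h1 := hD E
  have h2 := hD E'
  simp only [hf', map_add, Derivation.leibniz, Derivation.leibniz_pow, hE2, hE0, hE1, hE'2, hE'0,
    hE'1, smul_eq_mul, nsmul_eq_mul, mul_one, mul_zero, add_zero, zero_add, Nat.add_one_sub_one,
    pow_one] at h1 h2
  exact ⟨(Ideal.unit_mul_mem_iff_mem _ (h.isUnit_ofNat 2)).1 (by exact_mod_cast h1),
    hP.mem_of_pow_mem 2 h2⟩

theorem singular_degenerate_pinch {m : ℕ} (h : Germ φ 𝔪 (m + 3)) {T : Fin (m + 3) → R}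
    (hT : Ideal.span (Set.range T) = 𝔪) {f : R} (hf : f = MvPolynomial.aeval ![T 0, T 1, T 2]
      (MvPolynomial.X 2 ^ 2 + (MvPolynomial.X 1 + 2 * MvPolynomial.X 0 ^ 2) *
        (MvPolynomial.X 1 - MvPolynomial.X 0 ^ 2) ^ 2 : MvPolynomial (Fin 3) ℤ)) :
    ∃ (z w : R) (o : Fin (m + 1) → R), Ideal.span (insert z (insert w (Set.range o))) = 𝔪 ∧
      f ∈ Ideal.span {z, w} ^ 2 ∧
      ∀ P : Ideal R, P.IsPrime → (∀ D : Derivation ℤ R R, D f ∈ P) → z ∈ P ∧ w ∈ P := by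
  obtain ⟨o, ho⟩ := exists_eq_cons_cons_cons T
  rw [ho, range_cons_cons_cons] at hT
  obtain ⟨w, hw⟩ : ∃ w, w = T 1 - T 0 ^ 2 := ⟨_, rfl⟩
  have hf' : f = T 2 ^ 2 + (w + 3 * T 0 ^ 2) * w ^ 2 := by
    rw [hf, hw]
    simp
    ring
  have hspan : Ideal.span (insert (T 2) (insert w (insert (T 0) (Set.range o)))) =
      𝔪 := by
    rw [hw, Set.insert_comm, span_insert_congr (t := T 1) isUnit_one, Set.insert_comm, hT]
    rw [one_mul, sub_sub_cancel_left]
    exact Ideal.neg_mem_iff _ |>.2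
      (Ideal.pow_mem_of_mem _ (Ideal.subset_span (by simp)) 2 (by norm_num))
  have hzm : T 2 ∈ Ideal.span {T 2, w} := Ideal.subset_span (by simp)
  have hwm : w ∈ Ideal.span {T 2, w} := Ideal.subset_span (by simp)
  refine ⟨T 2, w, Fin.cons (T 0) o, by rw [Fin.range_cons, hspan], ?_, fun P hP hD => ?_⟩
  · rw [hf']
    exact Ideal.add_mem _ (Ideal.pow_mem_pow hzm 2)
      (Ideal.mul_mem_left _ _ (Ideal.pow_mem_pow hwm 2))
  obtain ⟨⟨E, -, hE2, hE0, hEo⟩, ⟨E', -, hE'2, hE'0, hE'o⟩⟩ := h.exists_dual_insert_insert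
    (ζ := T 2) (t := T 0) (o := Fin.cons w o) (by
      rw [Fin.range_cons, Set.insert_comm (T 0), hspan])
  obtain ⟨F, -, hF1, hF2, hFo⟩ := (h.exists_dual_insert_insert
    (ζ := w) (t := T 2) (o := Fin.cons (T 0) o) (by
      rw [Fin.range_cons, Set.insert_comm w, hspan])).1
  have hE1 : E w = 0 := hEo 0
  have hE'1 : E' w = 0 := hE'o 0
  have hF0 : F (T 0) = 0 := hFo 0
  have h1 := hD E
  have h2 := hD E'
  have h3 := hD F
  simp only [hf', map_add, Derivation.leibniz, Derivation.leibniz_pow, hE2, hE0, hE1, hE'2, hE'0,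
    hE'1, hF1, hF2, hF0, smul_eq_mul, nsmul_eq_mul, mul_one, mul_zero, add_zero, zero_add,
    Nat.add_one_sub_one, pow_one, derivation_three] at h1 h2 h3
  refine ⟨(Ideal.unit_mul_mem_iff_mem _ (h.isUnit_ofNat 2)).1 (by exact_mod_cast h1), ?_⟩
  -- With `x = T 0`, the derivative along `x` is `6 w² x` and the one along `w` is `3 w² + 6 w x²`.
  -- If `w ∉ P`, the first gives `x ∈ P` and then the second gives `w ∈ P`.
  by_contra hwP
  have hx : T 0 ∈ P := by
    have h4 : 6 * (w ^ 2 * T 0) ∈ P := by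
      convert h2 using 1
      push_cast
      ring
    exact (hP.mem_or_mem ((Ideal.unit_mul_mem_iff_mem _ (h.isUnit_ofNat 6)).1 h4)).resolve_left
      fun h5 => hwP (hP.mem_of_pow_mem 2 h5)
  have h4 : 3 * (w ^ 2) ∈ P := by
    convert P.sub_mem h3 (P.mul_mem_left (6 * w * T 0) hx) using 1
    push_cast
    ring
  exact hwP (hP.mem_of_pow_mem 2 ((Ideal.unit_mul_mem_iff_mem _ (h.isUnit_ofNat 3)).1 h4))

end Germ

/-! ### Local rings of smooth algebras and their localizations -/

section SmoothLocal
open TensorProduct IsLocalRing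

/-- The residue field is formally smooth over the perfect field `k`, so `κ ⊗ 𝔪 → κ ⊗ Ω` is
injective. The differentials of a minimal system of generators of `𝔪` therefore span a direct
summand of the free module `Ω`, and a retraction onto it provides the dual derivations. -/
theorem exists_germ {k R : Type u} [Field k] [CharZero k] [CommRing R] [IsLocalRing R]
    [IsNoetherianRing R] [Algebra k R] [Algebra.FormallySmooth k R] [Algebra.EssFiniteType k R] :
    ∃ n, Germ (algebraMap k R) (maximalIdeal R) n := by
  have : Module.Free R Ω[R⁄k] := Module.free_of_flat_of_isLocalRing
  have hsurj : Function.Surjective (algebraMap R (ResidueField R)) := residue_surjective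
  have : Algebra.FiniteType R (ResidueField R) :=
    Algebra.FiniteType.of_surjective (Algebra.ofId R (ResidueField R)) hsurj
  have hess : Algebra.EssFiniteType k (ResidueField R) := Algebra.EssFiniteType.comp k R _
  have hκ : Algebra.FormallySmooth k (ResidueField R) :=
    Algebra.FormallySmooth.of_perfectField
  have hinj := (Algebra.FormallySmooth.iff_injective_cotangentComplexBaseChange (R := k)
    (S := ResidueField R) (P := R) (K := ResidueField R) hsurj
    (IsNoetherian.noetherian _) (by simp [maximalIdeal_eq_bot])).1 inferInstance
  let I := RingHom.ker (algebraMap R (ResidueField R))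
  have hI : I = maximalIdeal R := IsLocalRing.ker_residue
  let b := Module.finBasis (ResidueField R) (ResidueField R ⊗[R] I)
  have hx : ∀ i, ∃ x : I, 1 ⊗ₜ x = b i := fun i =>
    TensorProduct.mk_surjective R I (ResidueField R) residue_surjective (b i)
  choose x hx using hx
  have hspan := IsLocalRing.span_eq_top_of_tmul_eq_basis (R := R) x b hx
  let f : (Fin (Module.finrank (ResidueField R) (ResidueField R ⊗[R] I)) → R) →ₗ[R] Ω[R⁄k] :=
    Fintype.linearCombination R fun i => KaehlerDifferential.D k R (x i : R)
  have hf : Function.Injective (f.lTensor (ResidueField R)) := by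
    have h1 : ∀ i, f.lTensor (ResidueField R) (1 ⊗ₜ Pi.single i 1) =
        KaehlerDifferential.cotangentComplexBaseChange k (ResidueField R) R (ResidueField R) (b i) := by
      intro i
      rw [← hx i, LinearMap.lTensor_tmul, KaehlerDifferential.cotangentComplexBaseChange_tmul]
      simp only [f, Fintype.linearCombination_apply_single, one_smul]
      rfl
    have hli : LinearIndependent (ResidueField R) fun i =>
        KaehlerDifferential.cotangentComplexBaseChange k (ResidueField R) R (ResidueField R) (b i) :=
      b.linearIndependent.map' _ (LinearMap.ker_eq_bot.2 hinj)
    let e := (Pi.basisFun R (Fin (Module.finrank (ResidueField R)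
      (ResidueField R ⊗[R] I)))).baseChange (ResidueField R)
    have h2 : (f.baseChange (ResidueField R)) ∘ e = fun i =>
        KaehlerDifferential.cotangentComplexBaseChange k (ResidueField R) R (ResidueField R) (b i) := by
      funext i
      rw [← h1 i]
      simp [e]
    rw [← h2] at hli
    have h3 : f.baseChange (ResidueField R) =
        Finsupp.linearCombination _ (f.baseChange (ResidueField R) ∘ e) ∘ₗ e.repr.toLinearMap :=
      e.ext fun i => by simp
    change Function.Injective (f.baseChange (ResidueField R))
    rw [h3]
    rw [LinearMap.coe_comp]
    exact Function.Injective.comp hli e.repr.injective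
  obtain ⟨l, hl⟩ := (IsLocalRing.split_injective_iff_lTensor_residueField_injective f).2 hf
  refine ⟨_, ‹_›, fun r => mem_maximalIdeal r, fun i => (x i : R), fun i =>
    (((LinearMap.proj i ∘ₗ l).compDer (KaehlerDifferential.D k R)).restrictScalars ℤ), ?_, ?_, ?_⟩
  · have := congrArg (Submodule.map I.subtype) hspan
    rw [Submodule.map_span, ← Set.range_comp, Submodule.map_top, Submodule.range_subtype] at this
    exact this.trans hI
  · intro i c
    simp
  · intro i j
    have h1 := LinearMap.congr_fun hl (Pi.single j 1)
    have h2 : f (Pi.single j 1) = KaehlerDifferential.D k R (x j : R) := by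
      simp [f, Fintype.linearCombination_apply_single]
    rw [LinearMap.comp_apply, h2] at h1
    have h3 := congrFun h1 i
    change l (KaehlerDifferential.D k R (x j : R)) i = _
    rw [h3]
    simp [Pi.single_apply]

end SmoothLocal

section Localization
open IsLocalRing

theorem isLocalization_atPrime_comap {A S T : Type*} [CommRing A] [CommRing S] [CommRing T]
    [IsLocalRing T] [Algebra A S] [Algebra A T] [Algebra S T] [IsScalarTower A S T]
    (M N : Submonoid A) [IsLocalization M S] [IsLocalization N T] :
    IsLocalization.AtPrime T ((maximalIdeal T).comap (algebraMap S T)) where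
  map_units s := by
    by_contra h
    exact s.2 ((mem_maximalIdeal _).2 h)
  surj t := by
    obtain ⟨⟨a, n⟩, h⟩ := IsLocalization.surj N t
    refine ⟨⟨algebraMap A S a, ⟨algebraMap A S n, fun hn => ?_⟩⟩, ?_⟩
    · rw [SetLike.mem_coe, Ideal.mem_comap, ← IsScalarTower.algebraMap_apply] at hn
      exact (mem_maximalIdeal _).1 hn (IsLocalization.map_units T n)
    · simpa only [← IsScalarTower.algebraMap_apply] using h
  exists_of_eq {x y} h := by
    obtain ⟨⟨a, m⟩, ha⟩ := IsLocalization.surj M x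
    obtain ⟨⟨b, l⟩, hb⟩ := IsLocalization.surj M y
    have h1 : algebraMap A T (a * l) = algebraMap A T (b * m) := by
      simp only [IsScalarTower.algebraMap_apply A S T, map_mul, ← ha, ← hb, h]
      ring
    obtain ⟨n, hn⟩ := (IsLocalization.eq_iff_exists N T).1 h1
    refine ⟨⟨algebraMap A S n, fun hn => ?_⟩, ?_⟩
    · rw [SetLike.mem_coe, Ideal.mem_comap, ← IsScalarTower.algebraMap_apply] at hn
      exact (mem_maximalIdeal _).1 hn (IsLocalization.map_units T n)
    · refine ((IsLocalization.map_units S m).mul (IsLocalization.map_units S l)).mul_left_cancel ?_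
      have := congrArg (algebraMap A S) hn
      simp only [map_mul] at this
      linear_combination this + algebraMap A S n * (algebraMap A S l * ha - algebraMap A S m * hb)

theorem ker_eq_map_of_isLocalization {S T S' T' : Type*} [CommRing S] [CommRing T] [CommRing S']
    [CommRing T'] [Algebra S T] [Algebra S' T'] {M : Submonoid S} {M' : Submonoid S'}
    [IsLocalization M T] [IsLocalization M' T'] (f : S →+* S') (g : T →+* T') [IsLocalHom g]
    (hf : Function.Surjective f) (h : ∀ s, g (algebraMap S T s) = algebraMap S' T' (f s)) :
    RingHom.ker g = (RingHom.ker f).map (algebraMap S T) := by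
  refine le_antisymm (fun t ht => ?_) (Ideal.map_le_iff_le_comap.2 fun s hs => ?_)
  · obtain ⟨⟨s, m⟩, hs⟩ := IsLocalization.surj M t
    have h1 : algebraMap S' T' (f s) = algebraMap S' T' 0 := by
      rw [← h, ← hs, map_mul, (RingHom.mem_ker).1 ht, zero_mul, map_zero]
    obtain ⟨c, hc⟩ := (IsLocalization.eq_iff_exists M' T').1 h1
    obtain ⟨b, hb⟩ := hf c
    have hu : IsUnit (algebraMap S T b) := by
      refine IsUnit.of_map g _ ?_
      rw [h, hb]
      exact IsLocalization.map_units T' c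
    have h2 : b * s ∈ RingHom.ker f := by rw [RingHom.mem_ker, map_mul, hb, hc, mul_zero]
    have h3 := Ideal.mem_map_of_mem (algebraMap S T) h2
    rw [map_mul, Ideal.unit_mul_mem_iff_mem _ hu, ← hs,
      Ideal.mul_unit_mem_iff_mem _ (IsLocalization.map_units T m)] at h3
    exact h3
  · rw [Ideal.mem_comap, RingHom.mem_ker, h, (RingHom.mem_ker).1 hs, map_zero]

end Localization

/-! ### Stalks at generizations -/

section Stalks
open IsLocalRing

variable {Z : Scheme.{u}}

/-- The prime of the local ring at `a` that corresponds to a generization `y` of `a`. -/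
noncomputable def stalkPrime {y a : Z} (h : y ⤳ a) : Ideal (Z.presheaf.stalk a) :=
  (maximalIdeal (Z.presheaf.stalk y)).comap (Z.presheaf.stalkSpecializes h).hom

instance {y a : Z} (h : y ⤳ a) : (stalkPrime h).IsPrime := Ideal.IsPrime.comap _

theorem isLocalization_stalkSpecializes {y a : Z} (h : y ⤳ a) :
    letI := (Z.presheaf.stalkSpecializes h).hom.toAlgebra
    IsLocalization.AtPrime (Z.presheaf.stalk y) (stalkPrime h) := by
  obtain ⟨_, ⟨V, hV, rfl⟩, haV, -⟩ :=
    Z.isBasis_affineOpens.exists_subset_of_mem_open (Set.mem_univ a) isOpen_univ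
  have hyV : y ∈ V := h.mem_open V.2 haV
  let := (Z.presheaf.stalkSpecializes h).hom.toAlgebra
  let := Z.presheaf.algebra_section_stalk ⟨y, hyV⟩
  let := Z.presheaf.algebra_section_stalk ⟨a, haV⟩
  have h1 := hV.isLocalization_stalk ⟨y, hyV⟩
  have h2 := hV.isLocalization_stalk ⟨a, haV⟩
  have : IsScalarTower Γ(Z, V) (Z.presheaf.stalk a) (Z.presheaf.stalk y) :=
    .of_algebraMap_eq' (by
      have := Z.presheaf.germ_stalkSpecializes haV h
      exact (congrArg CommRingCat.Hom.hom this).symm)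
  exact isLocalization_atPrime_comap (hV.primeIdealOf ⟨a, haV⟩).asIdeal.primeCompl
    (hV.primeIdealOf ⟨y, hyV⟩).asIdeal.primeCompl

theorem ringKrullDim_stalk_eq_height {y a : Z} (h : y ⤳ a) :
    ringKrullDim (Z.presheaf.stalk y) = (stalkPrime h).height := by
  let := (Z.presheaf.stalkSpecializes h).hom.toAlgebra
  have := isLocalization_stalkSpecializes h
  exact IsLocalization.AtPrime.ringKrullDim_eq_height (stalkPrime h) _

/-- Translates singularity at the generization `y` into the symbolic square of a prime of the local
ring at `a`, the form used in the algebraic part. -/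
theorem stalkSpecializes_mem_sq_iff {y a : Z} (h : y ⤳ a) (f : Z.presheaf.stalk a) :
    (Z.presheaf.stalkSpecializes h).hom f ∈ maximalIdeal (Z.presheaf.stalk y) ^ 2 ↔
      ∃ s ∉ stalkPrime h, s * f ∈ stalkPrime h ^ 2 := by
  let := (Z.presheaf.stalkSpecializes h).hom.toAlgebra
  have := isLocalization_stalkSpecializes h
  have h1 : (stalkPrime h).map (algebraMap (Z.presheaf.stalk a) (Z.presheaf.stalk y)) =
    maximalIdeal (Z.presheaf.stalk y) := IsLocalization.AtPrime.map_eq_maximalIdeal _ _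
  rw [← h1, ← Ideal.map_pow]
  exact (IsLocalization.algebraMap_mem_map_algebraMap_iff (stalkPrime h).primeCompl _ _ _)

theorem exists_stalkPrime_eq (a : Z) (P : Ideal (Z.presheaf.stalk a)) (hP : P.IsPrime) :
    ∃ (y : Z) (h : y ⤳ a), stalkPrime h = P := by
  let q : ↥(Spec (Z.presheaf.stalk a)) := (⟨P, hP⟩ : PrimeSpectrum (Z.presheaf.stalk a))
  have h : Z.fromSpecStalk a q ⤳ a := by
    have : Z.fromSpecStalk a q ∈ Set.range (Z.fromSpecStalk a) := ⟨_, rfl⟩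
    rwa [Scheme.range_fromSpecStalk] at this
  refine ⟨_, h, ?_⟩
  let c : ↥(Spec (Z.presheaf.stalk (Z.fromSpecStalk a q))) :=
    closedPoint (Z.presheaf.stalk (Z.fromSpecStalk a q))
  have h1 : (Spec.map (Z.presheaf.stalkSpecializes h) ≫ Z.fromSpecStalk a) c =
      Z.fromSpecStalk a q := by
    rw [Scheme.SpecMap_stalkSpecializes_fromSpecStalk h]
    exact Scheme.fromSpecStalk_closedPoint
  rw [Scheme.Hom.comp_apply] at h1
  exact congrArg PrimeSpectrum.asIdeal ((Z.fromSpecStalk a).isEmbedding.injective h1)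

end Stalks

section Smooth
open IsLocalRing

theorem exists_germ_stalk {k : Type u} [Field k] [CharZero k] {Z : Scheme.{u}}
    (p : Z ⟶ Spec (CommRingCat.of k)) [Smooth p] (a : Z) :
    ∃ n, Germ (scalars p a) (maximalIdeal (Z.presheaf.stalk a)) n := by
  have : IsLocallyNoetherian Z := LocallyOfFiniteType.isLocallyNoetherian p
  let := (scalars p a).toAlgebra
  let : Algebra k ((Spec (CommRingCat.of k)).presheaf.stalk (p a)) :=
    (StructureSheaf.toStalk k (p a)).hom.toAlgebra
  let := (p.stalkMap a).hom.toAlgebra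
  have : IsScalarTower k ((Spec (CommRingCat.of k)).presheaf.stalk (p a))
      (Z.presheaf.stalk a) := by
    have h : (Scheme.ΓSpecIso (CommRingCat.of k)).inv ≫ p.appTop ≫ Z.presheaf.germ ⊤ a trivial =
        StructureSheaf.toStalk k (p a) ≫ p.stalkMap a := by
      have := congrArg ((Scheme.ΓSpecIso (CommRingCat.of k)).inv ≫ ·)
        (p.germ_stalkMap ⊤ a trivial)
      exact this.symm
    exact .of_algebraMap_eq' (congrArg CommRingCat.Hom.hom h)
  let q : PrimeSpectrum k := p a
  have h1 : IsLocalization.AtPrime ((Spec (CommRingCat.of k)).presheaf.stalk (p a)) q.asIdeal :=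
    StructureSheaf.IsLocalization.to_stalk k (p a)
  have h2 : Algebra.FormallySmooth ((Spec (CommRingCat.of k)).presheaf.stalk (p a))
      (Z.presheaf.stalk a) := by
    have : a ∈ p.smoothLocus := by rw [p.smoothLocus_eq_top]; trivial
    exact this
  have h3 : Algebra.EssFiniteType ((Spec (CommRingCat.of k)).presheaf.stalk (p a))
      (Z.presheaf.stalk a) := LocallyOfFiniteType.stalkMap p a
  have h4 : Algebra.FormallySmooth k ((Spec (CommRingCat.of k)).presheaf.stalk (p a)) :=
    .of_isLocalization q.asIdeal.primeCompl
  have h5 : Algebra.EssFiniteType k ((Spec (CommRingCat.of k)).presheaf.stalk (p a)) :=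
    .of_isLocalization _ q.asIdeal.primeCompl
  have := Algebra.FormallySmooth.comp k ((Spec (CommRingCat.of k)).presheaf.stalk (p a))
      (Z.presheaf.stalk a)
  have := Algebra.EssFiniteType.comp k ((Spec (CommRingCat.of k)).presheaf.stalk (p a))
      (Z.presheaf.stalk a)
  exact exists_germ

end Smooth

/-! ### Regularity of hypersurfaces, étale stalk maps, closed subschemes -/

section Regular
open IsLocalRing

/-- If `f ∈ 𝔪²`, Nakayama lifts a minimal system of generators of the maximal ideal of `S` to
generators of `𝔪`, while the dimension drops by one, so `S` is not regular. If `f ∉ 𝔪²`, then `f` is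
a coordinate and the quotient is again a germ. -/
theorem Germ.isRegularLocalRing_iff {k R S : Type u} [Field k] [CharZero k] [CommRing R]
    [IsLocalRing R] [CommRing S] [IsLocalRing S] {φ : k →+* R} {n : ℕ} (h : Germ φ (maximalIdeal R) n)
    {g : R →+* S} (hg : Function.Surjective g) {f : R} (hf : f ∈ maximalIdeal R)
    (hf0 : f ∈ nonZeroDivisors R) (hker : RingHom.ker g = Ideal.span {f}) :
    IsRegularLocalRing S ↔ f ∉ maximalIdeal R ^ 2 := by
  have hR := h.isNoetherianRing
  let e : (R ⧸ Ideal.span {f}) ≃+* S :=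
    (Ideal.quotEquivOfEq hker.symm).trans (RingHom.quotientKerEquivOfSurjective hg)
  have hdim := ringKrullDim_quotient_span_singleton_succ_eq_ringKrullDim_of_mem_nonZeroDivisors
    hf0 hf
  have hgm : (maximalIdeal R).map g = maximalIdeal S := by
    have : IsLocalHom g := .of_surjective g hg
    exact IsLocalRing.map_maximalIdeal_of_surjective g hg
  refine ⟨fun hS hf2 => ?_, fun hf2 => ?_⟩
  · rw [ringKrullDim_eq_of_ringEquiv e, ← hS.spanFinrank_maximalIdeal] at hdim
    obtain ⟨s, hs, hs'⟩ := (hS.noetherian (maximalIdeal S)).exists_span_finset_card_eq_spanFinrank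
    have hg' := hg
    choose r hr using hg'
    have hle : maximalIdeal R ≤ Ideal.span (r '' s) := by
      refine h.le_of_le_sup_mul fun a ha => ?_
      have h1 : g a ∈ (Ideal.span (r '' s)).map g := by
        rw [Ideal.map_span, Set.image_image]
        simp only [hr, Set.image_id']
        have : g a ∈ maximalIdeal S := hgm ▸ Ideal.mem_map_of_mem g ha
        rw [← hs'] at this
        exact this
      obtain ⟨c, hc, hca⟩ := (Ideal.mem_map_iff_of_surjective g fun y => ⟨r y, hr y⟩).1 h1
      have h2 : a - c ∈ Ideal.span {f} := by
        rw [← hker, RingHom.mem_ker, map_sub, hca, sub_self]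
      rw [← add_sub_cancel c a]
      refine Submodule.add_mem_sup hc ?_
      rw [← sq]
      exact (Ideal.span_singleton_le_iff_mem _).2 hf2 h2
    have hle' : Ideal.span (r '' s) ≤ maximalIdeal R := by
      rw [Ideal.span_le]
      rintro _ ⟨y, hy, rfl⟩
      rw [SetLike.mem_coe, mem_maximalIdeal, mem_nonunits_iff]
      intro hu
      have hy' : y ∈ maximalIdeal S := hs' ▸ Submodule.subset_span hy
      exact (mem_maximalIdeal y).1 hy' (hr y ▸ hu.map g)
    have h1 := ringKrullDim_le_spanFinrank_maximalIdeal R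
    have h2 := Submodule.spanFinrank_span_le_ncard_of_finite (R := R)
      ((s.finite_toSet).image r)
    rw [← Ideal.span, le_antisymm hle' hle] at h2
    have h3 := h2.trans (Set.ncard_image_le s.finite_toSet)
    rw [Set.ncard_coe_finset, hs] at h3
    rw [← hdim] at h1
    have h4 : (maximalIdeal S).spanFinrank + 1 ≤ (maximalIdeal R).spanFinrank := by
      exact_mod_cast h1
    omega
  · obtain ⟨m, rfl, hm⟩ := h.quotient_of_order_one hf hf2
    have := hm.isLocalRing
    have := hm.isNoetherianRing
    have : IsRegularLocalRing (R ⧸ Ideal.span {f}) := by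
      refine .of_spanFinrank_maximalIdeal_le _ ?_
      rw [hm.ringKrullDim_eq, ← hm.eq_maximalIdeal]
      obtain ⟨x, d, hx, -⟩ := hm.exists_coords
      rw [← hx]
      have := Submodule.spanFinrank_span_le_ncard_of_finite (R := R ⧸ Ideal.span {f})
        (Set.finite_range x)
      refine Nat.cast_le.2 (this.trans ?_)
      rw [← Set.image_univ]
      exact (Set.ncard_image_le).trans (by simp)
    exact .of_ringEquiv e

end Regular

section Etale
open IsLocalRing

theorem etaleGermHom_stalkMap {U Z : Scheme.{u}} (ψ : U ⟶ Z) [Etale ψ] [IsLocallyNoetherian U]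
    (b : U) : EtaleGermHom (maximalIdeal (Z.presheaf.stalk (ψ b))) (ψ.stalkMap b).hom := by
  let := (ψ.stalkMap b).hom.toAlgebra
  have h1 : Algebra.FormallySmooth (Z.presheaf.stalk (ψ b)) (U.presheaf.stalk b) := by
    have : b ∈ ψ.smoothLocus := by rw [ψ.smoothLocus_eq_top]; trivial
    exact this
  have h2 : Algebra.FormallyUnramified (Z.presheaf.stalk (ψ b)) (U.presheaf.stalk b) :=
    FormallyUnramified.stalkMap ψ b
  have h3 : Algebra.EssFiniteType (Z.presheaf.stalk (ψ b)) (U.presheaf.stalk b) :=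
    LocallyOfFiniteType.stalkMap ψ b
  have h4 : IsLocalHom (algebraMap (Z.presheaf.stalk (ψ b)) (U.presheaf.stalk b)) :=
    inferInstanceAs (IsLocalHom (ψ.stalkMap b).hom)
  refine ⟨RingHom.formallyEtale_algebraMap.2 .of_formallyUnramified_and_formallySmooth,
    inferInstance, fun r => ?_⟩
  have := Algebra.FormallyUnramified.map_maximalIdeal (R := Z.presheaf.stalk (ψ b))
    (S := U.presheaf.stalk b)
  erw [this]
  rw [mem_maximalIdeal, mem_nonunits_iff]

end Etale

section ClosedSubscheme
open IsLocalRing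
variable {X Z : Scheme.{u}}

theorem stalkPrime_map (f : X ⟶ Z) {y x : X} (h : y ⤳ x) :
    stalkPrime (h.map f.continuous) = (stalkPrime h).comap (f.stalkMap x).hom := by
  have : (stalkPrime (h.map f.continuous)) = ((maximalIdeal (X.presheaf.stalk y)).comap
    (f.stalkMap y).hom).comap (Z.presheaf.stalkSpecializes (h.map f.continuous)).hom := by
    rw [((local_hom_TFAE (f.stalkMap y).hom).out 0 4 rfl rfl).1 inferInstance]
    rfl
  rw [this, stalkPrime, Ideal.comap_comap, Ideal.comap_comap, ← CommRingCat.hom_comp,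
    ← CommRingCat.hom_comp, ← f.stalkSpecializes_stalkMap y x h]

theorem stalkIdeal_specializes (i : X ⟶ Z) [IsClosedImmersion i] {y x : X} (h : y ⤳ x) :
    stalkIdeal i y = (stalkIdeal i x).map
      (Z.presheaf.stalkSpecializes (h.map i.continuous)).hom := by
  let := (X.presheaf.stalkSpecializes h).hom.toAlgebra
  let := (Z.presheaf.stalkSpecializes (h.map i.continuous)).hom.toAlgebra
  have := isLocalization_stalkSpecializes h
  have := isLocalization_stalkSpecializes (h.map i.continuous)
  exact ker_eq_map_of_isLocalization (M := (stalkPrime (h.map i.continuous)).primeCompl)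
    (M' := (stalkPrime h).primeCompl) (i.stalkMap x).hom (i.stalkMap y).hom
    (i.stalkMap_surjective x) (i.stalkSpecializes_stalkMap_apply y x h)

theorem exists_stalkPrime_eq_of_stalkIdeal_le (i : X ⟶ Z) [IsClosedImmersion i] (x : X)
    {P : Ideal (Z.presheaf.stalk (i x))} (hP : P.IsPrime) (hle : stalkIdeal i x ≤ P) :
    ∃ (y : X) (h : y ⤳ x), stalkPrime (h.map i.continuous) = P := by
  have hs : Function.Surjective (i.stalkMap x).hom := i.stalkMap_surjective x
  obtain ⟨y, h, hy⟩ := exists_stalkPrime_eq x _ (Ideal.map_isPrime_of_surjective hs hle)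
  refine ⟨y, h, ?_⟩
  rw [stalkPrime_map i h, hy, Ideal.comap_map_of_surjective _ hs, ← RingHom.ker_eq_comap_bot]
  exact sup_eq_left.2 hle

end ClosedSubscheme

/-! ### Étale square roots of units -/

section SquareRoot
open IsLocalRing Polynomial

/-- `X² - g` with its derivative `2 X` inverted is a standard étale algebra. A square root of `g` in
an algebraic closure of `K` is a geometric point of it, and the kernel of this point is the prime
sought. -/
theorem exists_prime_sqrt {A K : Type u} [CommRing A] [Field K] (χ : A →+* K) {g : A}
    (h2 : (2 : K) ≠ 0) (hg : χ g ≠ 0) :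
    ∃ (B : Type u) (_ : CommRing B) (_ : Algebra A B) (Q : Ideal B) (x : B), Algebra.Etale A B ∧
      Q.IsPrime ∧ Q.comap (algebraMap A B) = RingHom.ker χ ∧ x ^ 2 = algebraMap A B g := by
  let P : StandardEtalePair A :=
    { f := X ^ 2 - C g
      monic_f := monic_X_pow_sub_C g two_ne_zero
      g := derivative (X ^ 2 - C g)
      cond := ⟨1, 0, 1, by rw [mul_one, mul_zero, add_zero, pow_one]⟩ }
  let := ((algebraMap K (AlgebraicClosure K)).comp χ).toAlgebra
  obtain ⟨y, hy⟩ := IsAlgClosed.exists_pow_nat_eq (algebraMap A (AlgebraicClosure K) g) two_pos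
  have hg' : algebraMap A (AlgebraicClosure K) g ≠ 0 :=
    fun h => hg ((map_eq_zero (algebraMap K (AlgebraicClosure K))).1 h)
  have hmap : P.HasMap y := by
    constructor
    · simp [P, hy]
    · have h2' : (2 : AlgebraicClosure K) ≠ 0 := fun h =>
        h2 ((map_eq_zero (algebraMap K (AlgebraicClosure K))).1 (by rw [map_ofNat, h]))
      have hy0 : y ≠ 0 := by
        rintro rfl
        exact hg' (by rw [← hy]; simp)
      have e : aeval y P.g = 2 * y := by
        simp only [P, derivative_sub, derivative_X_pow, derivative_C, sub_zero, map_mul,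
          aeval_X, Nat.cast_ofNat, Nat.add_one_sub_one, pow_one]
        rw [aeval_C, map_ofNat]
      rw [e]
      exact (mul_ne_zero h2' hy0).isUnit
  refine ⟨P.Ring, inferInstance, inferInstance, RingHom.ker (P.lift y hmap), P.X, inferInstance,
    RingHom.ker_isPrime _, ?_, ?_⟩
  · ext r
    rw [Ideal.mem_comap, RingHom.mem_ker, AlgHom.commutes, RingHom.mem_ker]
    exact map_eq_zero (algebraMap K (AlgebraicClosure K))
  · have := P.hasMap_X.1
    simpa [P, sub_eq_zero] using this

theorem exists_etale_sqrt {Z : Scheme.{u}} (a : Z) (h2 : IsUnit (2 : Z.presheaf.stalk a))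
    {v : Z.presheaf.stalk a} (hv : IsUnit v) :
    ∃ (U : Scheme.{u}) (ψ : U ⟶ Z) (_ : Etale ψ) (b : U) (hb : ψ b = a) (σ : U.presheaf.stalk b),
      σ ^ 2 = (Z.presheaf.stalkSpecializes (specializes_of_eq hb) ≫ ψ.stalkMap b).hom v := by
  obtain ⟨V₀, ha₀, g₀, hg₀⟩ := Z.presheaf.exists_germ_eq v
  obtain ⟨_, ⟨V, hV', rfl⟩, haV, hVV⟩ :=
    Z.isBasis_affineOpens.exists_subset_of_mem_open ha₀ V₀.2
  have hV : IsAffineOpen V := hV'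
  have hle : V ≤ V₀ := hVV
  obtain ⟨g, hg⟩ : ∃ g, Z.presheaf.germ V a haV g = v := by
    refine ⟨Z.presheaf.map (homOfLE hle).op g₀, ?_⟩
    exact (TopCat.Presheaf.germ_res_apply _ _ _ haV _).trans hg₀
  let χ : Γ(Z, V) →+* ResidueField (Z.presheaf.stalk a) :=
    (residue (Z.presheaf.stalk a)).comp (Z.presheaf.germ V a haV).hom
  obtain ⟨B, _, _, Q, x, hB, hQ, hQχ, hx⟩ := exists_prime_sqrt χ (g := g)
    (by rw [← map_ofNat (residue (Z.presheaf.stalk a))]; exact (h2.map _).ne_zero)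
    (by
      have : χ g = residue _ v := congrArg (residue (Z.presheaf.stalk a)) hg
      rw [this]
      exact (hv.map _).ne_zero)
  let φ : Γ(Z, V) ⟶ CommRingCat.of B := CommRingCat.ofHom (algebraMap Γ(Z, V) B)
  have hφ : Etale (Spec.map φ) := by
    rw [HasRingHomProperty.Spec_iff (P := @Etale)]
    exact RingHom.etale_algebraMap.2 hB
  let b : ↥(Spec (CommRingCat.of B)) := (⟨Q, hQ⟩ : PrimeSpectrum B)
  have hb : Spec.map φ b = hV.primeIdealOf ⟨a, haV⟩ := by
    rw [hV.primeIdealOf_eq_map_closedPoint]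
    refine PrimeSpectrum.ext (hQχ.trans ?_)
    ext r
    rw [RingHom.mem_ker]
    exact residue_eq_zero_iff _
  have hb' : (Spec.map φ ≫ hV.fromSpec) b = a := by
    rw [Scheme.Hom.comp_apply, hb, hV.fromSpec_primeIdealOf]
  refine ⟨Spec (CommRingCat.of B), Spec.map φ ≫ hV.fromSpec, Etale.etale_comp (Spec.map φ) hV.fromSpec, b, hb', ?_⟩
  have htop : ⊤ ≤ (Spec.map φ ≫ hV.fromSpec) ⁻¹ᵁ V := by
    rw [Scheme.Hom.comp_preimage, hV.fromSpec_preimage_self]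
    exact le_rfl
  have happ : (Spec.map φ ≫ hV.fromSpec).appLE V ⊤ htop =
      φ ≫ (Scheme.ΓSpecIso (CommRingCat.of B)).inv := by
    rw [Scheme.Hom.comp_appLE, hV.fromSpec_app_self, Category.assoc]
    have h1 := Scheme.Hom.map_appLE (Spec.map φ)
      (show ⊤ ≤ Spec.map φ ⁻¹ᵁ (hV.fromSpec ⁻¹ᵁ V) from htop)
      (eqToHom hV.fromSpec_preimage_self).op
    have h2 : (Spec.map φ).appTop = (Spec.map φ).appLE ⊤ ⊤ le_top := Scheme.Hom.app_eq_appLE _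
    refine (congrArg ((Scheme.ΓSpecIso Γ(Z, V)).inv ≫ ·) (h1.trans h2.symm)).trans ?_
    exact (Scheme.ΓSpecIso_inv_naturality φ).symm
  have key : Z.presheaf.germ V a haV ≫ Z.presheaf.stalkSpecializes (specializes_of_eq hb') ≫
      (Spec.map φ ≫ hV.fromSpec).stalkMap b =
      φ ≫ (Scheme.ΓSpecIso (CommRingCat.of B)).inv ≫
        (Spec (CommRingCat.of B)).presheaf.germ ⊤ b trivial := by
    rw [TopCat.Presheaf.germ_stalkSpecializes_assoc, Scheme.Hom.germ_stalkMap, ← Category.assoc φ,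
      ← happ, Scheme.Hom.appLE, Category.assoc]
    exact congrArg ((Spec.map φ ≫ hV.fromSpec).app V ≫ ·)
      ((Spec (CommRingCat.of B)).presheaf.germ_res (homOfLE htop) b trivial).symm
  refine ⟨((Scheme.ΓSpecIso (CommRingCat.of B)).inv ≫
        (Spec (CommRingCat.of B)).presheaf.germ ⊤ b trivial).hom x, ?_⟩
  rw [← map_pow, hx, ← hg]
  exact (congrArg (fun f => f.hom g) key).symm

end SquareRoot


/-! ### Stalk homomorphisms of étale maps -/

section EtaleStalks
open IsLocalRing

variable {U Z : Scheme.{u}}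

/-- The map from the local ring of `Z` at `a` to the local ring of `U` at `b`, if `ψ b`
specializes to `a`. -/
noncomputable def stalkHom (ψ : U ⟶ Z) {b : U} {a : Z} (h : ψ b ⤳ a) :
    Z.presheaf.stalk a →+* U.presheaf.stalk b :=
  (Z.presheaf.stalkSpecializes h ≫ ψ.stalkMap b).hom

theorem etaleGermHom_stalkHom (ψ : U ⟶ Z) [Etale ψ] [IsLocallyNoetherian U] {b : U} {a : Z}
    (hb : ψ b = a) :
    EtaleGermHom (maximalIdeal (Z.presheaf.stalk a)) (stalkHom ψ (specializes_of_eq hb)) := by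
  subst hb
  have : stalkHom ψ (specializes_of_eq (rfl : ψ b = ψ b)) = (ψ.stalkMap b).hom := by
    rw [stalkHom, TopCat.Presheaf.stalkSpecializes_refl, Category.id_comp]
  rw [this]
  exact etaleGermHom_stalkMap ψ b

theorem stalkSpecializes_stalkHom (ψ : U ⟶ Z) {y b : U} {a : Z} (h : ψ b ⤳ a) (hy : y ⤳ b)
    (h' : ψ y ⤳ a) (f : Z.presheaf.stalk a) :
    (U.presheaf.stalkSpecializes hy).hom (stalkHom ψ h f) = stalkHom ψ h' f := by
  have : (Z.presheaf.stalkSpecializes h ≫ ψ.stalkMap b) ≫ U.presheaf.stalkSpecializes hy =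
      Z.presheaf.stalkSpecializes h' ≫ ψ.stalkMap y := by
    rw [Category.assoc, ← ψ.stalkSpecializes_stalkMap y b hy,
      TopCat.Presheaf.stalkSpecializes_comp_assoc]
  exact congrArg (fun g => g.hom f) this

theorem stalkHom_stalkSpecializes (ψ : U ⟶ Z) {b : U} {y a : Z} (h : ψ b ⤳ y) (hy : y ⤳ a)
    (f : Z.presheaf.stalk a) :
    stalkHom ψ h ((Z.presheaf.stalkSpecializes hy).hom f) = stalkHom ψ (h.trans hy) f := by
  have : Z.presheaf.stalkSpecializes hy ≫ Z.presheaf.stalkSpecializes h ≫ ψ.stalkMap b =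
      Z.presheaf.stalkSpecializes (h.trans hy) ≫ ψ.stalkMap b := by
    rw [TopCat.Presheaf.stalkSpecializes_comp_assoc]
  exact congrArg (fun g => g.hom f) this

variable {k : Type u} [Field k] [CharZero k]

theorem stalkHom_mem_sq_iff (p : Z ⟶ Spec (CommRingCat.of k)) [Smooth p] (ψ : U ⟶ Z) [Etale ψ] [IsLocallyNoetherian U] {b : U} {a : Z}
    (hb : ψ b = a) {f : Z.presheaf.stalk a} :
    stalkHom ψ (specializes_of_eq hb) f ∈ maximalIdeal (U.presheaf.stalk b) ^ 2 ↔
      f ∈ maximalIdeal (Z.presheaf.stalk a) ^ 2 := by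
  obtain ⟨n, h⟩ := exists_germ_stalk p a
  have hψ := etaleGermHom_stalkHom ψ hb
  rw [← (hψ.germ h).eq_maximalIdeal]
  exact hψ.mem_pow_iff h

theorem ringKrullDim_stalk_eq (p : Z ⟶ Spec (CommRingCat.of k)) [Smooth p] (ψ : U ⟶ Z) [Etale ψ] [IsLocallyNoetherian U] {b : U} {a : Z}
    (hb : ψ b = a) : ringKrullDim (U.presheaf.stalk b) = ringKrullDim (Z.presheaf.stalk a) := by
  obtain ⟨n, h⟩ := exists_germ_stalk p a
  rw [((etaleGermHom_stalkHom ψ hb).germ h).ringKrullDim_eq, h.ringKrullDim_eq]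

end EtaleStalks

/-! ### From local algebra to hypersurfaces in schemes -/

section Hypersurface
open IsLocalRing

variable {k : Type u} [Field k] [CharZero k] {X Z : Scheme.{u}}

theorem stalkIdeal_le (i : X ⟶ Z) (x : X) :
    stalkIdeal i x ≤ maximalIdeal (Z.presheaf.stalk (i x)) :=
  le_maximalIdeal (RingHom.ker_ne_top _)

theorem mem_singularSet_iff (p : Z ⟶ Spec (CommRingCat.of k)) [Smooth p] (i : X ⟶ Z) [IsClosedImmersion i]
    (hX : IsHypersurface i) {y x : X} (h : y ⤳ x)
    {f : Z.presheaf.stalk (i x)} (hf : stalkIdeal i x = Ideal.span {f}) :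
    y ∈ singularSet X ↔ (Z.presheaf.stalkSpecializes (h.map i.continuous)).hom f ∈
      maximalIdeal (Z.presheaf.stalk (i y)) ^ 2 := by
  obtain ⟨g, hg0, hg⟩ := hX y
  obtain ⟨n, hn⟩ := exists_germ_stalk p (i y)
  have hgm : g ∈ maximalIdeal (Z.presheaf.stalk (i y)) :=
    stalkIdeal_le i y (hg ▸ Ideal.mem_span_singleton_self g)
  have h1 := stalkIdeal_specializes i h
  rw [hf, Ideal.map_span, Set.image_singleton, hg] at h1
  rw [singularSet, Set.mem_ofPred_eq, hn.isRegularLocalRing_iff (i.stalkMap_surjective y) hgm hg0 hg,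
    not_not, ← Ideal.span_singleton_le_iff_mem, h1, Ideal.span_singleton_le_iff_mem]

/-- Both statements are checked upstairs on `U`. Choices for `X` at `x` pull back to `U`, where
every choice gives `s₀`. Singular points and their dimensions are transported in both directions,
since étale maps preserve dimension and membership in the square of the maximal ideal. -/
theorem HasEtaleEquation.inv_eq_and_codimAt_eq (p : Z ⟶ Spec (CommRingCat.of k)) [Smooth p] (i : X ⟶ Z) [IsClosedImmersion i]
    (hX : IsHypersurface i) {x : X}
    {F : MvPolynomial (Fin 3) ℤ} (hF : HasEtaleEquation i x F) {s₀ : List (WithTop ℚ)}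
    (hinv : ∀ {R : Type u} [CommRing R] {φ : k →+* R} {𝔪 : Ideal R} {m : ℕ}
      (_ : Germ φ 𝔪 (m + 3)) {T : Fin (m + 3) → R} (_ : Ideal.span (Set.range T) = 𝔪)
      {s : List (WithTop ℚ)},
      HasInv φ 𝔪 (Ideal.span {MvPolynomial.aeval ![T 0, T 1, T 2] F}) 1 s → s = s₀)
    (hsing : ∀ {R : Type u} [CommRing R] {φ : k →+* R} {𝔪 : Ideal R} {m : ℕ}
      (_ : Germ φ 𝔪 (m + 3)) {T : Fin (m + 3) → R} (_ : Ideal.span (Set.range T) = 𝔪) {f : R}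
      (_ : f = MvPolynomial.aeval ![T 0, T 1, T 2] F),
      ∃ (z w : R) (o : Fin (m + 1) → R), Ideal.span (insert z (insert w (Set.range o))) = 𝔪 ∧
        f ∈ Ideal.span {z, w} ^ 2 ∧
        ∀ P : Ideal R, P.IsPrime → (∀ D : Derivation ℤ R R, D f ∈ P) → z ∈ P ∧ w ∈ P) :
    inv p i x = s₀ ∧ codimAt i (singularSet X) x = 2 := by
  obtain ⟨U, ψ, _, b, hb, m, T, hdim, hT, hI⟩ := hF
  have : IsLocallyNoetherian U := LocallyOfFiniteType.isLocallyNoetherian (ψ ≫ p)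
  have hψ := etaleGermHom_stalkHom ψ hb
  change (stalkIdeal i x).map (stalkHom ψ (specializes_of_eq hb)) = _ at hI
  obtain ⟨N, h⟩ := exists_germ_stalk p (i x)
  have hG := hψ.germ h
  obtain rfl : N = m + 3 := by
    rw [hG.ringKrullDim_eq] at hdim
    exact_mod_cast hdim
  have hm := hG.eq_maximalIdeal
  obtain ⟨f, -, hf⟩ := hX x
  obtain ⟨F', hF'⟩ : ∃ F', F' = MvPolynomial.aeval ![T 0, T 1, T 2] F := ⟨_, rfl⟩
  obtain ⟨z, w, o, ho, hFsq, hder⟩ := hsing hG (hT.trans hm.symm) hF'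
  rw [← hF'] at hI
  have hIf := hI
  rw [hf, Ideal.map_span, Set.image_singleton] at hIf
  constructor
  · obtain ⟨s, hs⟩ := h.exists_hasInv (stalkIdeal_le i x) 1
    have huniq : ∀ t, HasInv (scalars p (i x)) (maximalIdeal (Z.presheaf.stalk (i x)))
        (stalkIdeal i x) 1 t → t = s₀ := fun t ht => by
      have h1 := hasInv_map ht h hψ
      rw [hI, hF'] at h1
      exact hinv hG (hT.trans hm.symm) h1
    have hex : ∃! t, HasInv (scalars p (i x)) (maximalIdeal (Z.presheaf.stalk (i x)))
        (stalkIdeal i x) 1 t := ⟨s, hs, fun t ht => (huniq t ht).trans (huniq s hs).symm⟩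
    rw [inv, dif_pos hex]
    exact huniq _ hex.choose_spec.1
  · apply le_antisymm
    · have hP := hG.isPrime_span_pair (m := m + 1) ho
      -- Upper bound: the image in `Z` of the point of `U` with prime `(z, w)` lies on `X`, is
      -- singular there, and has a local ring of dimension at most 2.
      obtain ⟨y', hy', hP'⟩ := exists_stalkPrime_eq b _ hP
      have hy : ψ y' ⤳ i x := (hy'.map ψ.continuous).trans (specializes_of_eq hb)
      have h1 : (U.presheaf.stalkSpecializes hy').hom F' ∈
          maximalIdeal (U.presheaf.stalk y') ^ 2 := by
        rw [stalkSpecializes_mem_sq_iff, hP']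
        exact ⟨1, hP.one_notMem, by rwa [one_mul]⟩
      have h2 : (U.presheaf.stalkSpecializes hy').hom (stalkHom ψ (specializes_of_eq hb) f) ∈
          maximalIdeal (U.presheaf.stalk y') ^ 2 := by
        have : stalkHom ψ (specializes_of_eq hb) f ∈ Ideal.span {F'} :=
          hIf ▸ Ideal.mem_span_singleton_self _
        obtain ⟨c, hc⟩ := Ideal.mem_span_singleton'.1 this
        rw [← hc, map_mul]
        exact Ideal.mul_mem_left _ _ h1
      rw [stalkSpecializes_stalkHom ψ _ hy' hy, ← stalkHom_stalkSpecializes ψ specializes_rfl hy,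
        stalkHom_mem_sq_iff p ψ rfl, stalkSpecializes_mem_sq_iff] at h2
      obtain ⟨s, hs, hsf⟩ := h2
      have hfP : f ∈ stalkPrime hy :=
        ((inferInstance : (stalkPrime hy).IsPrime).mem_or_mem
          (Ideal.pow_le_self two_ne_zero hsf)).resolve_left hs
      obtain ⟨y, hyx, hyP⟩ := exists_stalkPrime_eq_of_stalkIdeal_le i x
        (P := stalkPrime hy) inferInstance (by rwa [hf, Ideal.span_singleton_le_iff_mem])
      have hys : y ∈ singularSet X := by
        rw [mem_singularSet_iff p i hX hyx hf, stalkSpecializes_mem_sq_iff, hyP]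
        exact ⟨s, hs, hsf⟩
      refine (iInf₂_le y ⟨hys, hyx⟩).trans ?_
      rw [ringKrullDim_stalk_eq_height (hyx.map i.continuous), hyP, ← ringKrullDim_stalk_eq_height hy,
        ← ringKrullDim_stalk_eq p ψ rfl, ringKrullDim_stalk_eq_height hy', hP']
      have := hG.isNoetherianRing
      have h3 := (Ideal.span {z, w}).height_le_spanFinrank hP.ne_top
      have h4 := Submodule.spanFinrank_span_le_ncard_of_finite (R := U.presheaf.stalk b)
        (Set.toFinite {z, w})
      have h5 : (Ideal.span {z, w}).height ≤ 2 :=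
        h3.trans (by exact_mod_cast h4.trans ((Set.ncard_insert_le z {w}).trans (by rw [Set.ncard_singleton])))
      exact WithBot.coe_le_coe.2 h5
    · refine le_iInf₂ fun y hy => ?_
      obtain ⟨hys, hyx⟩ := hy
      rw [mem_singularSet_iff p i hX hyx hf] at hys
      have hflat : Flat ψ := inferInstance
      -- Lower bound: by flatness a singular generization of `x` lifts to a generization of `b`. Its
      -- prime contains all first derivatives of the equation, hence `z` and `w`.
      obtain ⟨y', hy', hψy⟩ := Flat.generalizingMap ψ
        ((hyx.map i.continuous).trans (specializes_of_eq hb.symm))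
      rw [← stalkHom_mem_sq_iff p ψ hψy, stalkHom_stalkSpecializes,
        ← stalkSpecializes_stalkHom ψ (specializes_of_eq hb) hy'] at hys
      rw [← ringKrullDim_stalk_eq p ψ hψy, ringKrullDim_stalk_eq_height hy']
      have h1 : (U.presheaf.stalkSpecializes hy').hom F' ∈
          maximalIdeal (U.presheaf.stalk y') ^ 2 := by
        have : F' ∈ Ideal.span {stalkHom ψ (specializes_of_eq hb) f} :=
          hIf ▸ Ideal.mem_span_singleton_self _
        obtain ⟨c, hc⟩ := Ideal.mem_span_singleton'.1 this
        rw [← hc, map_mul]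
        exact Ideal.mul_mem_left _ _ hys
      obtain ⟨s, hs, hsF⟩ := (stalkSpecializes_mem_sq_iff hy' F').1 h1
      have hprime : (stalkPrime hy').IsPrime := inferInstance
      obtain ⟨hz, hw⟩ := hder _ hprime fun D => derivation_mem_of_mul_mem_sq hprime hs hsF D
      exact WithBot.coe_le_coe.2 (hG.two_le_height (m := m + 1) ho hprime hz hw)

/-- The converse needs only one sequence of choices with the prescribed value, and a value other
than the junk `[]` guarantees it. -/
theorem hasInv_of_inv_eq (p : Z ⟶ Spec (CommRingCat.of k)) [Smooth p] (i : X ⟶ Z) [IsClosedImmersion i]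
    {x : X} {s : List (WithTop ℚ)} (hs : s ≠ []) (h : inv p i x = s) :
    HasInv (scalars p (i x)) (maximalIdeal (Z.presheaf.stalk (i x))) (stalkIdeal i x) 1 s := by
  rw [inv] at h
  split_ifs at h with hex
  · rw [← h]
    exact hex.choose_spec.1
  · exact absurd h.symm hs

theorem exists_normal_form_of_inv_eq (p : Z ⟶ Spec (CommRingCat.of k)) [Smooth p] (i : X ⟶ Z) [IsClosedImmersion i]
    (hX : IsHypersurface i) {x : X} {q : ℕ} (hq : q = 1 ∨ q = 2)
    (hinv : inv p i x = [2, 0, ((3 / 2 : ℚ) : WithTop ℚ), 0, ((q : ℚ) : WithTop ℚ), 0, ⊤])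
    (hcodim : codimAt i (singularSet X) x = 2) :
    ∃ (m : ℕ) (z y t : Z.presheaf.stalk (i x)) (o : Fin m → Z.presheaf.stalk (i x))
      (d l α γ : Z.presheaf.stalk (i x)),
      Germ (scalars p (i x)) (maximalIdeal (Z.presheaf.stalk (i x))) (m + 3) ∧
      Ideal.span (insert z (insert y (insert t (Set.range o)))) =
        maximalIdeal (Z.presheaf.stalk (i x)) ∧
      IsUnit d ∧ IsUnit l ∧ (q = 2 → IsUnit α) ∧
      stalkIdeal i x = Ideal.span {d * (z ^ 2 + (α * y + l * t ^ q + γ * z) * y ^ 2)} := by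
  obtain ⟨n, h⟩ := exists_germ_stalk p (i x)
  obtain ⟨f, -, hf⟩ := hX x
  have hI := hasInv_of_inv_eq p i (by simp) hinv
  obtain ⟨y, ⟨hys, hyx⟩, hdim⟩ : ∃ y : X, (y ∈ singularSet X ∧ y ⤳ x) ∧
      ringKrullDim (Z.presheaf.stalk (i y)) ≤ 2 := by
    -- The dimensions involved are natural numbers, so if all exceeded 2 the infimum would be at
    -- least 3. This also covers an empty family of points.
    by_contra! H
    have h3 : (3 : WithBot ℕ∞) ≤ codimAt i (singularSet X) x := by
      refine le_iInf₂ fun y hy => ?_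
      have h1 := H y hy
      obtain ⟨r, hr⟩ := exists_germ_stalk p (i y)
      rw [hr.ringKrullDim_eq] at h1 ⊢
      have h2 : 2 < r := by exact_mod_cast h1
      exact_mod_cast h2
    rw [hcodim] at h3
    exact absurd h3 (by decide)
  rw [mem_singularSet_iff p i hX hyx hf, stalkSpecializes_mem_sq_iff] at hys
  obtain ⟨s, hs, hsf⟩ := hys
  rw [ringKrullDim_stalk_eq_height (hyx.map i.continuous)] at hdim
  rw [hf] at hI
  obtain ⟨m, z, y, t, o, d, l, α, γ, rfl, ho, hd, hl, hα, e⟩ :=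
    h.exists_normal_form hq inferInstance (WithBot.coe_le_coe.1 hdim) hs hsf hI
  exact ⟨m, z, y, t, o, d, l, α, γ, h, ho, hd, hl, hα, by rw [hf, e]⟩

theorem hasEtaleEquation_of_coordinates (p : Z ⟶ Spec (CommRingCat.of k)) [Smooth p] (i : X ⟶ Z) [IsClosedImmersion i]
    {x : X} {F : MvPolynomial (Fin 3) ℤ} {U : Scheme.{u}}
    (ψ : U ⟶ Z) [Etale ψ] {b : U} (hb : ψ b = i x) {m : ℕ}
    (h : Germ (scalars p (i x)) (maximalIdeal (Z.presheaf.stalk (i x))) (m + 3))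
    (hT : ∃ T : Fin (m + 3) → U.presheaf.stalk b, Ideal.span (Set.range T) =
      (maximalIdeal (Z.presheaf.stalk (i x))).map (stalkHom ψ (specializes_of_eq hb)) ∧
      (stalkIdeal i x).map (stalkHom ψ (specializes_of_eq hb)) =
        Ideal.span {MvPolynomial.aeval ![T 0, T 1, T 2] F}) :
    HasEtaleEquation i x F := by
  have : IsLocallyNoetherian U := LocallyOfFiniteType.isLocallyNoetherian (ψ ≫ p)
  have hG := (etaleGermHom_stalkHom ψ hb).germ h
  obtain ⟨T, hT, hI⟩ := hT
  exact ⟨U, ψ, inferInstance, b, hb, m, T, hG.ringKrullDim_eq, hT.trans hG.eq_maximalIdeal, hI⟩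

end Hypersurface

/-! ### The two equivalences -/

section PinchPoints
open IsLocalRing

theorem map_span_params {R A : Type u} [CommRing R] [CommRing A] (θ : R →+* A) {m : ℕ} (z y t : R)
    (o : Fin m → R) : (Ideal.span (insert z (insert y (insert t (Set.range o))))).map θ =
      Ideal.span (insert (θ z) (insert (θ y) (insert (θ t) (Set.range (θ ∘ o))))) := by
  rw [Ideal.map_span, Set.image_insert_eq, Set.image_insert_eq, Set.image_insert_eq,
    ← Set.range_comp]

variable {k : Type u} [Field k] [CharZero k] {X Z : Scheme.{u}}

theorem isPinchPoint_iff (p : Z ⟶ Spec (CommRingCat.of k)) [Smooth p] (i : X ⟶ Z)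
    [IsClosedImmersion i] (hX : IsHypersurface i) (x : X) :
    IsPinchPoint i x ↔ inv p i x =
        [2, 0, ((3 / 2 : ℚ) : WithTop ℚ), 0, (((1 : ℕ) : ℚ) : WithTop ℚ), 0, ⊤] ∧
      codimAt i (singularSet X) x = 2 := by
  refine ⟨fun h => h.inv_eq_and_codimAt_eq p i hX (fun h _ hT _ hs => h.hasInv_pinch hT hs)
    (fun h _ hT _ hf => h.singular_pinch hT hf), fun ⟨hinv, hcodim⟩ => ?_⟩
  obtain ⟨m, z, y, t, o, d, l, α, γ, h, ho, hd, hl, -, hI⟩ :=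
    exists_normal_form_of_inv_eq p i hX (Or.inl rfl) hinv hcodim
  have hb : (𝟙 Z : Z ⟶ Z) (i x) = i x := rfl
  -- For pinch points no root is extracted: the coordinates exist in the local ring of `Z` itself.
  refine hasEtaleEquation_of_coordinates p i (𝟙 Z) hb h ?_
  let θ := stalkHom (𝟙 Z) (specializes_of_eq hb)
  obtain ⟨T, hT, hF⟩ := exists_pinch_coordinates (z := θ z) (y := θ y) (t := θ t) (α := θ α)
    (γ := θ γ) (θ ∘ o) (hd.map θ) (hl.map θ)
  refine ⟨T, ?_, ?_⟩
  · rw [hT, ← ho, map_span_params]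
  · rw [← hF, hI, Ideal.map_span, Set.image_singleton]
    simp only [map_mul, map_add, map_pow, θ]

theorem isDegeneratePinchPoint_iff (p : Z ⟶ Spec (CommRingCat.of k)) [Smooth p] (i : X ⟶ Z)
    [IsClosedImmersion i] (hX : IsHypersurface i) (x : X) :
    IsDegeneratePinchPoint i x ↔ inv p i x =
        [2, 0, ((3 / 2 : ℚ) : WithTop ℚ), 0, (((2 : ℕ) : ℚ) : WithTop ℚ), 0, ⊤] ∧
      codimAt i (singularSet X) x = 2 := by
  refine ⟨fun h => h.inv_eq_and_codimAt_eq p i hX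
    (fun h _ hT _ hs => h.hasInv_degenerate_pinch hT hs)
    (fun h _ hT _ hf => h.singular_degenerate_pinch hT hf), fun ⟨hinv, hcodim⟩ => ?_⟩
  obtain ⟨m, z, y, t, o, d, l, α, γ, h, ho, hd, hl, hα, hI⟩ :=
    exists_normal_form_of_inv_eq p i hX (Or.inr rfl) hinv hcodim
  obtain ⟨l', hl'⟩ := hl.exists_right_inv
  have hl'u : IsUnit l' := IsUnit.of_mul_eq_one l (by rw [mul_comm, hl'])
  -- The étale neighbourhood adjoins `σ` with `σ² = 3 / l`, which matches the coefficient `3 t²` of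
  -- the model.
  obtain ⟨U, ψ, _, b, hb, σ, hσ⟩ := exists_etale_sqrt (i x) (h.isUnit_ofNat 2)
    ((h.isUnit_ofNat 3).mul hl'u)
  have : IsLocallyNoetherian U := LocallyOfFiniteType.isLocallyNoetherian (ψ ≫ p)
  refine hasEtaleEquation_of_coordinates p i ψ hb h ?_
  let θ := stalkHom ψ (specializes_of_eq hb)
  have hσ' : θ l * σ ^ 2 = 3 := by
    rw [hσ]
    refine (map_mul θ _ _).symm.trans ?_
    rw [mul_left_comm, hl', mul_one, map_ofNat]
  have hG := (etaleGermHom_stalkHom ψ hb).germ h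
  obtain ⟨T, hT, hF⟩ := exists_degenerate_pinch_coordinates hG (z := θ z) (y := θ y) (t := θ t)
    (γ := θ γ) (θ ∘ o) (by rw [← map_span_params, ho]) (hd.map θ) ((hα rfl).map θ) hσ'
  refine ⟨T, hT, ?_⟩
  rw [← hF, hI, Ideal.map_span, Set.image_singleton]
  simp only [map_mul, map_add, map_pow, θ]

end PinchPoints
end YearZero

theorem mainTheorem7 {k : Type u} [Field k] [CharZero k] {X Z : Scheme.{u}}
    (p : Z ⟶ Spec (CommRingCat.of k)) [Smooth p] (i : X ⟶ Z) [IsClosedImmersion i]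
    (hX : YearZero.IsHypersurface i) (a : X) :
    (YearZero.IsPinchPoint i a ↔
      YearZero.inv p i a = [2, 0, ((3 / 2 : ℚ) : WithTop ℚ), 0, 1, 0, ⊤] ∧
        YearZero.codimAt i (YearZero.singularSet X) a = 2) ∧
    (YearZero.IsDegeneratePinchPoint i a ↔
      YearZero.inv p i a = [2, 0, ((3 / 2 : ℚ) : WithTop ℚ), 0, 2, 0, ⊤] ∧
        YearZero.codimAt i (YearZero.singularSet X) a = 2) := by
  have h1 : (((1 : ℕ) : ℚ) : WithTop ℚ) = 1 := by rw [Nat.cast_one, WithTop.coe_one]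
  rw [← h1]
  exact ⟨YearZero.isPinchPoint_iff p i hX a, YearZero.isDegeneratePinchPoint_iff p i hX a⟩
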